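/- Let $a<b$, $\mu_l=\frac{2\pi l}{b-a}$ for $l\in\mathbb Z$, and for $(b-a)$-periodic $u$ let $\widehat u_l=\frac1{b-a}\int_a^b u(x)e^{-i\mu_l(x-a)}\,dx$ and $\|u\|_{H^s}=\big(\sum_{l\in\mathbb Z}(1+\mu_l^2)^s|\widehat u_l|^2\big)^{1/2}$; $H^s_{\rm per}$ is the space of periodic $u\in L^2(a,b)$ with $\|u\|_{H^s}<\infty$. Fix an integer $m\ge5$, reals $T>0$, $R$, $\alpha\in(0,1)$, $\nu>0$, and a sign $\sigma\in\{1,-1\}$. For $\varepsilon\in(0,1]$ put $T_\varepsilon=T/\varepsilon^2$ and consider solutions $\psi$ on $[0,T_\varepsilon]$ of the periodic problem $$ i\partial_t\psi=-\partial_{xx}\psi+\sigma\varepsilon^2|\psi|^2\psi,\qquad \|\psi\|_{L^\infty([0,T_\varepsilon];H^m_{\rm per})}\le R,\quad \|\partial_t\psi\|_{L^\infty([0,T_\varepsilon];H^{m-2}_{\rm per})}\le R, $$ and put $M=\|\psi\|_{L^\infty([0,T_\varepsilon];H^1)}$. For an even integer $N>0$ let $h=(b-a)/N$, $x_j=a+jh$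 $(0\le j\le N)$, $\mathcal T_N=\{-\frac N2,\dots,\frac N2-1\}$, and for a grid function $u$ let $\widetilde u_l=\frac1N\sum_{j=0}^{N-1}u_je^{-i\mu_l(x_j-a)}$ and $I_Nu(x)=\sum_{l\in\mathcal T_N}\widetilde u_le^{i\mu_l(x-a)}$. For a step size $\tau>0$ and $t_n=n\tau$, the time-splitting Fourier pseudospectral (TSFP) approximation is given by $\psi^0_j=\psi(x_j,0)$ and $$\psi^{(1)}_j=\sum_{l\in\mathcal T_N}e^{-i\tau\mu_l^2/2}\,\widetilde{(\psi^n)}_l\,e^{i\mu_l(x_j-a)},\quad \psi^{(2)}_j=e^{-i\sigma\varepsilon^2\tau|\psi^{(1)}_j|^2}\psi^{(1)}_j,\quad \psi^{n+1}_j=\sum_{l\in\mathcal T_N}e^{-i\tau\mu_l^2/2}\,\widetilde{(\psi^{(2)})}_l\,e^{i\mu_l(x_j-a)}.$$ For $\tau_0\in(0,1)$ consider the following conditions on $\tau$: (S) $\displaystyle 0<\tau<\alpha\,\frac{\pi\,\tau_0^2}{\mu_1^2(1+\tau_0)^2}$; (NR) $\tau>0$ and $\displaystyle\Big|\tau-\frac{2l\pi}{\mu_1^2K}\Big|\ge\frac{\lambda}{|\mu_1^2K|^{2+\nu}}$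 for all integers $K,l$ with $0<|K|\le2\lceil1/\tau_0\rceil^2$ and $l\ge0$, where $\displaystyle\lambda=\frac{\alpha\pi\mu_1^{2+2\nu}}{4\sum_{k\ge1}k^{-(1+\nu)}}$. **(i)** There are constants $C,h_0,\tau_1>0$ and $\bar\tau_0\in(0,1)$, depending only on $a,b,\sigma,m,T,R,\alpha,\nu$, such that for all $\tau_0\in(0,\bar\tau_0]$, all $\varepsilon\in(0,1]$, all $\psi$ as above, all even $N>0$ with $h<h_0$, and all $0<\tau\le\tau_1/\varepsilon$ satisfying (S), or satisfying (NR) with $m\ge5+\nu$ and $m\ge3+2\nu$ (the latter is implied by the former if $\nu\le2$), one has for every integer $n\ge0$ with $t_n\le T_\varepsilon$ $$\|\psi(\cdot,t_n)-I_N\psi^n\|_{H^1}\le C\big(h^{m-1}+\varepsilon^2\tau^2+\tau_0^{m-1}\big),\qquad \|I_N\psi^n\|_{H^1}\le1+M .$$ **(ii)** If only $m\ge5+\nu$ is assumed, there are $C,h_0>0$ and $\bar\tau_0\in(0,1)$, depending only on $a,b,\sigma,m,T,R,\alpha,\nu$, and for every $\tau_0\in(0,\bar\tau_0]$ there are $D,\tau_1>0$,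 depending in addition on $\tau_0$, such that for all $\varepsilon\in(0,1]$, all $\psi$ as above, all even $N>0$ with $h<h_0$, all $0<\tau\le\tau_1/\varepsilon$ satisfying (NR), and all $n\ge0$ with $t_n\le T_\varepsilon$ $$\|\psi(\cdot,t_n)-I_N\psi^n\|_{H^1}\le C\big(h^{m-1}+\tau_0^{m-1}\big)+D\,\varepsilon^2\tau^2,\qquad \|I_N\psi^n\|_{H^1}\le1+M .$$ -/

import Mathlib

namespace NLSTSFP

/-- The frequency `μ_l = 2πl/(b-a)`. -/
noncomputable def mu (a b : ℝ) (l : ℤ) : ℝ := 2 * Real.pi * (l : ℝ) / (b - a)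

/-- The Fourier mode `e^{iμ_l(x-a)}`. -/
noncomputable def mode (a b : ℝ) (l : ℤ) (x : ℝ) : ℂ :=
  Complex.exp (Complex.I * ((mu a b l * (x - a) : ℝ) : ℂ))

/-- The Fourier coefficient `(1/(b-a)) ∫_a^b u(x) e^{-iμ_l(x-a)} dx`. -/
noncomputable def coeff (a b : ℝ) (u : ℝ → ℂ) (l : ℤ) : ℂ :=
  (1 / ((b - a : ℝ) : ℂ)) * ∫ x in a..b, u x * mode a b (-l) x

/-- The periodic Sobolev space `H^s_per(a,b)` of integer order; functions on `[a,b]` with periodic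
boundary conditions are identified with `(b-a)`-periodic functions on the line. -/
def MemHper (a b : ℝ) (s : ℕ) (u : ℝ → ℂ) : Prop :=
  Function.Periodic u (b - a) ∧
  MeasureTheory.MemLp u 2 (MeasureTheory.volume.restrict (Set.Ioc a b)) ∧
  Summable fun l : ℤ => (1 + mu a b l ^ 2) ^ s * ‖coeff a b u l‖ ^ 2

/-- The norm `(∑_l (1+μ_l²)^s |û_l|²)^{1/2}` on `H^s_per(a,b)`. -/
noncomputable def hNorm (a b : ℝ) (s : ℕ) (u : ℝ → ℂ) : ℝ :=
  Real.sqrt (∑' l : ℤ, (1 + mu a b l ^ 2) ^ s * ‖coeff a b u l‖ ^ 2)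

/-- The time derivative of `ψ(t, x)`, where `ψ t x` is the value at time `t` and point `x`. -/
noncomputable def timeDeriv (ψ : ℝ → ℝ → ℂ) (t x : ℝ) : ℂ := deriv (fun s => ψ s x) t

/-- `ψ` is a (classical) solution on `[0, S]` of `iψ_t = -ψ_xx + σ ε² |ψ|² ψ` with periodic
boundary conditions; the initial datum is `ψ 0`. -/
structure IsSolution (a b σ ε S : ℝ) (ψ : ℝ → ℝ → ℂ) : Prop where
  periodic : ∀ t ∈ Set.Icc 0 S, Function.Periodic (ψ t) (b - a)
  contDiff_space : ∀ t ∈ Set.Icc 0 S, ContDiff ℝ 2 (ψ t)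
  continuous_time : ∀ x, ContinuousOn (fun t => ψ t x) (Set.Icc 0 S)
  differentiable_time : ∀ t ∈ Set.Ioo 0 S, ∀ x, DifferentiableAt ℝ (fun s => ψ s x) t
  equation : ∀ t ∈ Set.Ioo 0 S, ∀ x,
    Complex.I * timeDeriv ψ t x =
      -iteratedDeriv 2 (ψ t) x + ((σ * ε ^ 2 * ‖ψ t x‖ ^ 2 : ℝ) : ℂ) * ψ t x

/-- `‖ψ‖_{L^∞([0,S];H^m)} ≤ R` and `‖∂_tψ‖_{L^∞([0,S];H^{m-2})} ≤ R`. -/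
def BoundedBy (a b : ℝ) (m : ℕ) (S R : ℝ) (ψ : ℝ → ℝ → ℂ) : Prop :=
  (∀ t ∈ Set.Icc 0 S, MemHper a b m (ψ t) ∧ hNorm a b m (ψ t) ≤ R) ∧
  (∀ t ∈ Set.Ioo 0 S,
    MemHper a b (m - 2) (timeDeriv ψ t) ∧ hNorm a b (m - 2) (timeDeriv ψ t) ≤ R)

/-- `‖ψ‖_{L^∞([0,S];H^1)}`. -/
noncomputable def supH1 (a b S : ℝ) (ψ : ℝ → ℝ → ℂ) : ℝ :=
  ⨆ t : Set.Icc (0 : ℝ) S, hNorm a b 1 (ψ t)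

/-- The mesh size `h = (b-a)/N`. -/
noncomputable def mesh (a b : ℝ) (N : ℕ) : ℝ := (b - a) / N

/-- The grid point `x_j = a + jh`. -/
noncomputable def gridPt (a b : ℝ) (N : ℕ) (j : ℕ) : ℝ := a + j * mesh a b N

/-- The index set `{-N/2, …, N/2-1}` (`N` even). -/
noncomputable def freqs (N : ℕ) : Finset ℤ := Finset.Ico (-((N : ℤ) / 2)) ((N : ℤ) / 2)

/-- The discrete Fourier coefficient `(1/N) ∑_{j=0}^{N-1} u_j e^{-iμ_l(x_j-a)}` of a grid
function `u = (u_0, …, u_N)`. -/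
noncomputable def discCoeff (a b : ℝ) (N : ℕ) (u : Fin (N + 1) → ℂ) (l : ℤ) : ℂ :=
  (1 / (N : ℂ)) * ∑ j : Fin N, u j.castSucc * mode a b (-l) (gridPt a b N j)

/-- The trigonometric interpolant `I_N u`. -/
noncomputable def interp (a b : ℝ) (N : ℕ) (u : Fin (N + 1) → ℂ) (x : ℝ) : ℂ :=
  ∑ l ∈ freqs N, discCoeff a b N u l * mode a b l x

/-- The free half step: multiply the `l`-th discrete coefficient by `e^{-iτμ_l²/2}`. -/
noncomputable def halfStep (a b : ℝ) (N : ℕ) (τ : ℝ) (u : Fin (N + 1) → ℂ) : Fin (N + 1) → ℂ :=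
  fun j => ∑ l ∈ freqs N,
    Complex.exp (-Complex.I * ((τ * mu a b l ^ 2 / 2 : ℝ) : ℂ)) * discCoeff a b N u l *
      mode a b l (gridPt a b N j)

/-- The nonlinear step `u_j ↦ e^{-iσε²τ|u_j|²} u_j`. -/
noncomputable def nonlinStep (N : ℕ) (σ ε τ : ℝ) (u : Fin (N + 1) → ℂ) : Fin (N + 1) → ℂ :=
  fun j => Complex.exp (-Complex.I * ((σ * ε ^ 2 * τ * ‖u j‖ ^ 2 : ℝ) : ℂ)) * u j

/-- The time-splitting Fourier pseudospectral approximation `ψ^n` with initial datum `ψ₀`. -/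
noncomputable def tsfp (a b : ℝ) (N : ℕ) (σ ε τ : ℝ) (ψ₀ : ℝ → ℂ) : ℕ → Fin (N + 1) → ℂ
  | 0 => fun j => ψ₀ (gridPt a b N j)
  | n + 1 => halfStep a b N τ (nonlinStep N σ ε τ (halfStep a b N τ (tsfp a b N σ ε τ ψ₀ n)))

/-- The small-step condition `0 < τ < α π τ₀² / (μ_1² (1+τ₀)²)`. -/
def SmallStep (a b α τ₀ τ : ℝ) : Prop :=
  τ ∈ Set.Ioo 0 (α * (Real.pi / (mu a b 1 ^ 2 * (1 + τ₀) ^ 2)) * τ₀ ^ 2)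

/-- The constant `λ = α π μ_1^{2+2ν} / (4 ∑_{k≥1} k^{-(1+ν)})`. -/
noncomputable def nonresConst (a b α ν : ℝ) : ℝ :=
  α * Real.pi * mu a b 1 ^ (2 + 2 * ν) / (4 * ∑' k : ℕ, 1 / ((k : ℝ) + 1) ^ (1 + ν))

/-- The Diophantine non-resonance condition on the step size: `τ > 0` and
`|τ - 2lπ/(μ_1²K)| ≥ λ/|μ_1²K|^{2+ν}` for all integers `0 < |K| ≤ 2⌈1/τ₀⌉²` and `l ≥ 0`. -/
def NonResonantStep (a b α ν τ₀ τ : ℝ) : Prop :=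
  0 < τ ∧ ∀ K l : ℤ, 0 < |K| → |K| ≤ 2 * ⌈1 / τ₀⌉ ^ 2 → 0 ≤ l →
    nonresConst a b α ν / |mu a b 1 ^ 2 * (K : ℝ)| ^ (2 + ν) ≤
      |τ - 2 * (l : ℝ) * Real.pi / (mu a b 1 ^ 2 * (K : ℝ))|

end NLSTSFP

/-! Everything is done on Fourier coefficients, in the twisted variable
$\varphi_l(t)=e^{it\mu_l^2}\widehat\psi_l(t)$. Twisting removes the linear part: with
$g=\sigma\varepsilon^2$,
$\varphi'=-ig\sum_{p-q+r=l}e^{it\delta}\varphi_p\overline{\varphi_q}\varphi_r$, where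
$\delta=\mu_l^2-\mu_p^2+\mu_q^2-\mu_r^2$ (`exactFlow_of_solution`). Hence $\varphi$ moves at speed
$O(\varepsilon^2)$ in $H^m$. In the same variable the two half steps of the scheme disappear, and
one step is the flow of the cubic equation on the grid with the phase frozen at the midpoint
$t_n+\tau/2$ (`exists_frozenFlow_tsfp`). The cubic term is bounded and Lipschitz on $H^1$ because
$H^1$ sequences are summable (`HB.tri`), and aliasing costs $h^{m-1}$ (`HB.aliased_sub_trunc`).

The local error in time (`one_step`) is a leading term plus a remainder of size
$(\varepsilon^2\tau)(\varepsilon^2\tau^2)$. Since the number of steps times $\varepsilon^2\tau$ is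
at most $T$, the remainders add up to $O(\varepsilon^2\tau^2)$. The leading term is $g$ times a
trilinear form with kernel $e^{it_k\delta}d(\tau,\delta)$, $d=\tau e^{i\tau\delta/2}-\int_0^\tau
e^{is\delta}ds$. Summing its absolute values would lose the factor $\varepsilon^2$. Its oscillation
in $k$ is used instead (`HB.sum_defect`): with $d=a\,(1-e^{i\tau\delta})$ the sum over $k$ is summed
by parts, leaving two boundary terms and the slow increments
$\varphi(t_{k+1})-\varphi(t_k)=O(\varepsilon^2\tau)$. If $a=O(\tau^2)$, the total is
$O(\varepsilon^2\tau^2)$.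

Such an $a$ is needed only when all four frequencies are at most $\lceil1/\tau_0\rceil$; otherwise
$H^m$ regularity makes the term $O(\tau_0^{m-1})$ (`KB_highKer`). For low frequencies
$|1-e^{i\tau\delta}|=2|\sin(\tau\delta/2)|$ must be bounded below. Under (S) the argument stays in
$[-\alpha\pi,\alpha\pi]$, and the sine is comparable to its argument (`abelBound_of_small`). Under
(NR) the sine is at least of order $|\delta|^{-1-\nu}$, and this loss is paid either by $2+2\nu$
derivatives (`abelBound_of_nonres`) or by a constant depending on the cut-off
(`abelBound_of_nonres'`); this is the difference between (i) and (ii).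

`global_error` closes the argument by a discrete Gronwall inequality, whose bound, being at most 1,
keeps the scheme in the ball where the Lipschitz constant is valid. -/

namespace NLSTSFP

open Finset
open scoped ENNReal

/-! ### Weighted $\ell^2$ bounds, tested on finite sets of frequencies -/

/-- The weight `1 + (κ l)²`. -/
noncomputable def wt (κ : ℝ) (l : ℤ) : ℝ := 1 + (κ * l) ^ 2

/-- The Japanese bracket `(1 + (κ l)²)^{1/2}`. -/
noncomputable def jb (κ : ℝ) (l : ℤ) : ℝ := Real.sqrt (wt κ l)

theorem one_le_wt (κ : ℝ) (l : ℤ) : 1 ≤ wt κ l := by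
  unfold wt; nlinarith [sq_nonneg (κ * l)]

theorem wt_pos (κ : ℝ) (l : ℤ) : 0 < wt κ l := lt_of_lt_of_le one_pos (one_le_wt κ l)

theorem jb_sq (κ : ℝ) (l : ℤ) : jb κ l ^ 2 = wt κ l := Real.sq_sqrt (wt_pos κ l).le

theorem one_le_jb (κ : ℝ) (l : ℤ) : 1 ≤ jb κ l := Real.one_le_sqrt.mpr (one_le_wt κ l)

theorem jb_pos (κ : ℝ) (l : ℤ) : 0 < jb κ l := lt_of_lt_of_le one_pos (one_le_jb κ l)

theorem jb_pow_sq (κ : ℝ) (l : ℤ) (s : ℕ) : (jb κ l ^ s) ^ 2 = wt κ l ^ s := by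
  rw [← jb_sq, ← pow_mul, ← pow_mul, mul_comm]

theorem abs_le_jb (κ : ℝ) (l : ℤ) : |κ * l| ≤ jb κ l := by
  rw [← Real.sqrt_sq_eq_abs]
  exact Real.sqrt_le_sqrt (by unfold wt; linarith)

/-- The weighted `ℓ²` norm of the entries with index in `F`. -/
noncomputable def partNorm (κ : ℝ) (s : ℕ) (F : Finset ℤ) (c : ℤ → ℂ) : ℝ :=
  Real.sqrt (∑ l ∈ F, wt κ l ^ s * ‖c l‖ ^ 2)

/-- The sequence `c` has weighted `ℓ²` norm at most `A`. -/
def HB (κ : ℝ) (s : ℕ) (A : ℝ) (c : ℤ → ℂ) : Prop := ∀ F : Finset ℤ, partNorm κ s F c ≤ A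

/-- The weighted entries with index in `F` as a vector. -/
noncomputable def vec (κ : ℝ) (s : ℕ) (F : Finset ℤ) (c : ℤ → ℂ) : EuclideanSpace ℂ F :=
  WithLp.toLp 2 fun l => ((jb κ l ^ s : ℝ) : ℂ) * c l

theorem norm_vec (κ : ℝ) (s : ℕ) (F : Finset ℤ) (c : ℤ → ℂ) :
    ‖vec κ s F c‖ = partNorm κ s F c := by
  rw [EuclideanSpace.norm_eq, partNorm, ← Finset.sum_coe_sort F]
  congr 1
  refine Finset.sum_congr rfl fun l _ => ?_
  simp only [vec, norm_mul, Complex.norm_real, mul_pow, Real.norm_eq_abs, sq_abs, jb_pow_sq]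

theorem vec_add (κ : ℝ) (s : ℕ) (F : Finset ℤ) (c d : ℤ → ℂ) :
    vec κ s F (fun l => c l + d l) = vec κ s F c + vec κ s F d := by
  ext l; simp [vec, mul_add]

theorem HB.nonneg {κ A : ℝ} {s : ℕ} {c : ℤ → ℂ} (h : HB κ s A c) : 0 ≤ A :=
  (Real.sqrt_nonneg _).trans (h ∅)

theorem HB.mono {κ A B : ℝ} {s : ℕ} {c : ℤ → ℂ} (h : HB κ s A c) (hAB : A ≤ B) : HB κ s B c :=
  fun F => (h F).trans hAB

theorem HB.sum_le {κ A : ℝ} {s : ℕ} {c : ℤ → ℂ} (h : HB κ s A c) (F : Finset ℤ) :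
    ∑ l ∈ F, wt κ l ^ s * ‖c l‖ ^ 2 ≤ A ^ 2 :=
  (Real.sqrt_le_left h.nonneg).mp (h F)

theorem HB.of_sum_le {κ A : ℝ} {s : ℕ} {c : ℤ → ℂ} (hA : 0 ≤ A)
    (h : ∀ F : Finset ℤ, ∑ l ∈ F, wt κ l ^ s * ‖c l‖ ^ 2 ≤ A ^ 2) : HB κ s A c :=
  fun F => (Real.sqrt_le_left hA).mpr (h F)

theorem HB.zero (κ : ℝ) (s : ℕ) : HB κ s 0 (fun _ => 0) := fun F => by simp [partNorm]

theorem HB.add {κ A B : ℝ} {s : ℕ} {c d : ℤ → ℂ} (hc : HB κ s A c) (hd : HB κ s B d) :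
    HB κ s (A + B) (fun l => c l + d l) := fun F => by
  rw [← norm_vec, vec_add]
  refine (norm_add_le _ _).trans (add_le_add ?_ ?_)
  · rw [norm_vec]; exact hc F
  · rw [norm_vec]; exact hd F

/-- If `w^s |c|² ≤ K² w^{s'} |d|²` termwise then the norms compare. -/
theorem HB.of_weight_le {κ A K : ℝ} {s s' : ℕ} {c d : ℤ → ℂ} (hd : HB κ s' A d) (hK : 0 ≤ K)
    (h : ∀ l, wt κ l ^ s * ‖c l‖ ^ 2 ≤ K ^ 2 * (wt κ l ^ s' * ‖d l‖ ^ 2)) :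
    HB κ s (K * A) c := by
  refine HB.of_sum_le (mul_nonneg hK hd.nonneg) fun F => ?_
  refine (Finset.sum_le_sum fun l _ => h l).trans ?_
  rw [← Finset.mul_sum, mul_pow]
  exact mul_le_mul_of_nonneg_left (hd.sum_le F) (sq_nonneg K)

theorem HB.of_norm_le {κ A K : ℝ} {s : ℕ} {c d : ℤ → ℂ} (hd : HB κ s A d) (hK : 0 ≤ K)
    (h : ∀ l, ‖c l‖ ≤ K * ‖d l‖) : HB κ s (K * A) c := by
  refine hd.of_weight_le hK fun l => ?_
  have h1 : ‖c l‖ ^ 2 ≤ (K * ‖d l‖) ^ 2 := pow_le_pow_left₀ (norm_nonneg _) (h l) 2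
  have h2 : 0 ≤ wt κ l ^ s := (pow_pos (wt_pos κ l) s).le
  calc wt κ l ^ s * ‖c l‖ ^ 2 ≤ wt κ l ^ s * (K * ‖d l‖) ^ 2 := mul_le_mul_of_nonneg_left h1 h2
    _ = _ := by ring

theorem HB.of_norm_le_one {κ A : ℝ} {s : ℕ} {c d : ℤ → ℂ} (hd : HB κ s A d)
    (h : ∀ l, ‖c l‖ ≤ ‖d l‖) : HB κ s A c := by
  simpa using hd.of_norm_le zero_le_one (fun l => by simpa using h l)

theorem HB.const_mul {κ A : ℝ} {s : ℕ} {c : ℤ → ℂ} (hc : HB κ s A c) (z : ℂ) :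
    HB κ s (‖z‖ * A) (fun l => z * c l) :=
  hc.of_norm_le (norm_nonneg z) fun _ => (norm_mul _ _).le

theorem HB.neg {κ A : ℝ} {s : ℕ} {c : ℤ → ℂ} (hc : HB κ s A c) : HB κ s A (fun l => -c l) :=
  hc.of_norm_le_one fun _ => (norm_neg _).le

theorem HB.sub {κ A B : ℝ} {s : ℕ} {c d : ℤ → ℂ} (hc : HB κ s A c) (hd : HB κ s B d) :
    HB κ s (A + B) (fun l => c l - d l) := by
  simpa [sub_eq_add_neg] using hc.add hd.neg

theorem HB.of_le {κ A : ℝ} {s s' : ℕ} {c : ℤ → ℂ} (hc : HB κ s' A c) (h : s ≤ s') :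
    HB κ s A c := by
  have := hc.of_weight_le (c := c) (s := s) zero_le_one fun l => by
    rw [one_pow, one_mul]
    exact mul_le_mul_of_nonneg_right (pow_le_pow_right₀ (one_le_wt κ l) h) (sq_nonneg _)
  simpa using this

theorem HB.sum {κ : ℝ} {s : ℕ} {n : ℕ} {A : ℕ → ℝ} {c : ℕ → ℤ → ℂ}
    (h : ∀ k < n, HB κ s (A k) (c k)) :
    HB κ s (∑ k ∈ range n, A k) (fun l => ∑ k ∈ range n, c k l) := by
  induction n with
  | zero => simpa using HB.zero κ s
  | succ n ih =>
    simp only [Finset.sum_range_succ]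
    exact (ih fun k hk => h k (by omega)).add (h n (by omega))

/-- A sequence supported in `F` has norm equal to its partial norm over `F`. -/
theorem HB.of_support {κ : ℝ} {s : ℕ} {F : Finset ℤ} {c : ℤ → ℂ} (h : ∀ l ∉ F, c l = 0) :
    HB κ s (partNorm κ s F c) c := fun G => by
  refine Real.sqrt_le_sqrt ?_
  have h1 : ∑ l ∈ G, wt κ l ^ s * ‖c l‖ ^ 2 = ∑ l ∈ G ∩ F, wt κ l ^ s * ‖c l‖ ^ 2 := by
    refine (Finset.sum_subset Finset.inter_subset_left fun l hl hl' => ?_).symm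
    have : l ∉ F := fun hF => hl' (Finset.mem_inter.mpr ⟨hl, hF⟩)
    simp [h l this]
  rw [h1]
  exact Finset.sum_le_sum_of_subset_of_nonneg Finset.inter_subset_right fun l _ _ =>
    mul_nonneg (pow_nonneg (wt_pos κ l).le s) (sq_nonneg _)

/-- Minkowski's inequality for integrals of sequences. -/
theorem HB.intervalIntegral {κ A x y : ℝ} {s : ℕ} {g : ℝ → ℤ → ℂ} (hxy : x ≤ y)
    (hg : ∀ l, ContinuousOn (fun r => g r l) (Set.Icc x y))
    (h : ∀ r ∈ Set.Icc x y, HB κ s A (g r)) :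
    HB κ s (A * (y - x)) (fun l => ∫ r in x..y, g r l) := fun F => by
  -- On a finite set of frequencies the partial norm is the norm of a Euclidean space, so the norm
  -- inequality for vector-valued integrals applies there.
  have hcont : ContinuousOn (fun r => vec κ s F (g r)) (Set.Icc x y) := by
    unfold vec
    refine (PiLp.continuous_toLp 2 _).comp_continuousOn (continuousOn_pi.mpr fun l => ?_)
    exact continuousOn_const.mul (hg l)
  have hint : IntervalIntegrable (fun r => vec κ s F (g r)) MeasureTheory.volume x y :=
    ContinuousOn.intervalIntegrable (by rwa [Set.uIcc_of_le hxy])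
  have hv : vec κ s F (fun l => ∫ r in x..y, g r l) = ∫ r in x..y, vec κ s F (g r) := by
    ext l
    have h1 := (EuclideanSpace.proj l : EuclideanSpace ℂ F →L[ℂ] ℂ).intervalIntegral_comp_comm
      hint
    have h2 : (∫ r in x..y, vec κ s F (g r)) l = ∫ r in x..y, (vec κ s F (g r)) l := h1.symm
    rw [h2]
    simp only [vec]
    rw [intervalIntegral.integral_const_mul]
  rw [← norm_vec, hv]
  have := intervalIntegral.norm_integral_le_of_norm_le_const (a := x) (b := y) (C := A)
    (f := fun r => vec κ s F (g r)) fun r hr => by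
      rw [norm_vec]
      rw [Set.uIoc_of_le hxy] at hr
      exact h r ⟨hr.1.le, hr.2⟩ F
  rwa [abs_of_nonneg (by linarith)] at this

/-- In $[0,\infty]$ every series has a sum and the order of summation is free. The convolution and
aliasing estimates are proved there and brought back through this equivalence. -/
theorem HB.iff_tsum {κ A : ℝ} {s : ℕ} {c : ℤ → ℂ} (hA : 0 ≤ A) :
    HB κ s A c ↔ ∑' l, ENNReal.ofReal (wt κ l ^ s) * ‖c l‖ₑ ^ 2 ≤ ENNReal.ofReal (A ^ 2) := by
  have key : ∀ F : Finset ℤ, ∑ l ∈ F, ENNReal.ofReal (wt κ l ^ s) * ‖c l‖ₑ ^ 2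
      = ENNReal.ofReal (∑ l ∈ F, wt κ l ^ s * ‖c l‖ ^ 2) := fun F => by
    rw [ENNReal.ofReal_sum_of_nonneg fun l _ =>
      mul_nonneg (pow_nonneg (wt_pos κ l).le s) (sq_nonneg _)]
    refine Finset.sum_congr rfl fun l _ => ?_
    rw [ENNReal.ofReal_mul (pow_nonneg (wt_pos κ l).le s), ENNReal.ofReal_pow (norm_nonneg _),
      ofReal_norm]
  constructor
  · intro h
    rw [ENNReal.tsum_eq_iSup_sum]
    refine iSup_le fun F => ?_
    rw [key]
    exact ENNReal.ofReal_le_ofReal (h.sum_le F)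
  · intro h
    refine HB.of_sum_le hA fun F => ?_
    have h1 := (ENNReal.sum_le_tsum F).trans h
    rw [key] at h1
    exact (ENNReal.ofReal_le_ofReal_iff (sq_nonneg A)).mp h1

/-! ### Cauchy-Schwarz and the embedding of $H^1$ into $\ell^1$ -/

/-- The Cauchy-Schwarz inequality for series in `[0,∞]`. -/
theorem tsum_sq_le_of_sq_le {ι : Type*} {x u v : ι → ℝ≥0∞} (h : ∀ i, x i ^ 2 ≤ u i * v i) :
    (∑' i, x i) ^ 2 ≤ (∑' i, u i) * ∑' i, v i := by
  -- Hölder's inequality for the counting measure; with the discrete $\sigma$-algebra every function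
  -- is measurable.
  let _ : MeasurableSpace ι := ⊤
  have hx : ∀ i, x i ≤ u i ^ (1 / 2 : ℝ) * v i ^ (1 / 2 : ℝ) := fun i => by
    rw [← ENNReal.mul_rpow_of_nonneg _ _ (by norm_num)]
    calc x i = (x i ^ 2) ^ (1 / 2 : ℝ) := by
          rw [← ENNReal.rpow_natCast, ← ENNReal.rpow_mul]; norm_num
      _ ≤ _ := ENNReal.rpow_le_rpow (h i) (by norm_num)
  have hr : ∀ y : ℝ≥0∞, (y ^ (1 / 2 : ℝ)) ^ (2 : ℝ) = y := fun y => by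
    rw [← ENNReal.rpow_mul]; norm_num
  have h1 := ENNReal.lintegral_mul_le_Lp_mul_Lq (MeasureTheory.Measure.count : MeasureTheory.Measure ι)
    Real.HolderConjugate.two_two (f := fun i => u i ^ (1 / 2 : ℝ)) (g := fun i => v i ^ (1 / 2 : ℝ))
    (measurable_from_top.aemeasurable) (measurable_from_top.aemeasurable)
  simp only [Pi.mul_apply, MeasureTheory.lintegral_count, hr] at h1
  calc (∑' i, x i) ^ 2
      ≤ ((∑' i, u i) ^ (1 / 2 : ℝ) * (∑' i, v i) ^ (1 / 2 : ℝ)) ^ 2 :=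
        pow_le_pow_left₀ zero_le ((ENNReal.tsum_le_tsum hx).trans h1) 2
    _ = _ := by
        rw [mul_pow, ← ENNReal.rpow_natCast, ← ENNReal.rpow_natCast]
        push_cast
        rw [hr, hr]

/-- The sum `∑_l w_l⁻¹`. -/
noncomputable def wtSum (κ : ℝ) : ℝ := ∑' l : ℤ, (wt κ l)⁻¹

theorem summable_wt_inv {κ : ℝ} (hκ : 0 < κ) : Summable fun l : ℤ => (wt κ l)⁻¹ := by
  have h2 : Summable fun l : ℤ => (κ ^ 2)⁻¹ * (1 / (l : ℝ) ^ 2) :=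
    (Real.summable_one_div_int_pow.mpr one_lt_two).mul_left _
  -- The comparison series takes the value `1 / 0 = 0` at `l = 0`, where the inverse weight is 1;
  -- this one-term series makes up for it.
  have h3 : Summable fun l : ℤ => if l = 0 then (1 : ℝ) else 0 :=
    summable_of_hasFiniteSupport ((Set.finite_singleton (0 : ℤ)).subset fun l hl => by
      by_contra h; simp_all)
  refine Summable.of_nonneg_of_le (fun l => inv_nonneg.mpr (wt_pos κ l).le) (fun l => ?_)
    (h3.add h2)
  by_cases hl : l = 0
  · subst hl; simp [wt]
  · have hl' : (0 : ℝ) < (l : ℝ) ^ 2 := by positivity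
    simp only [hl, if_false, zero_add]
    rw [one_div, ← mul_inv]
    exact inv_anti₀ (by positivity) (by unfold wt; nlinarith)

theorem wtSum_nonneg (κ : ℝ) : 0 ≤ wtSum κ := tsum_nonneg fun l => inv_nonneg.mpr (wt_pos κ l).le

theorem ofReal_mul_ofReal_inv {x : ℝ} (hx : 0 < x) :
    ENNReal.ofReal x⁻¹ * ENNReal.ofReal x = 1 := by
  rw [← ENNReal.ofReal_mul (inv_nonneg.mpr hx.le), inv_mul_cancel₀ hx.ne', ENNReal.ofReal_one]

/-- Cauchy-Schwarz against the inverse weights, which are summable in one space dimension. This is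
what makes $H^1$ enough to control the cubic term and the supremum norm. -/
theorem HB.tsum_enorm_sq_le {κ A : ℝ} (hκ : 0 < κ) {s : ℕ} (hs : 1 ≤ s) {c : ℤ → ℂ}
    (h : HB κ s A c) : (∑' l, ‖c l‖ₑ) ^ 2 ≤ ENNReal.ofReal (wtSum κ * A ^ 2) := by
  have h1 := (HB.iff_tsum h.nonneg).mp (h.of_le hs)
  simp only [pow_one] at h1
  refine (tsum_sq_le_of_sq_le (u := fun l => ENNReal.ofReal (wt κ l)⁻¹)
    (v := fun l => ENNReal.ofReal (wt κ l) * ‖c l‖ₑ ^ 2) fun l => ?_).trans ?_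
  · rw [← mul_assoc, ofReal_mul_ofReal_inv (wt_pos κ l), one_mul]
  · rw [ENNReal.ofReal_mul (wtSum_nonneg κ), wtSum,
      ENNReal.ofReal_tsum_of_nonneg (fun l => inv_nonneg.mpr (wt_pos κ l).le) (summable_wt_inv hκ)]
    exact mul_le_mul_right h1 _

theorem HB.summable_norm {κ A : ℝ} (hκ : 0 < κ) {s : ℕ} (hs : 1 ≤ s) {c : ℤ → ℂ}
    (h : HB κ s A c) : Summable fun l => ‖c l‖ := by
  have h1 := h.tsum_enorm_sq_le hκ hs
  have h2 : ∑' l, ‖c l‖ₑ ≠ ∞ := fun h3 => by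
    rw [h3] at h1; simp at h1
  have h3 : Summable fun l => ‖c l‖₊ := ENNReal.tsum_coe_ne_top_iff_summable.mp h2
  simpa using NNReal.summable_coe.mpr h3

theorem HB.tsum_norm_le {κ A : ℝ} (hκ : 0 < κ) {s : ℕ} (hs : 1 ≤ s) {c : ℤ → ℂ}
    (h : HB κ s A c) : ∑' l, ‖c l‖ ≤ Real.sqrt (wtSum κ) * A := by
  have h1 := h.tsum_enorm_sq_le hκ hs
  have h2 : ∑' l, ‖c l‖ₑ = ENNReal.ofReal (∑' l, ‖c l‖) := by
    rw [ENNReal.ofReal_tsum_of_nonneg (fun l => norm_nonneg _) (h.summable_norm hκ hs)]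
    simp
  have h0 : 0 ≤ ∑' l, ‖c l‖ := tsum_nonneg fun l => norm_nonneg _
  rw [h2, ← ENNReal.ofReal_pow h0, ENNReal.ofReal_le_ofReal_iff
    (mul_nonneg (wtSum_nonneg κ) (sq_nonneg A))] at h1
  rw [← abs_of_nonneg h.nonneg, ← Real.sqrt_sq_eq_abs, ← Real.sqrt_mul (wtSum_nonneg κ)]
  exact Real.le_sqrt_of_sq_le h1

/-! ### Young's inequality for trilinear convolutions -/

section triple

variable (F G H : ℤ → ℝ≥0∞)

theorem tsum_pair_fst_snd : ∑' x : ℤ × ℤ, F x.1 * G x.2 = (∑' p, F p) * ∑' q, G q := by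
  rw [ENNReal.tsum_prod']
  simp only [ENNReal.tsum_mul_left, ENNReal.tsum_mul_right]

theorem tsum_pair_fst_shift (l : ℤ) :
    ∑' x : ℤ × ℤ, F x.1 * H (l - x.1 + x.2) = (∑' p, F p) * ∑' r, H r := by
  rw [ENNReal.tsum_prod']
  simp only [ENNReal.tsum_mul_left]
  have : ∀ p : ℤ, ∑' q, H (l - p + q) = ∑' r, H r := fun p =>
    (Equiv.addLeft (l - p)).tsum_eq H
  simp only [this, ENNReal.tsum_mul_right]

theorem tsum_pair_snd_shift (l : ℤ) :
    ∑' x : ℤ × ℤ, G x.2 * H (l - x.1 + x.2) = (∑' q, G q) * ∑' r, H r := by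
  rw [ENNReal.tsum_prod', ENNReal.tsum_comm]
  simp only [ENNReal.tsum_mul_left]
  have : ∀ q : ℤ, ∑' p, H (l - p + q) = ∑' r, H r := fun q => by
    rw [← (Equiv.subLeft (l + q)).tsum_eq H]
    refine tsum_congr fun p => ?_
    rw [Equiv.subLeft_apply]; congr 1; ring
  simp only [this, ENNReal.tsum_mul_right]

theorem tsum_tsum_pair :
    ∑' l : ℤ, ∑' x : ℤ × ℤ, F x.1 * G x.2 * H (l - x.1 + x.2)
      = (∑' p, F p) * (∑' q, G q) * ∑' r, H r := by
  rw [ENNReal.tsum_comm]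
  simp only [ENNReal.tsum_mul_left]
  have : ∀ x : ℤ × ℤ, ∑' l, H (l - x.1 + x.2) = ∑' r, H r := fun x => by
    rw [← (Equiv.addRight (x.2 - x.1)).tsum_eq H]
    refine tsum_congr fun l => ?_
    rw [Equiv.coe_addRight]; congr 1; ring
  simp only [this, ENNReal.tsum_mul_right]
  rw [tsum_pair_fst_snd]

/-- The trilinear convolution of sequences in `[0,∞]`. -/
noncomputable def conv3 (l : ℤ) : ℝ≥0∞ := ∑' x : ℤ × ℤ, F x.1 * G x.2 * H (l - x.1 + x.2)

/-- Cauchy-Schwarz with the weight $F_pG_q$, whose total mass is the same for every $l$. This is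
$\ell^1*\ell^1*\ell^2\to\ell^2$; the next two lemmas let another factor carry the $\ell^2$ norm. -/
theorem tsum_conv3_sq_le_right :
    ∑' l, conv3 F G H l ^ 2 ≤ (∑' p, F p) ^ 2 * (∑' q, G q) ^ 2 * ∑' r, H r ^ 2 := by
  calc ∑' l, conv3 F G H l ^ 2
      ≤ ∑' l, (∑' x : ℤ × ℤ, F x.1 * G x.2) *
          ∑' x : ℤ × ℤ, F x.1 * G x.2 * H (l - x.1 + x.2) ^ 2 :=
        ENNReal.tsum_le_tsum fun l => tsum_sq_le_of_sq_le fun x => le_of_eq (by ring)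
    _ = _ := by
        rw [ENNReal.tsum_mul_left, tsum_pair_fst_snd, tsum_tsum_pair F G fun r => H r ^ 2]
        ring

theorem tsum_conv3_sq_le_left :
    ∑' l, conv3 F G H l ^ 2 ≤ (∑' p, F p ^ 2) * (∑' q, G q) ^ 2 * (∑' r, H r) ^ 2 := by
  calc ∑' l, conv3 F G H l ^ 2
      ≤ ∑' l, (∑' x : ℤ × ℤ, G x.2 * H (l - x.1 + x.2)) *
          ∑' x : ℤ × ℤ, F x.1 ^ 2 * G x.2 * H (l - x.1 + x.2) :=
        ENNReal.tsum_le_tsum fun l => tsum_sq_le_of_sq_le fun x => le_of_eq (by ring)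
    _ = _ := by
        simp only [tsum_pair_snd_shift]
        rw [ENNReal.tsum_mul_left, tsum_tsum_pair (fun p => F p ^ 2) G H]
        ring

theorem tsum_conv3_sq_le_middle :
    ∑' l, conv3 F G H l ^ 2 ≤ (∑' p, F p) ^ 2 * (∑' q, G q ^ 2) * (∑' r, H r) ^ 2 := by
  calc ∑' l, conv3 F G H l ^ 2
      ≤ ∑' l, (∑' x : ℤ × ℤ, F x.1 * H (l - x.1 + x.2)) *
          ∑' x : ℤ × ℤ, F x.1 * G x.2 ^ 2 * H (l - x.1 + x.2) :=
        ENNReal.tsum_le_tsum fun l => tsum_sq_le_of_sq_le fun x => le_of_eq (by ring)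
    _ = _ := by
        simp only [tsum_pair_fst_shift]
        rw [ENNReal.tsum_mul_left, tsum_tsum_pair F (fun q => G q ^ 2) H]
        ring

end triple

/-! ### Trilinear estimates with a frequency-dependent kernel -/

/-- The largest bracket of three frequencies. -/
noncomputable def jbMax (κ : ℝ) (p q r : ℤ) : ℝ := max (jb κ p) (max (jb κ q) (jb κ r))

theorem one_le_jbMax (κ : ℝ) (p q r : ℤ) : 1 ≤ jbMax κ p q r :=
  (one_le_jb κ p).trans (le_max_left _ _)

/-- The largest frequency carries all the derivatives: only the factor at that frequency has to be
measured with the weight, the other two in $\ell^1$. -/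
theorem jbMax_pow_le (κ : ℝ) (s : ℕ) (p q r : ℤ) :
    jbMax κ p q r ^ s ≤ jb κ p ^ s + jb κ q ^ s + jb κ r ^ s := by
  have hp := pow_nonneg (jb_pos κ p).le s
  have hq := pow_nonneg (jb_pos κ q).le s
  have hr := pow_nonneg (jb_pos κ r).le s
  unfold jbMax
  rcases max_choice (jb κ p) (max (jb κ q) (jb κ r)) with h | h <;> rw [h]
  · linarith
  · rcases max_choice (jb κ q) (jb κ r) with h | h <;> rw [h] <;> linarith

theorem jb_sub_add_le (κ : ℝ) (p q r : ℤ) : jb κ (p - q + r) ≤ 3 * jbMax κ p q r := by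
  have hp : |κ * p| ^ 2 ≤ jbMax κ p q r ^ 2 - 1 := by
    have h1 : jb κ p ^ 2 ≤ jbMax κ p q r ^ 2 :=
      pow_le_pow_left₀ (jb_pos κ p).le (le_max_left _ _) 2
    rw [jb_sq, wt] at h1; rw [sq_abs]; linarith
  have hq : |κ * q| ^ 2 ≤ jbMax κ p q r ^ 2 - 1 := by
    have h1 : jb κ q ^ 2 ≤ jbMax κ p q r ^ 2 :=
      pow_le_pow_left₀ (jb_pos κ q).le ((le_max_left _ _).trans (le_max_right _ _)) 2
    rw [jb_sq, wt] at h1; rw [sq_abs]; linarith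
  have hr : |κ * r| ^ 2 ≤ jbMax κ p q r ^ 2 - 1 := by
    have h1 : jb κ r ^ 2 ≤ jbMax κ p q r ^ 2 :=
      pow_le_pow_left₀ (jb_pos κ r).le ((le_max_right _ _).trans (le_max_right _ _)) 2
    rw [jb_sq, wt] at h1; rw [sq_abs]; linarith
  have h0 : 0 ≤ 3 * jbMax κ p q r := by linarith [one_le_jbMax κ p q r]
  refine Real.sqrt_le_iff.mpr ⟨h0, ?_⟩
  unfold wt
  rw [sq_abs] at hp hq hr
  push_cast
  -- The identity $(x-y+z)^2+(x+y)^2+(y+z)^2+(x-z)^2=3(x^2+y^2+z^2)$.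
  nlinarith [sq_nonneg (κ * p + κ * q), sq_nonneg (κ * q + κ * r), sq_nonneg (κ * p - κ * r)]

/-- The kernel `k` maps `H^s × H^s × H^s` to `H^{s'}` with constant `B`. -/
def KB (κ : ℝ) (s' s : ℕ) (B : ℝ) (k : ℤ → ℤ → ℤ → ℂ) : Prop :=
  ∀ p q r, jb κ (p - q + r) ^ s' * ‖k p q r‖ ≤ B * jbMax κ p q r ^ s

theorem KB.nonneg {κ B : ℝ} {s s' : ℕ} {k : ℤ → ℤ → ℤ → ℂ} (h : KB κ s' s B k) : 0 ≤ B := by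
  have h1 := h 0 0 0
  have h2 : 0 ≤ jb κ (0 - 0 + 0) ^ s' * ‖k 0 0 0‖ :=
    mul_nonneg (pow_nonneg (jb_pos κ _).le _) (norm_nonneg _)
  have h3 : 0 < jbMax κ 0 0 0 ^ s := pow_pos (by linarith [one_le_jbMax κ 0 0 0]) _
  nlinarith

/-- The terms of the trilinear convolution with kernel `k`. -/
noncomputable def triTerm (k : ℤ → ℤ → ℤ → ℂ) (c d e : ℤ → ℂ) (l : ℤ) (x : ℤ × ℤ) : ℂ :=
  k x.1 x.2 (l - x.1 + x.2) * (c x.1 * (starRingEnd ℂ) (d x.2) * e (l - x.1 + x.2))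

/-- The trilinear convolution `∑_{p-q+r=l} k(p,q,r) c_p conj(d_q) e_r`. -/
noncomputable def Tri (k : ℤ → ℤ → ℤ → ℂ) (c d e : ℤ → ℂ) (l : ℤ) : ℂ :=
  ∑' x : ℤ × ℤ, triTerm k c d e l x

theorem add_three_sq_le (x y z : ℝ≥0∞) : (x + y + z) ^ 2 ≤ 3 * (x ^ 2 + y ^ 2 + z ^ 2) := by
  by_cases hx : x = ∞
  · subst hx; simp [ENNReal.mul_top]
  by_cases hy : y = ∞
  · subst hy; simp [ENNReal.mul_top]
  by_cases hz : z = ∞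
  · subst hz; simp [ENNReal.mul_top]
  lift x to NNReal using hx
  lift y to NNReal using hy
  lift z to NNReal using hz
  norm_cast
  rw [← NNReal.coe_le_coe]
  push_cast
  nlinarith [sq_nonneg ((x : ℝ) - y), sq_nonneg ((y : ℝ) - z), sq_nonneg ((x : ℝ) - z)]

/-- The absolute values stand inside the convolution, so this one bound yields both the convergence
of `Tri` and its norm estimate. The kernel bound splits the weight among the three factors, and each
piece is a case of Young's inequality. -/
theorem tsum_triTerm_sq_le {κ B A₁ A₂ A₃ : ℝ} (hκ : 0 < κ) {s s' : ℕ} (hs : 1 ≤ s)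
    {k : ℤ → ℤ → ℤ → ℂ} (hk : KB κ s' s B k) {c d e : ℤ → ℂ}
    (hc : HB κ s A₁ c) (hd : HB κ s A₂ d) (he : HB κ s A₃ e) :
    ∑' l, ENNReal.ofReal (wt κ l ^ s') * (∑' x, ‖triTerm k c d e l x‖ₑ) ^ 2
      ≤ ENNReal.ofReal ((3 * B * wtSum κ * A₁ * A₂ * A₃) ^ 2) := by
  have hB := hk.nonneg
  set W : (ℤ → ℂ) → ℤ → ℝ≥0∞ := fun c l => ENNReal.ofReal (jb κ l ^ s) * ‖c l‖ₑ with hW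
  set N : (ℤ → ℂ) → ℤ → ℝ≥0∞ := fun c l => ‖c l‖ₑ with hN
  have hWsq : ∀ {A : ℝ} {c : ℤ → ℂ}, HB κ s A c → ∑' l, W c l ^ 2 ≤ ENNReal.ofReal (A ^ 2) := by
    intro A c h
    refine le_trans (le_of_eq (tsum_congr fun l => ?_)) ((HB.iff_tsum h.nonneg).mp h)
    rw [hW]
    simp only
    rw [mul_pow, ← ENNReal.ofReal_pow (pow_nonneg (jb_pos κ l).le _), jb_pow_sq]
  have hNsq : ∀ {A : ℝ} {c : ℤ → ℂ}, HB κ s A c →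
      (∑' l, N c l) ^ 2 ≤ ENNReal.ofReal (wtSum κ * A ^ 2) := fun h => h.tsum_enorm_sq_le hκ hs
  have hterm : ∀ l x, ENNReal.ofReal (jb κ l ^ s') * ‖triTerm k c d e l x‖ₑ
      ≤ ENNReal.ofReal B * (W c x.1 * N d x.2 * N e (l - x.1 + x.2)
        + N c x.1 * W d x.2 * N e (l - x.1 + x.2) + N c x.1 * N d x.2 * W e (l - x.1 + x.2)) := by
    intro l x
    have h1 := hk x.1 x.2 (l - x.1 + x.2)
    rw [show x.1 - x.2 + (l - x.1 + x.2) = l by ring] at h1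
    have h2 : ENNReal.ofReal (jb κ l ^ s') * ‖k x.1 x.2 (l - x.1 + x.2)‖ₑ
        ≤ ENNReal.ofReal B * (ENNReal.ofReal (jb κ x.1 ^ s) + ENNReal.ofReal (jb κ x.2 ^ s)
          + ENNReal.ofReal (jb κ (l - x.1 + x.2) ^ s)) := by
      have hj := fun l => pow_nonneg (jb_pos κ l).le s
      rw [← ofReal_norm, ← ENNReal.ofReal_mul (pow_nonneg (jb_pos κ l).le _),
        ← ENNReal.ofReal_add (hj _) (hj _), ← ENNReal.ofReal_add (add_nonneg (hj _) (hj _)) (hj _),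
        ← ENNReal.ofReal_mul hB]
      exact ENNReal.ofReal_le_ofReal
        (h1.trans (mul_le_mul_of_nonneg_left (jbMax_pow_le κ s _ _ _) hB))
    unfold triTerm
    rw [enorm_mul, enorm_mul, enorm_mul, RCLike.enorm_conj, ← mul_assoc]
    refine (mul_le_mul_left h2 _).trans (le_of_eq ?_)
    simp only [hW, hN]
    ring
  have hl : ∀ l, ENNReal.ofReal (wt κ l ^ s') * (∑' x, ‖triTerm k c d e l x‖ₑ) ^ 2
      ≤ ENNReal.ofReal (B ^ 2) * (3 * (conv3 (W c) (N d) (N e) l ^ 2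
        + conv3 (N c) (W d) (N e) l ^ 2 + conv3 (N c) (N d) (W e) l ^ 2)) := by
    intro l
    rw [← jb_pow_sq, ENNReal.ofReal_pow (pow_nonneg (jb_pos κ l).le _), ← mul_pow,
      ← ENNReal.tsum_mul_left, ENNReal.ofReal_pow hB]
    refine (pow_le_pow_left₀ zero_le (ENNReal.tsum_le_tsum (hterm l)) 2).trans ?_
    rw [ENNReal.tsum_mul_left, mul_pow, ENNReal.tsum_add, ENNReal.tsum_add]
    exact mul_le_mul_right (add_three_sq_le _ _ _) _
  refine (ENNReal.tsum_le_tsum hl).trans ?_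
  rw [ENNReal.tsum_mul_left, ENNReal.tsum_mul_left, ENNReal.tsum_add, ENNReal.tsum_add]
  have hK := wtSum_nonneg κ
  have e1 : ∑' l, conv3 (W c) (N d) (N e) l ^ 2
      ≤ ENNReal.ofReal (wtSum κ ^ 2 * (A₁ * A₂ * A₃) ^ 2) := by
    refine (tsum_conv3_sq_le_left _ _ _).trans
      ((mul_le_mul' (mul_le_mul' (hWsq hc) (hNsq hd)) (hNsq he)).trans (le_of_eq ?_))
    rw [← ENNReal.ofReal_mul (by positivity), ← ENNReal.ofReal_mul (by positivity)]
    congr 1; ring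
  have e2 : ∑' l, conv3 (N c) (W d) (N e) l ^ 2
      ≤ ENNReal.ofReal (wtSum κ ^ 2 * (A₁ * A₂ * A₃) ^ 2) := by
    refine (tsum_conv3_sq_le_middle _ _ _).trans
      ((mul_le_mul' (mul_le_mul' (hNsq hc) (hWsq hd)) (hNsq he)).trans (le_of_eq ?_))
    rw [← ENNReal.ofReal_mul (by positivity), ← ENNReal.ofReal_mul (by positivity)]
    congr 1; ring
  have e3 : ∑' l, conv3 (N c) (N d) (W e) l ^ 2
      ≤ ENNReal.ofReal (wtSum κ ^ 2 * (A₁ * A₂ * A₃) ^ 2) := by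
    refine (tsum_conv3_sq_le_right _ _ _).trans
      ((mul_le_mul' (mul_le_mul' (hNsq hc) (hNsq hd)) (hWsq he)).trans (le_of_eq ?_))
    rw [← ENNReal.ofReal_mul (by positivity), ← ENNReal.ofReal_mul (by positivity)]
    congr 1; ring
  -- Three equal bounds and the factor 3 of `add_three_sq_le` together give $3^2$.
  refine (mul_le_mul_right (mul_le_mul_right (add_le_add (add_le_add e1 e2) e3) _) _).trans
    (le_of_eq ?_)
  rw [← ENNReal.ofReal_add (by positivity) (by positivity),
    ← ENNReal.ofReal_add (by positivity) (by positivity),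
    show (3 : ℝ≥0∞) = ENNReal.ofReal 3 by simp,
    ← ENNReal.ofReal_mul (by positivity), ← ENNReal.ofReal_mul (by positivity)]
  congr 1; ring

theorem summable_triTerm {κ B A₁ A₂ A₃ : ℝ} (hκ : 0 < κ) {s s' : ℕ} (hs : 1 ≤ s)
    {k : ℤ → ℤ → ℤ → ℂ} (hk : KB κ s' s B k) {c d e : ℤ → ℂ}
    (hc : HB κ s A₁ c) (hd : HB κ s A₂ d) (he : HB κ s A₃ e) (l : ℤ) :
    Summable fun x => ‖triTerm k c d e l x‖ := by
  have h1 := (ENNReal.le_tsum l).trans (tsum_triTerm_sq_le hκ hs hk hc hd he)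
  have h2 : ∑' x, ‖triTerm k c d e l x‖ₑ ≠ ∞ := fun h3 => by
    rw [h3] at h1
    have h4 : ENNReal.ofReal (wt κ l ^ s') ≠ 0 := by
      rw [Ne, ENNReal.ofReal_eq_zero, not_le]; exact pow_pos (wt_pos κ l) _
    simp [ENNReal.mul_top h4] at h1
  have h3 : Summable fun x => ‖triTerm k c d e l x‖₊ :=
    ENNReal.tsum_coe_ne_top_iff_summable.mp h2
  simpa using NNReal.summable_coe.mpr h3

/-- The trilinear estimate in weighted `ℓ²`. -/
theorem HB.tri {κ B A₁ A₂ A₃ : ℝ} (hκ : 0 < κ) {s s' : ℕ} (hs : 1 ≤ s)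
    {k : ℤ → ℤ → ℤ → ℂ} (hk : KB κ s' s B k) {c d e : ℤ → ℂ}
    (hc : HB κ s A₁ c) (hd : HB κ s A₂ d) (he : HB κ s A₃ e) :
    HB κ s' (3 * B * wtSum κ * A₁ * A₂ * A₃) (Tri k c d e) := by
  have hB := hk.nonneg
  have hK := wtSum_nonneg κ
  have h1 := hc.nonneg
  have h2 := hd.nonneg
  have h3 := he.nonneg
  refine (HB.iff_tsum (by positivity)).mpr
    (le_trans (ENNReal.tsum_le_tsum fun l => ?_) (tsum_triTerm_sq_le hκ hs hk hc hd he))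
  refine mul_le_mul_right (pow_le_pow_left₀ zero_le ?_ 2) _
  exact enorm_tsum_le_tsum_enorm

/-- The bounds are there to secure summability, under which `tsum` is additive; the two exponents on
the left of the kernel bounds may therefore differ. -/
theorem Tri_kernel_sub {κ B B' A₁ A₂ A₃ : ℝ} (hκ : 0 < κ) {s s₁ s₂ : ℕ} (hs : 1 ≤ s)
    {k k' : ℤ → ℤ → ℤ → ℂ} (hk : KB κ s₁ s B k) (hk' : KB κ s₂ s B' k') {c d e : ℤ → ℂ}
    (hc : HB κ s A₁ c) (hd : HB κ s A₂ d) (he : HB κ s A₃ e) (l : ℤ) :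
    Tri (fun p q r => k p q r - k' p q r) c d e l = Tri k c d e l - Tri k' c d e l := by
  unfold Tri
  rw [← (summable_triTerm hκ hs hk hc hd he l).of_norm.tsum_sub
    (summable_triTerm hκ hs hk' hc hd he l).of_norm]
  exact tsum_congr fun x => by unfold triTerm; ring

theorem Tri_kernel_add {κ B B' A₁ A₂ A₃ : ℝ} (hκ : 0 < κ) {s s₁ s₂ : ℕ} (hs : 1 ≤ s)
    {k k' : ℤ → ℤ → ℤ → ℂ} (hk : KB κ s₁ s B k) (hk' : KB κ s₂ s B' k') {c d e : ℤ → ℂ}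
    (hc : HB κ s A₁ c) (hd : HB κ s A₂ d) (he : HB κ s A₃ e) (l : ℤ) :
    Tri (fun p q r => k p q r + k' p q r) c d e l = Tri k c d e l + Tri k' c d e l := by
  unfold Tri
  rw [← (summable_triTerm hκ hs hk hc hd he l).of_norm.tsum_add
    (summable_triTerm hκ hs hk' hc hd he l).of_norm]
  exact tsum_congr fun x => by unfold triTerm; ring

theorem Tri_sub {κ B A₁ A₂ A₃ A₁' A₂' A₃' : ℝ} (hκ : 0 < κ) {s s₁ : ℕ} (hs : 1 ≤ s)
    {k : ℤ → ℤ → ℤ → ℂ} (hk : KB κ s₁ s B k) {c d e c' d' e' : ℤ → ℂ}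
    (hc : HB κ s A₁ c) (hd : HB κ s A₂ d) (he : HB κ s A₃ e)
    (hc' : HB κ s A₁' c') (hd' : HB κ s A₂' d') (he' : HB κ s A₃' e') (l : ℤ) :
    Tri k c d e l - Tri k c' d' e' l = Tri k (fun l => c l - c' l) d e l
      + Tri k c' (fun l => d l - d' l) e l + Tri k c' d' (fun l => e l - e' l) l := by
  unfold Tri
  have h1 := summable_triTerm hκ hs hk hc hd he l
  have h2 := summable_triTerm hκ hs hk hc' hd' he' l
  have h3 := summable_triTerm hκ hs hk (hc.sub hc') hd he l
  have h4 := summable_triTerm hκ hs hk hc' (hd.sub hd') he l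
  have h5 := summable_triTerm hκ hs hk hc' hd' (he.sub he') l
  rw [← h1.of_norm.tsum_sub h2.of_norm, ← h3.of_norm.tsum_add h4.of_norm,
    ← (h3.of_norm.add h4.of_norm).tsum_add h5.of_norm]
  exact tsum_congr fun x => by unfold triTerm; rw [map_sub]; ring

/-- The cubic map is locally Lipschitz. -/
theorem HB.tri_sub_tri {κ B A D : ℝ} (hκ : 0 < κ) {s s' : ℕ} (hs : 1 ≤ s)
    {k : ℤ → ℤ → ℤ → ℂ} (hk : KB κ s' s B k) {c c' : ℤ → ℂ}
    (hc : HB κ s A c) (hc' : HB κ s A c') (hD : HB κ s D (fun l => c l - c' l)) :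
    HB κ s' (9 * B * wtSum κ * A ^ 2 * D) (fun l => Tri k c c c l - Tri k c' c' c' l) := by
  simp only [Tri_sub hκ hs hk hc hc hc hc' hc' hc']
  refine (((HB.tri hκ hs hk hD hc hc).add (HB.tri hκ hs hk hc' hD hc)).add
    (HB.tri hκ hs hk hc' hc' hD)).mono (le_of_eq ?_)
  ring

theorem KB_one (κ : ℝ) (s : ℕ) : KB κ s s (3 ^ s) (fun _ _ _ => 1) := fun p q r => by
  rw [norm_one, mul_one, ← mul_pow]
  exact pow_le_pow_left₀ (jb_pos κ _).le (jb_sub_add_le κ p q r) s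

theorem KB.of_norm_le {κ B K : ℝ} {s s' : ℕ} {k k' : ℤ → ℤ → ℤ → ℂ} (h : KB κ s' s B k)
    (hK : 0 ≤ K) (hkk : ∀ p q r, ‖k' p q r‖ ≤ K * ‖k p q r‖) : KB κ s' s (K * B) k' :=
  fun p q r => by
    have hj := pow_nonneg (jb_pos κ (p - q + r)).le s'
    calc jb κ (p - q + r) ^ s' * ‖k' p q r‖ ≤ jb κ (p - q + r) ^ s' * (K * ‖k p q r‖) :=
          mul_le_mul_of_nonneg_left (hkk p q r) hj
      _ = K * (jb κ (p - q + r) ^ s' * ‖k p q r‖) := by ring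
      _ ≤ K * (B * jbMax κ p q r ^ s) := mul_le_mul_of_nonneg_left (h p q r) hK
      _ = _ := by ring

theorem KB.mono {κ B B' : ℝ} {s s' : ℕ} {k : ℤ → ℤ → ℤ → ℂ} (h : KB κ s' s B k) (hB : B ≤ B') :
    KB κ s' s B' k := fun p q r => (h p q r).trans
  (mul_le_mul_of_nonneg_right hB (pow_nonneg (by linarith [one_le_jbMax κ p q r]) s))

theorem KB.of_le {κ B : ℝ} {s s' t : ℕ} {k : ℤ → ℤ → ℤ → ℂ} (h : KB κ s' s B k) (hst : s ≤ t) :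
    KB κ s' t B k := fun p q r => (h p q r).trans
  (mul_le_mul_of_nonneg_left (pow_le_pow_right₀ (one_le_jbMax κ p q r) hst) h.nonneg)

/-! ### Aliasing and truncation errors -/

theorem HB.term_summable {κ A : ℝ} (hκ : 0 < κ) {s : ℕ} (hs : 1 ≤ s) {c : ℤ → ℂ}
    (h : HB κ s A c) {N : ℕ} (hN : 0 < N) (l : ℤ) : Summable fun k : ℤ => ‖c (l + k * N)‖ :=
  (h.summable_norm hκ hs).comp_injective (i := fun k : ℤ => l + k * N) fun k k' hk => by
    simpa [hN.ne'] using hk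

/-- Restriction of a sequence to the frequencies of the grid. -/
noncomputable def trunc (N : ℕ) (c : ℤ → ℂ) (l : ℤ) : ℂ := if l ∈ freqs N then c l else 0

/-- The discrete Fourier coefficients of a function with Fourier coefficients `c`. -/
noncomputable def aliased (N : ℕ) (c : ℤ → ℂ) (l : ℤ) : ℂ :=
  if l ∈ freqs N then ∑' k : ℤ, c (l + k * N) else 0

/-- The constant of the aliasing estimate. -/
noncomputable def aliasConst (κ : ℝ) : ℝ :=
  Real.sqrt ((4 / κ ^ 2 + 1) * ∑' k : ℤ, 1 / (k : ℝ) ^ 2)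

theorem aliasConst_nonneg (κ : ℝ) : 0 ≤ aliasConst κ := Real.sqrt_nonneg _

theorem two_mul_abs_le_of_mem_freqs {N : ℕ} {l : ℤ} (hl : l ∈ freqs N) : 2 * |l| ≤ N := by
  rw [freqs, Finset.mem_Ico] at hl
  rcases abs_cases l with h | h <;> omega

theorem le_two_mul_abs_of_not_mem_freqs {N : ℕ} (hN : Even N) {l : ℤ} (hl : l ∉ freqs N) :
    (N : ℤ) ≤ 2 * |l| := by
  rw [freqs, Finset.mem_Ico] at hl
  obtain ⟨k, rfl⟩ := hN
  rcases abs_cases l with h | h <;> omega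

/-- For $2|l|\le N$ and $k\ne0$ one has $2|l+kN|\ge|k|N$, which with $\kappa Nh=2\pi$ becomes $(\pi
k)^2\le h^2w_{l+kN}$. In particular $h^2w_{l+kN}\ge1$, so $s-1$ further powers of it may be
inserted. The factor $k^2$ on the left makes the sum over all aliases converge. -/
theorem alias_weight_le {κ h : ℝ} (hκ : 0 < κ) {N : ℕ} (hN : 0 < N) (hh : κ * N * h = 2 * Real.pi)
    {s : ℕ} (hs : 1 ≤ s) {l : ℤ} (hl : l ∈ freqs N) (k : ℤ) :
    (k : ℝ) ^ 2 * wt κ l ≤ (4 / κ ^ 2 + 1) * (h ^ (s - 1)) ^ 2 * wt κ (l + k * N) ^ s := by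
  by_cases hk : k = 0
  · subst hk
    have := pow_pos (wt_pos κ (l + (0 : ℤ) * N)) s
    rw [Int.cast_zero, zero_pow two_ne_zero, zero_mul]
    positivity
  have hNr : (1 : ℝ) ≤ N := by exact_mod_cast hN
  have hκN : 0 < κ * N := by positivity
  have hpos : 0 < h := by
    by_contra hc
    have := mul_nonpos_of_nonneg_of_nonpos hκN.le (not_lt.mp hc)
    linarith [Real.pi_pos]
  have hkr : (1 : ℝ) ≤ |(k : ℝ)| := by exact_mod_cast Int.one_le_abs hk
  have hl2 : 2 * |(l : ℝ)| ≤ N := by exact_mod_cast two_mul_abs_le_of_mem_freqs hl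
  have h1 : |(k : ℝ)| * N ≤ 2 * |((l + k * N : ℤ) : ℝ)| := by
    push_cast
    have h2 : |(k : ℝ)| * N = |(l + k * N : ℝ) - l| := by
      rw [add_sub_cancel_left, abs_mul, Nat.abs_cast]
    have h3 := abs_sub (l + k * N : ℝ) (l : ℝ)
    nlinarith
  have h4 : (Real.pi * k) ^ 2 ≤ h ^ 2 * wt κ (l + k * N) := by
    have h5 : |Real.pi * k| ≤ |h * (κ * ((l + k * N : ℤ) : ℝ))| := by
      rw [abs_mul, abs_mul, abs_mul, abs_of_pos Real.pi_pos, abs_of_pos hpos, abs_of_pos hκ]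
      have : Real.pi = κ * N * h / 2 := by linarith
      rw [this]
      have hκh : 0 < κ * h := by positivity
      nlinarith
    have h6 := sq_le_sq.mpr h5
    unfold wt
    nlinarith [sq_nonneg h]
  -- The two summands of the constant come from $h\le2\pi/\kappa$, which is $N\ge1$, and from
  -- $h\kappa|l|\le\pi$.
  have h7 : h ^ 2 * wt κ l ≤ (4 / κ ^ 2 + 1) * Real.pi ^ 2 := by
    have h8 : h ≤ 2 * Real.pi / κ := by
      rw [le_div_iff₀ hκ]; nlinarith [mul_pos hκ hpos]
    have h9 : h ^ 2 ≤ (2 * Real.pi / κ) ^ 2 := pow_le_pow_left₀ hpos.le h8 2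
    have h10 : (h * (κ * l)) ^ 2 ≤ Real.pi ^ 2 := by
      refine sq_le_sq.mpr ?_
      rw [abs_mul, abs_mul, abs_of_pos hpos, abs_of_pos hκ, abs_of_pos Real.pi_pos]
      have hκh : 0 < κ * h := by positivity
      nlinarith
    unfold wt
    calc h ^ 2 * (1 + (κ * l) ^ 2) = h ^ 2 + (h * (κ * l)) ^ 2 := by ring
      _ ≤ (2 * Real.pi / κ) ^ 2 + Real.pi ^ 2 := add_le_add h9 h10
      _ = _ := by field_simp; ring
  have hπ : (1 : ℝ) ≤ Real.pi ^ 2 := by nlinarith [Real.pi_gt_three]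
  set W := wt κ (l + k * N) with hW
  have hWp : 0 < W := wt_pos _ _
  have hC : 0 < 4 / κ ^ 2 + 1 := by positivity
  have hk2 : (1 : ℝ) ≤ (k : ℝ) ^ 2 := by rw [← sq_abs]; nlinarith
  have h11 : 1 ≤ h ^ 2 * W := by nlinarith
  have h12 : (k : ℝ) ^ 2 * wt κ l ≤ (4 / κ ^ 2 + 1) * W := by
    have h13 := mul_le_mul h4 h7 (by have := wt_pos κ l; positivity) (by positivity)
    have h14 : 0 < Real.pi ^ 2 * h ^ 2 := by positivity
    refine le_of_mul_le_mul_left ?_ h14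
    nlinarith
  have h15 : 1 ≤ (h ^ 2 * W) ^ (s - 1) := one_le_pow₀ h11
  calc (k : ℝ) ^ 2 * wt κ l ≤ (4 / κ ^ 2 + 1) * W := h12
    _ ≤ (4 / κ ^ 2 + 1) * W * (h ^ 2 * W) ^ (s - 1) := le_mul_of_one_le_right (by positivity) h15
    _ = (4 / κ ^ 2 + 1) * (h ^ (s - 1)) ^ 2 * (W ^ (s - 1) * W) := by rw [mul_pow]; ring
    _ = _ := by rw [← pow_succ, Nat.sub_add_cancel hs]

/-- The aliasing error in `H¹`. -/
theorem HB.aliased_sub_trunc {κ h A : ℝ} (hκ : 0 < κ) {N : ℕ} (hN : 0 < N)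
    (hh : κ * N * h = 2 * Real.pi) {s : ℕ} (hs : 1 ≤ s) {c : ℤ → ℂ} (hc : HB κ s A c) :
    HB κ 1 (aliasConst κ * h ^ (s - 1) * A) (fun l => aliased N c l - trunc N c l) := by
  have hpos : 0 < h := by
    by_contra hneg
    have : 0 < κ * N := by positivity
    nlinarith [Real.pi_pos]
  have hZ : Summable fun k : ℤ => 1 / (k : ℝ) ^ 2 := Real.summable_one_div_int_pow.mpr one_lt_two
  have hZ0 : 0 ≤ ∑' k : ℤ, 1 / (k : ℝ) ^ 2 := tsum_nonneg fun k => by positivity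
  have hA := hc.nonneg
  set C := (4 / κ ^ 2 + 1) * (h ^ (s - 1)) ^ 2 with hCdef
  have hC : 0 ≤ C := by positivity
  refine (HB.iff_tsum (by have := aliasConst_nonneg κ; positivity)).mpr ?_
  set f : ℤ → ℝ≥0∞ := fun n => ENNReal.ofReal (wt κ n ^ s) * ‖c n‖ₑ ^ 2 with hf
  have hterm : ∀ l ∈ freqs N, ENNReal.ofReal (wt κ l ^ 1) *
      ‖aliased N c l - trunc N c l‖ₑ ^ 2 ≤
      ENNReal.ofReal (C * ∑' k : ℤ, 1 / (k : ℝ) ^ 2) * ∑' k : ℤ, f (l + k * N) := by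
    intro l hl
    -- The term `k = 0` of the alias sum is the truncated sequence itself; the error consists of the
    -- others.
    set d : ℤ → ℂ := fun k => if k = 0 then 0 else c (l + k * N) with hd
    have hsum := (hc.term_summable hκ hs hN l).of_norm
    have hdiff : aliased N c l - trunc N c l = ∑' k, d k := by
      have h1 := hsum.tsum_eq_add_tsum_ite 0
      simp only [aliased, trunc, hl, if_true]
      rw [h1]; simp [hd]
    have hE : ‖aliased N c l - trunc N c l‖ₑ ≤ ∑' k, ‖d k‖ₑ := by
      rw [hdiff]; exact enorm_tsum_le_tsum_enorm
    have hcs : ENNReal.ofReal (wt κ l) * (∑' k, ‖d k‖ₑ) ^ 2 ≤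
        (∑' k : ℤ, ENNReal.ofReal (C * (1 / (k : ℝ) ^ 2))) * ∑' k : ℤ, f (l + k * N) := by
      have e1 : ENNReal.ofReal (wt κ l) * (∑' k, ‖d k‖ₑ) ^ 2
          = (∑' k, ENNReal.ofReal (jb κ l) * ‖d k‖ₑ) ^ 2 := by
        rw [ENNReal.tsum_mul_left, mul_pow, ← ENNReal.ofReal_pow (jb_pos κ l).le, jb_sq]
      rw [e1]
      refine tsum_sq_le_of_sq_le fun k => ?_
      by_cases hk : k = 0
      · simp [hd, hk]
      · have hk2 : (0 : ℝ) < (k : ℝ) ^ 2 := by positivity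
        simp only [hd, hk, if_false, hf]
        rw [mul_pow, ← ENNReal.ofReal_pow (jb_pos κ l).le, jb_sq, ← mul_assoc,
          ← ENNReal.ofReal_mul (by positivity)]
        refine mul_le_mul_left (ENNReal.ofReal_le_ofReal ?_) _
        have h2 := alias_weight_le hκ hN hh hs hl k
        rw [mul_one_div, div_mul_eq_mul_div, le_div_iff₀ hk2]
        linarith
    rw [← ENNReal.ofReal_tsum_of_nonneg (fun k => by positivity) (hZ.mul_left C),
      tsum_mul_left] at hcs
    rw [pow_one]
    exact (mul_le_mul_right (pow_le_pow_left₀ zero_le hE 2) _).trans hcs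
  have hzero : ∀ l ∉ freqs N, ENNReal.ofReal (wt κ l ^ 1) *
      ‖aliased N c l - trunc N c l‖ₑ ^ 2 = 0 := fun l hl => by simp [aliased, trunc, hl]
  rw [tsum_eq_sum hzero]
  refine (Finset.sum_le_sum hterm).trans ?_
  rw [← Finset.mul_sum]
  -- Every integer is $l+kN$ for at most one pair with $l$ a grid frequency, so the alias sums
  -- together do not exceed the full norm.
  have hinj : ∑ l ∈ freqs N, ∑' k : ℤ, f (l + k * N) ≤ ∑' n, f n := by
    rw [← Finset.tsum_subtype (freqs N) fun l => ∑' k : ℤ, f (l + k * N)]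
    rw [← ENNReal.tsum_prod (f := fun (l : {x // x ∈ freqs N}) (k : ℤ) => f (l + k * N))]
    refine ENNReal.tsum_comp_le_tsum_of_injective
      (f := fun x : {x // x ∈ freqs N} × ℤ => (x.1 : ℤ) + x.2 * N) ?_ f
    rintro ⟨⟨l, hl⟩, k⟩ ⟨⟨l', hl'⟩, k'⟩ heq
    simp only at heq
    rw [freqs, Finset.mem_Ico] at hl hl'
    have hkk : k = k' := by
      by_contra hne
      have h1 : l - l' = (k' - k) * N := by linarith
      have h2 : |l - l'| < N := by rw [abs_lt]; omega
      rw [h1, abs_mul, Nat.abs_cast] at h2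
      have h3 : 1 ≤ |k' - k| := Int.one_le_abs (sub_ne_zero.mpr (Ne.symm hne))
      nlinarith [(Nat.cast_pos.mpr hN : (0 : ℤ) < N)]
    subst hkk
    simp_all
  refine (mul_le_mul_right (hinj.trans ((HB.iff_tsum hA).mp hc)) _).trans (le_of_eq ?_)
  rw [← ENNReal.ofReal_mul (by positivity)]
  congr 1
  rw [mul_pow, mul_pow, aliasConst, Real.sq_sqrt (by positivity), hCdef]
  ring

theorem HB.trunc {κ A : ℝ} {s : ℕ} {c : ℤ → ℂ} (hc : HB κ s A c) (N : ℕ) :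
    HB κ s A (trunc N c) := hc.of_norm_le_one fun l => by
  unfold NLSTSFP.trunc; split_ifs <;> simp

/-- The truncation error in `H¹`. -/
theorem HB.trunc_sub {κ h A : ℝ} (hκ : 0 < κ) {N : ℕ} (hN : Even N) (hN0 : 0 < N)
    (hh : κ * N * h = 2 * Real.pi) {s : ℕ} (hs : 1 ≤ s) {c : ℤ → ℂ} (hc : HB κ s A c) :
    HB κ 1 (h ^ (s - 1) * A) (fun l => NLSTSFP.trunc N c l - c l) := by
  have hpos : 0 < h := by
    by_contra hneg
    have : 0 < κ * N := by positivity
    nlinarith [Real.pi_pos]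
  refine hc.of_weight_le (by positivity) fun l => ?_
  by_cases hl : l ∈ freqs N
  · simp only [NLSTSFP.trunc, hl, if_true, sub_self, norm_zero]
    have := pow_pos (wt_pos κ l) s
    rw [zero_pow two_ne_zero, mul_zero]; positivity
  · simp only [NLSTSFP.trunc, hl, if_false, zero_sub, norm_neg]
    have h1 : (N : ℝ) ≤ 2 * |(l : ℝ)| := by exact_mod_cast le_two_mul_abs_of_not_mem_freqs hN hl
    have h2 : Real.pi ^ 2 ≤ (h * (κ * l)) ^ 2 := by
      refine sq_le_sq.mpr ?_
      rw [abs_mul, abs_mul, abs_of_pos hpos, abs_of_pos hκ, abs_of_pos Real.pi_pos]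
      have hκh : 0 < κ * h := by positivity
      nlinarith
    have h3 : 1 ≤ h ^ 2 * wt κ l := by
      unfold wt; nlinarith [Real.pi_gt_three, sq_nonneg h]
    have h4 : 1 ≤ (h ^ 2 * wt κ l) ^ (s - 1) := one_le_pow₀ h3
    have hw := wt_pos κ l
    calc wt κ l ^ 1 * ‖c l‖ ^ 2 ≤ (h ^ 2 * wt κ l) ^ (s - 1) * (wt κ l ^ 1 * ‖c l‖ ^ 2) :=
          le_mul_of_one_le_left (by positivity) h4
      _ = (h ^ (s - 1)) ^ 2 * ((wt κ l ^ (s - 1) * wt κ l) * ‖c l‖ ^ 2) := by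
          rw [mul_pow]; ring
      _ = _ := by rw [← pow_succ, Nat.sub_add_cancel hs]

/-- Stability of interpolation in `H¹`. -/
theorem HB.aliased {κ h A : ℝ} (hκ : 0 < κ) {N : ℕ} (hN : 0 < N)
    (hh : κ * N * h = 2 * Real.pi) {c : ℤ → ℂ} (hc : HB κ 1 A c) :
    HB κ 1 ((1 + aliasConst κ) * A) (aliased N c) := by
  -- At `s = 1` the power of `h` is `h ^ 0`, so the bound is uniform in the grid.
  have h1 := (hc.aliased_sub_trunc hκ hN hh le_rfl).add (hc.trunc N)
  simp only [sub_add_cancel] at h1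
  exact h1.mono (le_of_eq (by simp; ring))

/-! ### Phases, the resonance function and the twisted variable -/

/-- The phase `e^{ix}`. -/
noncomputable def ph (x : ℝ) : ℂ := Complex.exp (Complex.I * (x : ℂ))

theorem norm_ph (x : ℝ) : ‖ph x‖ = 1 := Complex.norm_exp_I_mul_ofReal x

theorem ph_add (x y : ℝ) : ph (x + y) = ph x * ph y := by
  unfold ph; rw [← Complex.exp_add]; push_cast; ring_nf

theorem ph_zero : ph 0 = 1 := by simp [ph]

theorem ph_neg (x : ℝ) : ph (-x) = (starRingEnd ℂ) (ph x) := by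
  unfold ph; rw [← Complex.exp_conj]; simp

theorem ph_mul_ph_neg (x : ℝ) : ph x * ph (-x) = 1 := by rw [← ph_add]; simp [ph_zero]

theorem continuous_ph : Continuous ph := by unfold ph; fun_prop

theorem hasDerivAt_ph_mul (d t : ℝ) :
    HasDerivAt (fun t => ph (t * d)) (Complex.I * d * ph (t * d)) t := by
  have h1 : HasDerivAt (fun t : ℝ => Complex.I * ((t * d : ℝ) : ℂ)) (Complex.I * d) t := by
    have h2 : HasDerivAt (fun t : ℝ => ((t * d : ℝ) : ℂ)) ((d : ℝ) : ℂ) t := by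
      simpa using ((hasDerivAt_id t).mul_const d).ofReal_comp
    exact h2.const_mul _
  have := h1.cexp
  unfold ph
  convert! this using 1
  ring

theorem norm_ph_sub_ph_le (x y d : ℝ) : ‖ph (x * d) - ph (y * d)‖ ≤ |x - y| * |d| := by
  have h1 : ph (x * d) - ph (y * d) = ph (y * d) * (ph ((x - y) * d) - 1) := by
    rw [mul_sub, ← ph_add, mul_one]; ring_nf
  rw [h1, norm_mul, norm_ph, one_mul, ← abs_mul]
  unfold ph
  rw [Complex.norm_exp_I_mul_ofReal_sub_one, Real.norm_eq_abs, abs_mul, abs_two]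
  have := Real.abs_sin_le_abs (x := (x - y) * d / 2)
  rw [abs_div, abs_two] at this
  linarith

theorem norm_one_sub_ph (x : ℝ) : ‖1 - ph x‖ = 2 * |Real.sin (x / 2)| := by
  rw [norm_sub_rev]
  unfold ph
  rw [Complex.norm_exp_I_mul_ofReal_sub_one, Real.norm_eq_abs, abs_mul, abs_two]

/-- The integer `l² - p² + q² - r²` with `l = p - q + r`. -/
def resInt (p q r : ℤ) : ℤ := (p - q + r) ^ 2 - p ^ 2 + q ^ 2 - r ^ 2

/-- The resonance function `μ_l² - μ_p² + μ_q² - μ_r²` with `l = p - q + r`. -/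
noncomputable def res (κ : ℝ) (p q r : ℤ) : ℝ := κ ^ 2 * resInt p q r

/-- The kernel `e^{itδ}` of the cubic nonlinearity in the twisted variable. -/
noncomputable def phKer (κ t : ℝ) (p q r : ℤ) : ℂ := ph (t * res κ p q r)

theorem res_eq (κ : ℝ) (p q r : ℤ) : res κ p q r =
    (κ * ((p - q + r : ℤ) : ℝ)) ^ 2 - (κ * p) ^ 2 + (κ * q) ^ 2 - (κ * r) ^ 2 := by
  unfold res resInt; push_cast; ring

theorem sq_le_jbMax_sq (κ : ℝ) (p q r : ℤ) : (κ * p) ^ 2 ≤ jbMax κ p q r ^ 2 ∧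
    (κ * q) ^ 2 ≤ jbMax κ p q r ^ 2 ∧ (κ * r) ^ 2 ≤ jbMax κ p q r ^ 2 := by
  have key : ∀ l, jb κ l ≤ jbMax κ p q r → (κ * l) ^ 2 ≤ jbMax κ p q r ^ 2 := fun l h => by
    rw [← sq_abs (κ * l)]
    exact pow_le_pow_left₀ (abs_nonneg _) ((abs_le_jb κ l).trans h) 2
  exact ⟨key p (le_max_left _ _), key q ((le_max_left _ _).trans (le_max_right _ _)),
    key r ((le_max_right _ _).trans (le_max_right _ _))⟩

theorem abs_res_le (κ : ℝ) (p q r : ℤ) : |res κ p q r| ≤ 10 * jbMax κ p q r ^ 2 := by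
  obtain ⟨hp, hq, hr⟩ := sq_le_jbMax_sq κ p q r
  have hl : (κ * ((p - q + r : ℤ) : ℝ)) ^ 2 ≤ (3 * jbMax κ p q r) ^ 2 := by
    rw [← sq_abs]
    exact pow_le_pow_left₀ (abs_nonneg _) ((abs_le_jb κ _).trans (jb_sub_add_le κ p q r)) 2
  rw [res_eq, abs_le]
  constructor <;> nlinarith [sq_nonneg (κ * p), sq_nonneg (κ * q), sq_nonneg (κ * r),
    sq_nonneg (κ * ((p - q + r : ℤ) : ℝ))]

theorem KB_phKer (κ t : ℝ) (s : ℕ) : KB κ s s (3 ^ s) (phKer κ t) := by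
  simpa using (KB_one κ s).of_norm_le (k' := phKer κ t) zero_le_one fun p q r => by
    simp [phKer, norm_ph]

/-- Shifting the time in the phase costs a factor $|\delta|\le10M^2$, with $M$ the largest bracket,
and the $H^1$ weight of the output at most $3M$: three derivatives in all. -/
theorem KB_phKer_sub (κ x y : ℝ) {s : ℕ} (hs : 3 ≤ s) :
    KB κ 1 s (30 * |x - y|) (fun p q r => phKer κ x p q r - phKer κ y p q r) := by
  refine KB.of_le (s := 3) (fun p q r => ?_) hs
  have h1 := norm_ph_sub_ph_le x y (res κ p q r)
  have h2 := abs_res_le κ p q r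
  have h3 := jb_sub_add_le κ p q r
  have h4 := one_le_jbMax κ p q r
  have h5 := abs_nonneg (x - y)
  calc jb κ (p - q + r) ^ 1 * ‖phKer κ x p q r - phKer κ y p q r‖
      ≤ (3 * jbMax κ p q r) * (|x - y| * (10 * jbMax κ p q r ^ 2)) := by
        rw [pow_one]
        exact mul_le_mul h3 (h1.trans (mul_le_mul_of_nonneg_left h2 h5)) (norm_nonneg _)
          (by linarith)
    _ = _ := by ring

/-- Multiplication of the `l`-th entry by `e^{itμ_l²}`. -/
noncomputable def twist (κ t : ℝ) (c : ℤ → ℂ) (l : ℤ) : ℂ := ph (t * (κ * l) ^ 2) * c l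

theorem norm_twist (κ t : ℝ) (c : ℤ → ℂ) (l : ℤ) : ‖twist κ t c l‖ = ‖c l‖ := by
  rw [twist, norm_mul, norm_ph, one_mul]

theorem HB.twist {κ A : ℝ} {s : ℕ} {c : ℤ → ℂ} (hc : HB κ s A c) (t : ℝ) :
    HB κ s A (twist κ t c) := hc.of_norm_le_one fun l => (norm_twist κ t c l).le

theorem twist_twist_neg (κ t : ℝ) (c : ℤ → ℂ) : twist κ t (twist κ (-t) c) = c := by
  funext l
  rw [NLSTSFP.twist, NLSTSFP.twist, ← mul_assoc, neg_mul, ph_mul_ph_neg, one_mul]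

theorem twist_add (κ t u : ℝ) (c : ℤ → ℂ) : twist κ t (twist κ u c) = twist κ (t + u) c := by
  funext l
  rw [NLSTSFP.twist, NLSTSFP.twist, NLSTSFP.twist, ← mul_assoc, ← ph_add, add_mul]

/-- The free phases of the four frequencies in one interaction multiply to $e^{it\delta}$.
Conjugation by the free flow thus changes only the kernel of the cubic term. -/
theorem twist_Tri (κ t : ℝ) (c d e : ℤ → ℂ) (l : ℤ) :
    twist κ t (Tri (fun _ _ _ => 1) (twist κ (-t) c) (twist κ (-t) d) (twist κ (-t) e)) l
      = Tri (phKer κ t) c d e l := by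
  unfold NLSTSFP.twist Tri
  rw [← tsum_mul_left]
  refine tsum_congr fun x => ?_
  have h1 : phKer κ t x.1 x.2 (l - x.1 + x.2) = ph (t * (κ * l) ^ 2) * ph (-t * (κ * x.1) ^ 2) *
      (starRingEnd ℂ) (ph (-t * (κ * x.2) ^ 2)) *
      ph (-t * (κ * ((l - x.1 + x.2 : ℤ) : ℝ)) ^ 2) := by
    rw [← ph_neg, ← ph_add, ← ph_add, ← ph_add]
    unfold phKer
    rw [res_eq, show x.1 - x.2 + (l - x.1 + x.2) = l by ring]
    congr 1; ring
  unfold triTerm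
  rw [h1, map_mul]
  ring

/-! ### The midpoint defect and summation by parts -/

/-- The local defect `τ e^{iτδ/2} - ∫_0^τ e^{isδ} ds` of the midpoint rule. -/
noncomputable def midDefect (τ δ : ℝ) : ℂ := τ * ph (τ / 2 * δ) - ∫ s in (0 : ℝ)..τ, ph (s * δ)

theorem norm_midDefect_le {τ : ℝ} (hτ : 0 ≤ τ) (δ : ℝ) : ‖midDefect τ δ‖ ≤ 2 * τ := by
  refine (norm_sub_le _ _).trans ?_
  have h1 : ‖(τ : ℂ) * ph (τ / 2 * δ)‖ = τ := by
    rw [norm_mul, norm_ph, Complex.norm_real, Real.norm_eq_abs, abs_of_nonneg hτ, mul_one]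
  have h2 := intervalIntegral.norm_integral_le_of_norm_le_const (a := 0) (b := τ) (C := 1)
    (f := fun s => ph (s * δ)) fun s _ => (norm_ph _).le
  rw [sub_zero, abs_of_nonneg hτ, one_mul] at h2
  linarith

theorem midDefect_zero (τ : ℝ) : midDefect τ 0 = 0 := by simp [midDefect, ph_zero]

/-- Once the phase $e^{i\tau\delta/2}$ of the midpoint is factored out, the integral is symmetric
about it, hence real and equal to $2\sin(\tau\delta/2)/\delta$. -/
theorem norm_midDefect_eq (τ : ℝ) {δ : ℝ} (hδ : δ ≠ 0) :
    ‖midDefect τ δ‖ = |τ - 2 * Real.sin (τ * δ / 2) / δ| := by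
  have hδ' : (δ : ℂ) ≠ 0 := by exact_mod_cast hδ
  have h1 : ∫ s in (0 : ℝ)..τ, ph (s * δ) = (ph (τ * δ) - 1) / (Complex.I * δ) := by
    have hd : ∀ s ∈ Set.uIcc 0 τ,
        HasDerivAt (fun s => ph (s * δ) / (Complex.I * δ)) (ph (s * δ)) s := fun s _ => by
      have := (hasDerivAt_ph_mul δ s).div_const (Complex.I * δ)
      convert! this using 1
      field_simp
    rw [intervalIntegral.integral_eq_sub_of_hasDerivAt hd
      ((continuous_ph.comp (continuous_id.mul continuous_const)).intervalIntegrable _ _)]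
    rw [zero_mul, ph_zero, sub_div]
  have h2 : ph (τ * δ) - 1 = ph (τ / 2 * δ) * (2 * Complex.I * Real.sin (τ * δ / 2)) := by
    have e1 : ph (τ * δ) = ph (τ / 2 * δ) * ph (τ / 2 * δ) := by rw [← ph_add]; ring_nf
    have e2 : (1 : ℂ) = ph (τ / 2 * δ) * ph (-(τ / 2 * δ)) := (ph_mul_ph_neg _).symm
    have e3 : ph (τ / 2 * δ) - ph (-(τ / 2 * δ)) = 2 * Complex.I * Real.sin (τ * δ / 2) := by
      unfold ph
      rw [Complex.ofReal_sin, Complex.sin, show τ * δ / 2 = τ / 2 * δ by ring]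
      push_cast
      ring_nf
      rw [Complex.I_sq]; ring_nf
    rw [e1, ← e3, mul_sub, ← e2]
  have h3 : midDefect τ δ
      = ph (τ / 2 * δ) * ((τ - 2 * Real.sin (τ * δ / 2) / δ : ℝ) : ℂ) := by
    unfold midDefect
    rw [h1, h2]
    push_cast
    field_simp
  rw [h3, norm_mul, norm_ph, one_mul, Complex.norm_real, Real.norm_eq_abs]

/-- All four frequencies of a resonance are at most `n`. -/
def Low (n : ℤ) (p q r : ℤ) : Prop := |p| ≤ n ∧ |q| ≤ n ∧ |r| ≤ n ∧ |p - q + r| ≤ n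

theorem Low.abs_resInt_le {n p q r : ℤ} (h : Low n p q r) : |resInt p q r| ≤ 2 * n ^ 2 := by
  obtain ⟨hp, hq, hr, hl⟩ := h
  have key : ∀ x : ℤ, |x| ≤ n → x ^ 2 ≤ n ^ 2 := fun x hx => by
    rw [← sq_abs]; exact pow_le_pow_left₀ (abs_nonneg _) hx 2
  have h1 := key p hp
  have h2 := key q hq
  have h3 := key r hr
  have h4 := key _ hl
  unfold resInt
  rw [abs_le]
  constructor <;> nlinarith [sq_nonneg p, sq_nonneg q, sq_nonneg r, sq_nonneg (p - q + r)]

open Classical in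
/-- The low frequency part of the defect kernel, divided by `1 - e^{iτδ}`. -/
noncomputable def abelKer (κ τ : ℝ) (n p q r : ℤ) : ℂ :=
  if Low n p q r then midDefect τ (res κ p q r) / (1 - ph (τ * res κ p q r)) else 0

open Classical in
/-- The high frequency part of the defect kernel. -/
noncomputable def highKer (κ τ : ℝ) (n p q r : ℤ) : ℂ :=
  if Low n p q r then 0 else midDefect τ (res κ p q r)

/-- The summation by parts bound for low frequency defects. -/
def AbelBound (κ τ : ℝ) (n : ℤ) (m : ℕ) (B : ℝ) : Prop :=
  ∀ p q r, Low n p q r → resInt p q r ≠ 0 →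
    jb κ (p - q + r) * ‖midDefect τ (res κ p q r)‖
      ≤ B * τ ^ 2 * ‖1 - ph (τ * res κ p q r)‖ * jbMax κ p q r ^ m

theorem KB_abelKer {κ τ B : ℝ} {n : ℤ} {m : ℕ} (hB : 0 ≤ B) (h : AbelBound κ τ n m B) :
    KB κ 1 m (B * τ ^ 2) (abelKer κ τ n) := fun p q r => by
  have hM : 0 ≤ jbMax κ p q r ^ m := pow_nonneg (by linarith [one_le_jbMax κ p q r]) m
  have h0 : 0 ≤ B * τ ^ 2 * jbMax κ p q r ^ m := by positivity
  unfold abelKer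
  split_ifs with hl
  · by_cases hr : resInt p q r = 0
    · simp [res, hr, midDefect_zero, h0]
    by_cases hz : 1 - ph (τ * res κ p q r) = 0
    · simp [hz, h0]
    · rw [norm_div, pow_one, ← mul_div_assoc, div_le_iff₀ (norm_pos_iff.mpr hz)]
      linarith [h p q r hl hr]
  · simp [h0]

/-- Where $1-e^{i\tau\delta}$ vanishes, `AbelBound` forces the defect to vanish too, and for
$\delta=0$ it is zero anyway. The value `x / 0 = 0` in `abelKer` is therefore harmless. -/
theorem midDefect_eq_abelKer_add {κ τ B : ℝ} {n : ℤ} {m : ℕ} (h : AbelBound κ τ n m B)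
    (p q r : ℤ) : midDefect τ (res κ p q r)
      = abelKer κ τ n p q r * (1 - ph (τ * res κ p q r)) + highKer κ τ n p q r := by
  unfold abelKer highKer
  split_ifs with hl
  · rw [add_zero]
    by_cases hr : resInt p q r = 0
    · simp [res, hr, midDefect_zero]
    by_cases hz : 1 - ph (τ * res κ p q r) = 0
    · have h1 := h p q r hl hr
      rw [hz, norm_zero, mul_zero, zero_mul] at h1
      have h2 := le_of_mul_le_mul_left (h1.trans (mul_zero (jb κ (p - q + r))).ge) (jb_pos κ _)
      rw [hz, mul_zero]
      exact norm_le_zero_iff.mp h2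
    · rw [div_mul_cancel₀ _ hz]
  · simp

/-- If one of the four frequencies exceeds $n\ge1/\tau_0$, then $1\le(3/\kappa)\tau_0M$, with $M$
the largest input bracket. The power $m-1$ of this inequality is inserted into the trivial bound
$2\tau$ of the defect; the remaining power of $M$ pays for the $H^1$ weight of the output. -/
theorem KB_highKer {κ τ τ₀ : ℝ} (hκ : 0 < κ) (hτ : 0 ≤ τ) (hτ₀ : 0 < τ₀) {n : ℤ}
    (hn : 1 / τ₀ ≤ n) {m : ℕ} (hm : 1 ≤ m) :
    KB κ 1 m (6 * (3 / κ) ^ (m - 1) * τ * τ₀ ^ (m - 1)) (highKer κ τ n) := fun p q r => by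
  have hM1 := one_le_jbMax κ p q r
  have hM0 : 0 < jbMax κ p q r := by linarith
  unfold highKer
  split_ifs with hl
  · rw [norm_zero, mul_zero]; positivity
  have hbig : ∀ l : ℤ, ¬ |l| ≤ n → jb κ l ≤ 3 * jbMax κ p q r →
      1 ≤ 3 / κ * τ₀ * jbMax κ p q r := fun l hl hle => by
    have h1 : (n : ℝ) ≤ |(l : ℝ)| := by exact_mod_cast (not_le.mp hl).le
    have h2 := (abs_le_jb κ l).trans hle
    rw [abs_mul, abs_of_pos hκ] at h2
    have h3 : κ * (1 / τ₀) ≤ 3 * jbMax κ p q r :=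
      (mul_le_mul_of_nonneg_left (hn.trans h1) hκ.le).trans h2
    rw [mul_one_div, div_le_iff₀ hτ₀] at h3
    rw [div_mul_eq_mul_div, div_mul_eq_mul_div, le_div_iff₀ hκ]
    linarith
  have hp : jb κ p ≤ 3 * jbMax κ p q r := by
    have : jb κ p ≤ jbMax κ p q r := le_max_left _ _
    linarith
  have hq : jb κ q ≤ 3 * jbMax κ p q r := by
    have : jb κ q ≤ jbMax κ p q r := (le_max_left _ _).trans (le_max_right _ _)
    linarith
  have hr : jb κ r ≤ 3 * jbMax κ p q r := by
    have : jb κ r ≤ jbMax κ p q r := (le_max_right _ _).trans (le_max_right _ _)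
    linarith
  have h1 : 1 ≤ 3 / κ * τ₀ * jbMax κ p q r := by
    by_contra hcon
    refine hl ⟨?_, ?_, ?_, ?_⟩ <;> by_contra h
    · exact hcon (hbig _ h hp)
    · exact hcon (hbig _ h hq)
    · exact hcon (hbig _ h hr)
    · exact hcon (hbig _ h (jb_sub_add_le κ p q r))
  have h2 := one_le_pow₀ h1 (n := m - 1)
  have h3 : jb κ (p - q + r) ^ 1 * ‖midDefect τ (res κ p q r)‖
      ≤ 3 * jbMax κ p q r * (2 * τ) := by
    rw [pow_one]
    exact mul_le_mul (jb_sub_add_le κ p q r) (norm_midDefect_le hτ _) (norm_nonneg _) (by positivity)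
  calc _ ≤ 3 * jbMax κ p q r * (2 * τ) := h3
    _ ≤ 3 * jbMax κ p q r * (2 * τ) * (3 / κ * τ₀ * jbMax κ p q r) ^ (m - 1) :=
      le_mul_of_one_le_right (by positivity) h2
    _ = 6 * (3 / κ) ^ (m - 1) * τ * τ₀ ^ (m - 1) * (jbMax κ p q r ^ (m - 1) * jbMax κ p q r) := by
      rw [mul_pow, mul_pow]; ring
    _ = _ := by rw [← pow_succ, Nat.sub_add_cancel hm]

/-- The kernel of the leading local error at time `t`. -/
noncomputable def defKer (κ τ t : ℝ) (p q r : ℤ) : ℂ :=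
  ph (t * res κ p q r) * midDefect τ (res κ p q r)

/-- The accumulated leading local errors, by summation by parts. -/
theorem HB.sum_defect {κ τ τ₀ B R D : ℝ} (hκ : 0 < κ) (hτ : 0 ≤ τ) (hτ₀ : 0 < τ₀) {n₀ : ℤ}
    (hn₀ : 1 / τ₀ ≤ n₀) {m : ℕ} (hm : 1 ≤ m) (hB : 0 ≤ B) (hAB : AbelBound κ τ n₀ m B)
    {φ : ℕ → ℤ → ℂ} {n : ℕ} (hφ : ∀ k < n, HB κ m R (φ k))
    (hD : ∀ k, k + 1 < n → HB κ m D (fun l => φ (k + 1) l - φ k l)) (hD0 : 0 ≤ D) (hR0 : 0 ≤ R) :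
    HB κ 1 (n * (18 * (3 / κ) ^ (m - 1) * τ * τ₀ ^ (m - 1) * wtSum κ * R ^ 3)
        + (6 * R + 9 * (n * D)) * (B * τ ^ 2 * wtSum κ * R ^ 2))
      (fun l => ∑ k ∈ range n, Tri (defKer κ τ (k * τ)) (φ k) (φ k) (φ k) l) := by
  have hK := wtSum_nonneg κ
  have hA := KB_abelKer hB hAB
  have hH := KB_highKer (κ := κ) (τ := τ) hκ hτ hτ₀ hn₀ hm
  set ak : ℕ → ℤ → ℤ → ℤ → ℂ := fun k p q r => ph (k * τ * res κ p q r) * abelKer κ τ n₀ p q r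
    with hak
  set hk : ℕ → ℤ → ℤ → ℤ → ℂ := fun k p q r => ph (k * τ * res κ p q r) * highKer κ τ n₀ p q r
    with hhk
  have hKa : ∀ k, KB κ 1 m (B * τ ^ 2) (ak k) := fun k => by
    simpa using hA.of_norm_le (k' := ak k) zero_le_one fun p q r => by simp [hak, norm_ph]
  have hKh : ∀ k, KB κ 1 m (6 * (3 / κ) ^ (m - 1) * τ * τ₀ ^ (m - 1)) (hk k) := fun k => by
    simpa using hH.of_norm_le (k' := hk k) zero_le_one fun p q r => by simp [hhk, norm_ph]
  -- $e^{ik\tau\delta}(1-e^{i\tau\delta})$ is a difference of consecutive phases, so the low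
  -- frequency part is a difference of consecutive kernels acting on the same $\varphi_k$.
  have hsplit : ∀ k < n, ∀ l, Tri (defKer κ τ (k * τ)) (φ k) (φ k) (φ k) l
      = (Tri (ak k) (φ k) (φ k) (φ k) l - Tri (ak (k + 1)) (φ k) (φ k) (φ k) l)
        + Tri (hk k) (φ k) (φ k) (φ k) l := by
    intro k hkn l
    have h1 := hφ k hkn
    have hKs : KB κ 1 m (B * τ ^ 2 + B * τ ^ 2)
        (fun p q r => ak k p q r - ak (k + 1) p q r) := fun p q r => by
      have hj := pow_nonneg (jb_pos κ (p - q + r)).le 1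
      calc _ ≤ jb κ (p - q + r) ^ 1 * (‖ak k p q r‖ + ‖ak (k + 1) p q r‖) :=
            mul_le_mul_of_nonneg_left (norm_sub_le _ _) hj
        _ = jb κ (p - q + r) ^ 1 * ‖ak k p q r‖ + jb κ (p - q + r) ^ 1 * ‖ak (k + 1) p q r‖ := by
            ring
        _ ≤ _ := by
            rw [add_mul]; exact add_le_add (hKa k p q r) (hKa (k + 1) p q r)
    rw [← Tri_kernel_sub hκ hm (hKa k) (hKa (k + 1)) h1 h1 h1,
      ← Tri_kernel_add hκ hm hKs (hKh k) h1 h1 h1]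
    congr 1
    funext p q r
    have h2 : ph (((k + 1 : ℕ) : ℝ) * τ * res κ p q r)
        = ph (k * τ * res κ p q r) * ph (τ * res κ p q r) := by
      rw [← ph_add]; congr 1; push_cast; ring
    simp only [defKer, hak, hhk]
    rw [midDefect_eq_abelKer_add hAB, h2]
    ring
  have hhigh : HB κ 1 (n * (18 * (3 / κ) ^ (m - 1) * τ * τ₀ ^ (m - 1) * wtSum κ * R ^ 3))
      (fun l => ∑ k ∈ range n, Tri (hk k) (φ k) (φ k) (φ k) l) := by
    have := HB.sum (κ := κ) (s := 1) (n := n)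
      (A := fun _ => 18 * (3 / κ) ^ (m - 1) * τ * τ₀ ^ (m - 1) * wtSum κ * R ^ 3)
      (c := fun k => Tri (hk k) (φ k) (φ k) (φ k)) fun k hkn =>
        (HB.tri hκ hm (hKh k) (hφ k hkn) (hφ k hkn) (hφ k hkn)).mono (le_of_eq (by ring))
    simpa using this
  have hlow : HB κ 1 ((6 * R + 9 * (n * D)) * (B * τ ^ 2 * wtSum κ * R ^ 2))
      (fun l => ∑ k ∈ range n,
        (Tri (ak k) (φ k) (φ k) (φ k) l - Tri (ak (k + 1)) (φ k) (φ k) (φ k) l)) := by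
    -- The upper boundary term involves $\varphi_{n-1}$, so the empty sum is treated apart.
    rcases Nat.eq_zero_or_pos n with rfl | hn
    · simpa using (HB.zero κ 1).mono (show (0 : ℝ) ≤ 6 * R * (B * τ ^ 2 * wtSum κ * R ^ 2) by
        positivity)
    obtain ⟨n', rfl⟩ := Nat.exists_eq_succ_of_ne_zero hn.ne'
    have h0 := HB.tri hκ hm (hKa 0) (hφ 0 (by omega)) (hφ 0 (by omega)) (hφ 0 (by omega))
    have h1 := HB.tri hκ hm (hKa (n' + 1)) (hφ n' (by omega)) (hφ n' (by omega)) (hφ n' (by omega))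
    have h2 := HB.sum (κ := κ) (s := 1) (n := n')
      (A := fun _ => 9 * (B * τ ^ 2) * wtSum κ * R ^ 2 * D)
      (c := fun k l => Tri (ak (k + 1)) (φ (k + 1)) (φ (k + 1)) (φ (k + 1)) l
        - Tri (ak (k + 1)) (φ k) (φ k) (φ k) l) fun k hkn =>
        HB.tri_sub_tri hκ hm (hKa (k + 1)) (hφ (k + 1) (by omega)) (hφ k (by omega))
          (hD k (by omega))
    have h3 := (h0.sub h1).add h2
    -- The difference is moved from the kernels to the sequences. Only the terms with the increments
    -- $\varphi_{k+1}-\varphi_k$ are as many as the steps, and they carry the small factor `D`.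
    have heq : (fun l => ∑ k ∈ range (n' + 1),
        (Tri (ak k) (φ k) (φ k) (φ k) l - Tri (ak (k + 1)) (φ k) (φ k) (φ k) l))
        = fun l => Tri (ak 0) (φ 0) (φ 0) (φ 0) l - Tri (ak (n' + 1)) (φ n') (φ n') (φ n') l
          + ∑ k ∈ range n', (Tri (ak (k + 1)) (φ (k + 1)) (φ (k + 1)) (φ (k + 1)) l
            - Tri (ak (k + 1)) (φ k) (φ k) (φ k) l) := by
      funext l
      rw [Finset.sum_sub_distrib, Finset.sum_range_succ', Finset.sum_range_succ,
        Finset.sum_sub_distrib]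
      ring
    rw [heq]
    refine h3.mono ?_
    simp only [Finset.sum_const, Finset.card_range, nsmul_eq_mul]
    push_cast
    have h4 : 0 ≤ D * (B * τ ^ 2 * wtSum κ * R ^ 2) := by positivity
    nlinarith
  have := hhigh.add hlow
  refine this.of_norm_le_one fun l => le_of_eq ?_
  congr 1
  rw [← Finset.sum_add_distrib]
  refine Finset.sum_congr rfl fun k hk' => ?_
  rw [hsplit k (Finset.mem_range.mp hk') l]
  ring

/-! ### Lower bounds for $|1-e^{i\tau\delta}|$: small and non-resonant steps -/

theorem abs_sub_sin_le_cube (x : ℝ) : |x - Real.sin x| ≤ |x| ^ 3 := by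
  wlog h : 0 ≤ x generalizing x
  · have := this (-x) (by linarith)
    rw [Real.sin_neg, abs_neg, ← abs_neg] at this
    convert! this using 2
    ring
  rw [abs_of_nonneg h, abs_of_nonneg (by linarith [Real.sin_le h])]
  rcases h.eq_or_lt with h4 | h4
  · subst h4; simp
  · have := Real.sin_gt_sub_cube h4
    have h5 : 0 < x ^ 3 := by positivity
    linarith

/-- The sine is concave on $[0,\pi]$, so up to $\alpha\pi$ its graph lies above the chord from the
origin. -/
theorem mul_abs_le_abs_sin {α x : ℝ} (hα₀ : 0 < α) (hα₁ : α < 1) (hx : |x| ≤ α * Real.pi) :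
    Real.sin (α * Real.pi) / (α * Real.pi) * |x| ≤ |Real.sin x| := by
  wlog h : 0 ≤ x generalizing x
  · have := this (x := -x) (by rwa [abs_neg]) (by linarith)
    rwa [Real.sin_neg, abs_neg, abs_neg] at this
  rw [abs_of_nonneg h] at hx ⊢
  have hπ := Real.pi_pos
  have hαπ : 0 < α * Real.pi := by positivity
  have h1 : α * Real.pi ≤ Real.pi := by nlinarith
  have hx1 : 0 ≤ 1 - x / (α * Real.pi) := by rw [sub_nonneg, div_le_one hαπ]; exact hx
  have hx2 : 0 ≤ x / (α * Real.pi) := by positivity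
  have hm0 : (0 : ℝ) ∈ Set.Icc 0 Real.pi := ⟨le_rfl, hπ.le⟩
  have hm1 : α * Real.pi ∈ Set.Icc 0 Real.pi := ⟨hαπ.le, h1⟩
  have hcc := strictConcaveOn_sin_Icc.concaveOn.2 hm0 hm1 hx1 hx2 (by ring)
  simp only [smul_eq_mul, Real.sin_zero, mul_zero, zero_add] at hcc
  rw [div_mul_cancel₀ _ hαπ.ne'] at hcc
  calc _ = x / (α * Real.pi) * Real.sin (α * Real.pi) := by ring
    _ ≤ Real.sin x := hcc
    _ ≤ _ := le_abs_self _

theorem norm_midDefect_eq_div {τ δ : ℝ} (hτ : 0 < τ) (hδ : δ ≠ 0) :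
    ‖midDefect τ δ‖ = τ * |τ * δ / 2 - Real.sin (τ * δ / 2)| / |τ * δ / 2| := by
  have h : τ - 2 * Real.sin (τ * δ / 2) / δ
      = τ * ((τ * δ / 2 - Real.sin (τ * δ / 2)) / (τ * δ / 2)) := by field_simp
  rw [norm_midDefect_eq τ hδ, h, abs_mul, abs_div, abs_of_pos hτ]
  exact (mul_div_assoc _ _ _).symm

/-- Summation by parts for small steps. -/
theorem abelBound_of_small {κ τ α : ℝ} (hτ : 0 < τ) (hα₀ : 0 < α) (hα₁ : α < 1) {n : ℤ}
    (hsmall : τ * κ ^ 2 * n ^ 2 ≤ α * Real.pi) {m : ℕ} (hm : 3 ≤ m) (hκ : 0 < κ) :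
    AbelBound κ τ n m (30 * (α * Real.pi / (4 * Real.sin (α * Real.pi)))) := by
  intro p q r hlow hr
  have hπ := Real.pi_pos
  have hsin : 0 < Real.sin (α * Real.pi) :=
    Real.sin_pos_of_pos_of_lt_pi (by positivity) (by nlinarith)
  have hδ : res κ p q r ≠ 0 := by
    unfold res; have : (resInt p q r : ℝ) ≠ 0 := by exact_mod_cast hr
    positivity
  set δ := res κ p q r with hδd
  -- The factor 2 in $|\delta|\le2\kappa^2n^2$ cancels against the half angle.
  have hx : |τ * δ / 2| ≤ α * Real.pi := by
    have h1 : |(resInt p q r : ℝ)| ≤ 2 * (n : ℝ) ^ 2 := by exact_mod_cast hlow.abs_resInt_le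
    rw [abs_div, abs_mul, abs_two, abs_of_pos hτ, hδd, res, abs_mul, abs_of_pos (by positivity)]
    have h2 : 0 < τ * κ ^ 2 := by positivity
    nlinarith
  set x := τ * δ / 2 with hxd
  have hx0 : 0 < |x| := abs_pos.mpr (by positivity)
  have h1 := abs_sub_sin_le_cube x
  have h2 := mul_abs_le_abs_sin hα₀ hα₁ hx
  set c := Real.sin (α * Real.pi) / (α * Real.pi) with hc
  have hc0 : 0 < c := by positivity
  have hcinv : α * Real.pi / (4 * Real.sin (α * Real.pi)) = 1 / (4 * c) := by
    rw [hc]; field_simp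
  -- With $x=\tau\delta/2$ the defect is $\tau|x-\sin x|/|x|\le\tau x^2$, while
  -- $|1-e^{i\tau\delta}|=2|\sin x|\ge2c|x|$. The quotient is at most
  -- $\tau|x|/(2c)=\tau^2|\delta|/(4c)$.
  have h3 : ‖midDefect τ δ‖ ≤ 1 / (4 * c) * τ ^ 2 * |δ| * ‖1 - ph (τ * δ)‖ := by
    rw [norm_midDefect_eq_div hτ hδ, norm_one_sub_ph, ← hxd, div_le_iff₀ hx0]
    have hτδ : τ * |δ| = 2 * |x| := by
      rw [hxd, abs_div, abs_mul, abs_two, abs_of_pos hτ]; ring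
    calc τ * |x - Real.sin x| ≤ τ * |x| ^ 3 := mul_le_mul_of_nonneg_left h1 hτ.le
      _ = 1 / (4 * c) * τ * (2 * |x|) * (2 * (c * |x|)) * |x| := by field_simp; ring
      _ ≤ 1 / (4 * c) * τ * (2 * |x|) * (2 * |Real.sin x|) * |x| := by gcongr
      _ = _ := by rw [← hτδ]; ring
  have h4 := abs_res_le κ p q r
  have h5 := jb_sub_add_le κ p q r
  have hM := one_le_jbMax κ p q r
  have hM3 : jbMax κ p q r ^ 3 ≤ jbMax κ p q r ^ m := pow_le_pow_right₀ hM hm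
  have hz := norm_nonneg (1 - ph (τ * δ))
  rw [hcinv]
  -- The constant 30 is 3 for the output bracket times 10 for $|\delta|$, and three derivatives are
  -- spent.
  calc jb κ (p - q + r) * ‖midDefect τ δ‖
      ≤ 3 * jbMax κ p q r * (1 / (4 * c) * τ ^ 2 * (10 * jbMax κ p q r ^ 2) * ‖1 - ph (τ * δ)‖) := by
        refine mul_le_mul h5 (h3.trans ?_) (norm_nonneg _) (by positivity)
        gcongr
    _ = 30 * (1 / (4 * c)) * τ ^ 2 * ‖1 - ph (τ * δ)‖ * jbMax κ p q r ^ 3 := by ring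
    _ ≤ _ := by gcongr

/-- A lower bound for the sine away from the multiples of `π`. -/
theorem abs_sin_ge {y d : ℝ} (hy : 0 ≤ y) (h : ∀ l : ℤ, 0 ≤ l → d ≤ |y - l * Real.pi|) :
    2 / Real.pi * d ≤ |Real.sin y| := by
  have hπ := Real.pi_pos
  -- The nearest multiple of $\pi$ to a nonnegative number has a nonnegative index, which is why
  -- multiples with `l ≥ 0` suffice.
  set l := round (y / Real.pi) with hl
  have hl0 : 0 ≤ l := by
    rw [hl, round_eq]
    exact Int.floor_nonneg.mpr (by positivity)
  have h1 : |y - l * Real.pi| ≤ Real.pi / 2 := by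
    have := abs_sub_round (y / Real.pi)
    have e : y - l * Real.pi = (y / Real.pi - l) * Real.pi := by field_simp
    rw [e, abs_mul, abs_of_pos hπ]
    nlinarith
  have h2 := Real.mul_abs_le_abs_sin h1
  rw [Real.sin_sub_int_mul_pi, abs_mul, abs_zpow, abs_neg, abs_one, one_zpow, one_mul] at h2
  exact (mul_le_mul_of_nonneg_left (h l hl0) (by positivity)).trans h2

/-- The non-resonance condition in terms of the resonance function. -/
theorem norm_midDefect_le_of_nonres {κ τ lam ν : ℝ} (hκ : 0 < κ) (hτ : 0 < τ) (hlam : 0 < lam)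
    {n : ℤ} (hn : 1 ≤ n)
    (hNR : ∀ K l : ℤ, 0 < |K| → |K| ≤ 2 * n ^ 2 → 0 ≤ l →
      lam / |κ ^ 2 * (K : ℝ)| ^ (2 + ν) ≤ |τ - 2 * (l : ℝ) * Real.pi / (κ ^ 2 * (K : ℝ))|)
    {p q r : ℤ} (hlow : Low n p q r) (hr : resInt p q r ≠ 0) :
    ‖midDefect τ (res κ p q r)‖ ≤
      Real.pi * (κ ^ 2) ^ (2 + ν) / lam ^ 2 * τ ^ 2 * |res κ p q r| ^ (1 + ν)
        * ‖1 - ph (τ * res κ p q r)‖ := by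
  have hπ := Real.pi_pos
  -- The condition with `K = 1`, `l = 0` bounds $\tau$ from below; this turns the trivial bound
  -- $2\tau$ of the defect into a multiple of $\tau^2$.
  have hτge : lam / (κ ^ 2) ^ (2 + ν) ≤ τ := by
    have := hNR 1 0 (by norm_num) (by rw [abs_one]; nlinarith) le_rfl
    simpa [abs_of_pos hτ] using this
  have hK : (0 : ℝ) < |(resInt p q r : ℝ)| := abs_pos.mpr (by exact_mod_cast hr)
  set D := |res κ p q r| with hD
  have hDe : D = κ ^ 2 * |(resInt p q r : ℝ)| := by
    rw [hD, res, abs_mul, abs_of_pos (by positivity)]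
  have hD0 : 0 < D := by rw [hDe]; positivity
  have hsin : lam / (Real.pi * D ^ (1 + ν)) ≤ |Real.sin (τ * D / 2)| := by
    have h1 := abs_sin_ge (y := τ * D / 2) (d := lam / (2 * D ^ (1 + ν))) (by positivity)
      fun l hl => by
        -- The sine is odd, so it is enough to use the absolute value of the resonance integer; then
        -- $\tau D/2-l\pi=\frac D2(\tau-2l\pi/D)$ is what the condition controls.
        have h2 := hNR |resInt p q r| l (by rw [abs_abs]; exact abs_pos.mpr hr)
          (by rw [abs_abs]; exact hlow.abs_resInt_le) hl
        rw [Int.cast_abs, ← hDe, abs_of_pos hD0] at h2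
        have e1 : τ * D / 2 - l * Real.pi = (D / 2) * (τ - 2 * l * Real.pi / D) := by
          field_simp
        rw [e1, abs_mul, abs_of_pos (show 0 < D / 2 by positivity)]
        refine le_trans (le_of_eq ?_) (mul_le_mul_of_nonneg_left h2 (by positivity))
        rw [show 2 + ν = (1 + ν) + 1 by ring, Real.rpow_add_one hD0.ne']
        field_simp
    refine le_trans (le_of_eq ?_) h1
    field_simp
  have habs : |Real.sin (τ * res κ p q r / 2)| = |Real.sin (τ * D / 2)| := by
    rcases abs_choice (res κ p q r) with h | h
    · rw [hD, h]
    · rw [hD, h, mul_neg, neg_div, Real.sin_neg, abs_neg]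
  have hpow : 0 < D ^ (1 + ν) := Real.rpow_pos_of_pos hD0 _
  have hkp : 0 < (κ ^ 2) ^ (2 + ν) := Real.rpow_pos_of_pos (by positivity) _
  rw [norm_one_sub_ph, habs]
  refine (norm_midDefect_le hτ.le _).trans ?_
  rw [div_le_iff₀ hkp] at hτge
  calc 2 * τ = 2 * τ * (lam / lam) := by rw [div_self hlam.ne', mul_one]
    _ ≤ 2 * τ * (τ * (κ ^ 2) ^ (2 + ν) / lam) := by gcongr
    _ = Real.pi * (κ ^ 2) ^ (2 + ν) / lam ^ 2 * τ ^ 2 * D ^ (1 + ν)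
        * (2 * (lam / (Real.pi * D ^ (1 + ν)))) := by field_simp
    _ ≤ _ := by gcongr

/-- Summation by parts for non-resonant steps, uniformly in the frequency cut-off. -/
theorem abelBound_of_nonres {κ τ lam ν : ℝ} (hκ : 0 < κ) (hτ : 0 < τ) (hlam : 0 < lam)
    (hν : 0 < ν) {n : ℤ} (hn : 1 ≤ n)
    (hNR : ∀ K l : ℤ, 0 < |K| → |K| ≤ 2 * n ^ 2 → 0 ≤ l →
      lam / |κ ^ 2 * (K : ℝ)| ^ (2 + ν) ≤ |τ - 2 * (l : ℝ) * Real.pi / (κ ^ 2 * (K : ℝ))|)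
    {m : ℕ} (hm : 3 + 2 * ν ≤ m) :
    AbelBound κ τ n m (3 * 10 ^ (1 + ν) * (Real.pi * (κ ^ 2) ^ (2 + ν) / lam ^ 2)) := by
  intro p q r hlow hr
  have h1 := norm_midDefect_le_of_nonres hκ hτ hlam hn hNR hlow hr
  have hM := one_le_jbMax κ p q r
  have hM0 : 0 < jbMax κ p q r := by linarith
  have h2 : |res κ p q r| ^ (1 + ν) ≤ 10 ^ (1 + ν) * jbMax κ p q r ^ (2 + 2 * ν) := by
    refine (Real.rpow_le_rpow (abs_nonneg _) (abs_res_le κ p q r) (by linarith)).trans ?_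
    rw [Real.mul_rpow (by norm_num) (by positivity), ← Real.rpow_natCast, ← Real.rpow_mul hM0.le]
    refine le_of_eq ?_
    congr 2
    push_cast; ring
  -- $|\delta|^{1+\nu}$ costs $2+2\nu$ derivatives and the output weight one more, hence $3+2\nu\le
  -- m$.
  have h3 : jbMax κ p q r ^ (2 + 2 * ν) * jbMax κ p q r ≤ jbMax κ p q r ^ m := by
    rw [← Real.rpow_add_one hM0.ne', ← Real.rpow_natCast (jbMax κ p q r) m]
    exact Real.rpow_le_rpow_of_exponent_le hM (by linarith)
  have hkp : 0 < (κ ^ 2) ^ (2 + ν) := Real.rpow_pos_of_pos (by positivity) _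
  have h10 : (0 : ℝ) < 10 ^ (1 + ν) := Real.rpow_pos_of_pos (by norm_num) _
  have hz := norm_nonneg (1 - ph (τ * res κ p q r))
  have hπ := Real.pi_pos
  set C := Real.pi * (κ ^ 2) ^ (2 + ν) / lam ^ 2 with hC
  have hC0 : 0 < C := by positivity
  calc jb κ (p - q + r) * ‖midDefect τ (res κ p q r)‖
      ≤ 3 * jbMax κ p q r * (C * τ ^ 2 * (10 ^ (1 + ν) * jbMax κ p q r ^ (2 + 2 * ν))
          * ‖1 - ph (τ * res κ p q r)‖) := by
        refine mul_le_mul (jb_sub_add_le κ p q r) (h1.trans ?_) (norm_nonneg _) (by positivity)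
        gcongr
    _ = 3 * 10 ^ (1 + ν) * C * τ ^ 2 * ‖1 - ph (τ * res κ p q r)‖
          * (jbMax κ p q r ^ (2 + 2 * ν) * jbMax κ p q r) := by ring
    _ ≤ _ := by gcongr

/-- Summation by parts for non-resonant steps, with a constant depending on the cut-off. -/
theorem abelBound_of_nonres' {κ τ lam ν : ℝ} (hκ : 0 < κ) (hτ : 0 < τ) (hlam : 0 < lam)
    (hν : 0 < ν) {n : ℤ} (hn : 1 ≤ n)
    (hNR : ∀ K l : ℤ, 0 < |K| → |K| ≤ 2 * n ^ 2 → 0 ≤ l →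
      lam / |κ ^ 2 * (K : ℝ)| ^ (2 + ν) ≤ |τ - 2 * (l : ℝ) * Real.pi / (κ ^ 2 * (K : ℝ))|)
    {m : ℕ} (hm : 1 ≤ m) :
    AbelBound κ τ n m
      (3 * (κ ^ 2 * (2 * n ^ 2)) ^ (1 + ν) * (Real.pi * (κ ^ 2) ^ (2 + ν) / lam ^ 2)) := by
  intro p q r hlow hr
  have h1 := norm_midDefect_le_of_nonres hκ hτ hlam hn hNR hlow hr
  have hM := one_le_jbMax κ p q r
  have hM0 : 0 < jbMax κ p q r := by linarith
  have hn0 : (0 : ℝ) < n := by exact_mod_cast hn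
  -- The resonance function is bounded through the cut-off instead of through derivatives; this is
  -- where the dependence on $\tau_0$ arises.
  have h2 : |res κ p q r| ^ (1 + ν) ≤ (κ ^ 2 * (2 * n ^ 2)) ^ (1 + ν) := by
    refine Real.rpow_le_rpow (abs_nonneg _) ?_ (by linarith)
    rw [res, abs_mul, abs_of_pos (by positivity)]
    have : |(resInt p q r : ℝ)| ≤ 2 * (n : ℝ) ^ 2 := by exact_mod_cast hlow.abs_resInt_le
    exact mul_le_mul_of_nonneg_left this (by positivity)
  have h3 : jbMax κ p q r ≤ jbMax κ p q r ^ m := le_self_pow₀ hM (by omega)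
  have hkp : 0 < (κ ^ 2) ^ (2 + ν) := Real.rpow_pos_of_pos (by positivity) _
  have h10 : (0 : ℝ) < (κ ^ 2 * (2 * n ^ 2)) ^ (1 + ν) := Real.rpow_pos_of_pos (by positivity) _
  have hz := norm_nonneg (1 - ph (τ * res κ p q r))
  have hπ := Real.pi_pos
  set C := Real.pi * (κ ^ 2) ^ (2 + ν) / lam ^ 2 with hC
  have hC0 : 0 < C := by positivity
  calc jb κ (p - q + r) * ‖midDefect τ (res κ p q r)‖
      ≤ 3 * jbMax κ p q r * (C * τ ^ 2 * (κ ^ 2 * (2 * n ^ 2)) ^ (1 + ν)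
          * ‖1 - ph (τ * res κ p q r)‖) := by
        refine mul_le_mul (jb_sub_add_le κ p q r) (h1.trans ?_) (norm_nonneg _) (by positivity)
        gcongr
    _ = 3 * (κ ^ 2 * (2 * n ^ 2)) ^ (1 + ν) * C * τ ^ 2 * ‖1 - ph (τ * res κ p q r)‖
          * jbMax κ p q r := by ring
    _ ≤ _ := by gcongr

/-! ### The exact flow and the frozen flow in the twisted variable -/

/-- The cubic nonlinearity of the discrete problem in the variable twisted at time `t`. -/
noncomputable def gridTri (κ : ℝ) (N : ℕ) (t : ℝ) (c d e : ℤ → ℂ) : ℤ → ℂ :=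
  twist κ t (aliased N (Tri (fun _ _ _ => 1) (twist κ (-t) c) (twist κ (-t) d) (twist κ (-t) e)))

theorem twist_sub (κ t : ℝ) (c d : ℤ → ℂ) (l : ℤ) :
    twist κ t c l - twist κ t d l = twist κ t (fun l => c l - d l) l := by
  unfold NLSTSFP.twist; ring

theorem trunc_sub_trunc (N : ℕ) (c d : ℤ → ℂ) (l : ℤ) :
    trunc N c l - trunc N d l = trunc N (fun l => c l - d l) l := by
  unfold NLSTSFP.trunc; split_ifs <;> simp

theorem twist_trunc (κ t : ℝ) (N : ℕ) (c : ℤ → ℂ) (l : ℤ) :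
    twist κ t (trunc N c) l = trunc N (twist κ t c) l := by
  by_cases hl : l ∈ freqs N <;> simp [NLSTSFP.trunc, NLSTSFP.twist, hl]

theorem aliased_sub_aliased {κ A B : ℝ} (hκ : 0 < κ) {N : ℕ} (hN : 0 < N) {c d : ℤ → ℂ}
    (hc : HB κ 1 A c) (hd : HB κ 1 B d) (l : ℤ) :
    aliased N c l - aliased N d l = aliased N (fun l => c l - d l) l := by
  unfold NLSTSFP.aliased
  split_ifs
  · exact ((hc.term_summable hκ le_rfl hN l).of_norm.tsum_sub
      (hd.term_summable hκ le_rfl hN l).of_norm).symm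
  · simp

theorem HB.gridTri {κ h A₁ A₂ A₃ : ℝ} (hκ : 0 < κ) {N : ℕ} (hN : 0 < N)
    (hh : κ * N * h = 2 * Real.pi) {c d e : ℤ → ℂ}
    (hc : HB κ 1 A₁ c) (hd : HB κ 1 A₂ d) (he : HB κ 1 A₃ e) (t : ℝ) :
    HB κ 1 (9 * (1 + aliasConst κ) * wtSum κ * A₁ * A₂ * A₃) (gridTri κ N t c d e) :=
  (((HB.tri hκ le_rfl (KB_one κ 1) (hc.twist (-t)) (hd.twist (-t)) (he.twist (-t))).aliased
    hκ hN hh).twist t).mono (le_of_eq (by ring))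

theorem HB.gridTri_sub {κ h A D : ℝ} (hκ : 0 < κ) {N : ℕ} (hN : 0 < N)
    (hh : κ * N * h = 2 * Real.pi) {c c' : ℤ → ℂ}
    (hc : HB κ 1 A c) (hc' : HB κ 1 A c') (hD : HB κ 1 D (fun l => c l - c' l)) (t : ℝ) :
    HB κ 1 (27 * (1 + aliasConst κ) * wtSum κ * A ^ 2 * D)
      (fun l => NLSTSFP.gridTri κ N t c c c l - NLSTSFP.gridTri κ N t c' c' c' l) := by
  unfold NLSTSFP.gridTri
  have h1 := HB.tri hκ le_rfl (KB_one κ 1) (hc.twist (-t)) (hc.twist (-t)) (hc.twist (-t))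
  have h2 := HB.tri hκ le_rfl (KB_one κ 1) (hc'.twist (-t)) (hc'.twist (-t)) (hc'.twist (-t))
  have h3 : HB κ 1 D (fun l => NLSTSFP.twist κ (-t) c l - NLSTSFP.twist κ (-t) c' l) := by
    simp only [twist_sub]; exact hD.twist (-t)
  simp only [twist_sub, aliased_sub_aliased hκ hN h1 h2]
  exact (((HB.tri_sub_tri hκ le_rfl (KB_one κ 1) (hc.twist (-t)) (hc'.twist (-t)) h3).aliased
    hκ hN hh).twist t).mono (le_of_eq (by ring))

/-- The aliasing error of the cubic nonlinearity. -/
theorem HB.gridTri_sub_trunc {κ h A : ℝ} (hκ : 0 < κ) {N : ℕ} (hN : 0 < N)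
    (hh : κ * N * h = 2 * Real.pi) {m : ℕ} (hm : 1 ≤ m) {c : ℤ → ℂ} (hc : HB κ m A c) (t : ℝ) :
    HB κ 1 (aliasConst κ * h ^ (m - 1) * (3 ^ (m + 1) * wtSum κ * A ^ 3))
      (fun l => NLSTSFP.gridTri κ N t c c c l
        - NLSTSFP.trunc N (Tri (phKer κ t) c c c) l) := by
  have h1 := HB.tri hκ hm (KB_one κ m) (hc.twist (-t)) (hc.twist (-t)) (hc.twist (-t))
  have h2 : Tri (phKer κ t) c c c = NLSTSFP.twist κ t (Tri (fun _ _ _ => 1)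
      (NLSTSFP.twist κ (-t) c) (NLSTSFP.twist κ (-t) c) (NLSTSFP.twist κ (-t) c)) :=
    funext fun l => (twist_Tri κ t c c c l).symm
  rw [h2]
  unfold NLSTSFP.gridTri
  simp only [← twist_trunc, twist_sub]
  exact ((h1.aliased_sub_trunc hκ hN hh hm).twist t).mono (le_of_eq (by ring))

/-- The twisted exact solution: bounds and Duhamel's formula. -/
structure ExactFlow (κ g S : ℝ) (m : ℕ) (R : ℝ) (φ : ℝ → ℤ → ℂ) : Prop where
  bound : ∀ t ∈ Set.Icc 0 S, HB κ m R (φ t)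
  cont : ∀ l, ContinuousOn (fun t => φ t l) (Set.Icc 0 S)
  contTri : ∀ l, ContinuousOn (fun t => Tri (phKer κ t) (φ t) (φ t) (φ t) l) (Set.Icc 0 S)
  duhamel : ∀ s t, 0 ≤ s → s ≤ t → t ≤ S → ∀ l, φ t l - φ s l
    = ∫ r in s..t, (-Complex.I * g) * Tri (phKer κ r) (φ r) (φ r) (φ r) l

/-- The twisted flow of the nonlinear part of one step on the grid. -/
structure FrozenFlow (κ g : ℝ) (N : ℕ) (t τ : ℝ) (χ : ℝ → ℤ → ℂ) : Prop where
  support : ∀ s, ∀ l ∉ freqs N, χ s l = 0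
  cont : ∀ l, ContinuousOn (fun s => χ s l) (Set.Icc 0 τ)
  contTri : ∀ l, ContinuousOn (fun s => gridTri κ N t (χ s) (χ s) (χ s) l) (Set.Icc 0 τ)
  linear : ∀ s ∈ Set.Icc 0 τ,
    gridTri κ N t (χ s) (χ s) (χ s) = gridTri κ N t (χ 0) (χ 0) (χ s)
  duhamel : ∀ s ∈ Set.Icc 0 τ, ∀ l, χ s l - χ 0 l
    = ∫ r in (0 : ℝ)..s, (-Complex.I * g) * gridTri κ N t (χ r) (χ r) (χ r) l

theorem norm_neg_I_mul (g : ℝ) : ‖-Complex.I * (g : ℂ)‖ = |g| := by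
  rw [norm_mul, norm_neg, Complex.norm_I, one_mul, Complex.norm_real, Real.norm_eq_abs]

theorem continuousOn_partNorm {κ : ℝ} {s : ℕ} {F : Finset ℤ} {X : Set ℝ} {c : ℝ → ℤ → ℂ}
    (h : ∀ l, ContinuousOn (fun t => c t l) X) : ContinuousOn (fun t => partNorm κ s F (c t)) X := by
  unfold partNorm
  exact (continuousOn_finsetSum _ fun l _ =>
    continuousOn_const.mul ((h l).norm.pow 2)).sqrt

/-- A finitely supported continuous family attains its largest norm. -/
theorem exists_max_HB {κ τ : ℝ} (hτ : 0 ≤ τ) {s : ℕ} {F : Finset ℤ} {c : ℝ → ℤ → ℂ}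
    (h : ∀ l, ContinuousOn (fun t => c t l) (Set.Icc 0 τ))
    (hs : ∀ t, ∀ l ∉ F, c t l = 0) :
    ∃ D, (∀ t ∈ Set.Icc 0 τ, HB κ s D (c t)) ∧
      ∃ t ∈ Set.Icc 0 τ, ∀ A, HB κ s A (c t) → D ≤ A := by
  obtain ⟨t, ht, hmax⟩ := isCompact_Icc.exists_isMaxOn (Set.nonempty_Icc.mpr hτ)
    (continuousOn_partNorm (κ := κ) (s := s) (F := F) h)
  exact ⟨partNorm κ s F (c t), fun r hr => (HB.of_support (hs r)).mono (hmax hr),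
    t, ht, fun A hA => hA F⟩

/-- By `linear` the vector field is linear in `χ s` with coefficients fixed by `χ 0`. At a time of
largest norm `D`, Duhamel's formula gives $D\le V+D/2$, with no continuation argument. -/
theorem FrozenFlow.bound {κ g h t τ V : ℝ} (hκ : 0 < κ) {N : ℕ} (hN : 0 < N)
    (hh : κ * N * h = 2 * Real.pi) (hτ : 0 ≤ τ) {χ : ℝ → ℤ → ℂ} (hχ : FrozenFlow κ g N t τ χ)
    (hV : HB κ 1 V (χ 0))
    (hsmall : |g| * τ * (9 * (1 + aliasConst κ) * wtSum κ * V ^ 2) ≤ 1 / 2) :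
    ∀ s ∈ Set.Icc 0 τ, HB κ 1 (2 * V) (χ s) := by
  obtain ⟨D, hD, s₀, hs₀, hmax⟩ := exists_max_HB (κ := κ) (s := 1) hτ hχ.cont hχ.support
  have hD0 : 0 ≤ D := (hD s₀ hs₀).nonneg
  have hC : 0 ≤ 9 * (1 + aliasConst κ) * wtSum κ * V ^ 2 := by
    have := aliasConst_nonneg κ
    have := wtSum_nonneg κ
    positivity
  have hint : HB κ 1 (|g| * (9 * (1 + aliasConst κ) * wtSum κ * V * V * D) * (s₀ - 0))
      (fun l => ∫ r in (0 : ℝ)..s₀, (-Complex.I * g) * gridTri κ N t (χ r) (χ r) (χ r) l) := by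
    refine HB.intervalIntegral hs₀.1 (fun l => ?_) fun r hr => ?_
    · exact continuousOn_const.mul ((hχ.contTri l).mono (Set.Icc_subset_Icc_right hs₀.2))
    · have hr' : r ∈ Set.Icc 0 τ := ⟨hr.1, hr.2.trans hs₀.2⟩
      rw [hχ.linear r hr', ← norm_neg_I_mul]
      exact (HB.gridTri hκ hN hh hV hV (hD r hr') t).const_mul _
  have hs : χ s₀ = fun l => χ 0 l + ∫ r in (0 : ℝ)..s₀, (-Complex.I * g) *
      gridTri κ N t (χ r) (χ r) (χ r) l := by
    funext l; rw [← hχ.duhamel s₀ hs₀ l]; ring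
  have h1 := hV.add hint
  rw [← hs] at h1
  have h2 := hmax _ h1
  have h3 : |g| * (9 * (1 + aliasConst κ) * wtSum κ * V * V * D) * (s₀ - 0)
      ≤ (|g| * τ * (9 * (1 + aliasConst κ) * wtSum κ * V ^ 2)) * D := by
    have : 0 ≤ |g| * (9 * (1 + aliasConst κ) * wtSum κ * V ^ 2) * D := by positivity
    nlinarith [hs₀.2]
  have h4 : D ≤ 2 * V := by nlinarith
  exact fun s hs => (hD s hs).mono h4

theorem norm_triTerm_phKer (κ t : ℝ) (c d e : ℤ → ℂ) (l : ℤ) (x : ℤ × ℤ) :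
    ‖triTerm (phKer κ t) c d e l x‖ = ‖triTerm (fun _ _ _ => 1) c d e l x‖ := by
  unfold triTerm phKer
  rw [norm_mul, norm_ph, one_mul, one_mul]

theorem continuous_ph_mul (d : ℝ) : Continuous fun s : ℝ => ph (s * d) :=
  continuous_ph.comp (continuous_id.mul continuous_const)

theorem continuous_Tri_phKer {κ A : ℝ} (hκ : 0 < κ) {c : ℤ → ℂ} (hc : HB κ 1 A c) (l : ℤ) :
    Continuous fun t => Tri (phKer κ t) c c c l := by
  unfold Tri
  refine continuous_tsum (u := fun x => ‖triTerm (fun _ _ _ => 1) c c c l x‖) (fun x => ?_)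
    (summable_triTerm hκ le_rfl (KB_one κ 1) hc hc hc l) fun x t => ?_
  · unfold triTerm phKer
    exact (continuous_ph_mul _).mul continuous_const
  · exact (norm_triTerm_phKer κ t c c c l x).le

/-- The integral over a step passes through the series by dominated convergence, the majorant not
depending on the phase. Term by term it produces the midpoint defect, so this is the leading local
error in closed form. -/
theorem integral_Tri_phKer_sub {κ A : ℝ} (hκ : 0 < κ) {c : ℤ → ℂ} (hc : HB κ 1 A c) (t τ : ℝ)
    (l : ℤ) :
    ∫ s in (0 : ℝ)..τ, (Tri (phKer κ (t + τ / 2)) c c c l - Tri (phKer κ (t + s)) c c c l)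
      = Tri (defKer κ τ t) c c c l := by
  have hsum := summable_triTerm hκ le_rfl (KB_one κ 1) hc hc hc l
  have hterm : ∀ x, ∫ s in (0 : ℝ)..τ, (triTerm (phKer κ (t + τ / 2)) c c c l x
      - triTerm (phKer κ (t + s)) c c c l x) = triTerm (defKer κ τ t) c c c l x := fun x => by
    unfold triTerm
    set δ := res κ x.1 x.2 (l - x.1 + x.2) with hδ
    set z := c x.1 * (starRingEnd ℂ) (c x.2) * c (l - x.1 + x.2) with hz
    have h1 : ∀ s, phKer κ (t + τ / 2) x.1 x.2 (l - x.1 + x.2) * z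
        - phKer κ (t + s) x.1 x.2 (l - x.1 + x.2) * z
        = ph (t * δ) * z * (ph (τ / 2 * δ) - ph (s * δ)) := fun s => by
      unfold phKer; rw [← hδ, add_mul, add_mul, ph_add, ph_add]; ring
    simp only [h1]
    rw [intervalIntegral.integral_const_mul, intervalIntegral.integral_sub
      (intervalIntegrable_const)
      ((continuous_ph_mul δ).intervalIntegrable _ _)]
    rw [intervalIntegral.integral_const, sub_zero, Complex.real_smul]
    unfold defKer midDefect
    rw [← hδ]
    ring
  have hS : HasSum (fun x => ∫ s in (0 : ℝ)..τ, (triTerm (phKer κ (t + τ / 2)) c c c l x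
      - triTerm (phKer κ (t + s)) c c c l x))
      (∫ s in (0 : ℝ)..τ, (Tri (phKer κ (t + τ / 2)) c c c l - Tri (phKer κ (t + s)) c c c l)) := by
    refine intervalIntegral.hasSum_integral_of_dominated_convergence
      (fun x _ => 2 * ‖triTerm (fun _ _ _ => 1) c c c l x‖) (fun x => ?_) (fun x => ?_) ?_ ?_ ?_
    · refine Continuous.aestronglyMeasurable ?_
      unfold triTerm phKer
      exact continuous_const.sub ((continuous_ph.comp
        ((continuous_const.add continuous_id).mul continuous_const)).mul continuous_const)
    · refine Filter.Eventually.of_forall fun s _ => (norm_sub_le _ _).trans (le_of_eq ?_)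
      rw [norm_triTerm_phKer, norm_triTerm_phKer]; ring
    · exact Filter.Eventually.of_forall fun s _ => hsum.mul_left 2
    · exact intervalIntegrable_const
    · refine Filter.Eventually.of_forall fun s _ => ?_
      exact (summable_triTerm hκ le_rfl (KB_phKer κ _ 1) hc hc hc l).of_norm.hasSum.sub
        (summable_triTerm hκ le_rfl (KB_phKer κ _ 1) hc hc hc l).of_norm.hasSum
  rw [← hS.tsum_eq]
  exact tsum_congr hterm

/-- Without a linear part the twisted solution moves only at a speed proportional to $|g|$, and it
does so in the full $H^m$ norm. This is the slow variation that summation by parts relies on. -/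
theorem ExactFlow.sub_bound {κ g S R : ℝ} (hκ : 0 < κ) {m : ℕ} (hm : 1 ≤ m) {φ : ℝ → ℤ → ℂ}
    (hφ : ExactFlow κ g S m R φ) {s t : ℝ} (hs : 0 ≤ s) (hst : s ≤ t) (ht : t ≤ S) :
    HB κ m (|g| * (3 ^ (m + 1) * wtSum κ * R ^ 3) * (t - s)) (fun l => φ t l - φ s l) := by
  simp only [hφ.duhamel s t hs hst ht]
  refine HB.intervalIntegral hst (fun l => ?_) fun r hr => ?_
  · exact continuousOn_const.mul ((hφ.contTri l).mono (Set.Icc_subset_Icc hs ht))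
  · have hb := hφ.bound r ⟨hs.trans hr.1, hr.2.trans ht⟩
    rw [← norm_neg_I_mul]
    refine HB.const_mul ((HB.tri hκ hm (KB_phKer κ r m) hb hb hb).mono (le_of_eq ?_)) _
    ring

/-! ### The error of one step -/

/-- The Lipschitz constant of the discrete cubic nonlinearity. -/
noncomputable def lipC (κ R : ℝ) : ℝ := 27 * (1 + aliasConst κ) * wtSum κ * (2 * (1 + R)) ^ 2

/-- The constant of the spatial discretization error. -/
noncomputable def spaceC (κ R : ℝ) (m : ℕ) : ℝ :=
  aliasConst κ * (3 ^ (m + 1) * wtSum κ * R ^ 3) + 27 * wtSum κ * R ^ 3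

/-- The constant of the second order terms of the splitting. -/
noncomputable def timeC (κ R : ℝ) (m : ℕ) : ℝ :=
  2 * lipC κ R * (90 * wtSum κ * R ^ 3) + 270 * wtSum κ * R ^ 2 * (3 ^ (m + 1) * wtSum κ * R ^ 3)

theorem lipC_nonneg (κ R : ℝ) : 0 ≤ lipC κ R := by
  have := aliasConst_nonneg κ
  have := wtSum_nonneg κ
  unfold lipC; positivity

theorem spaceC_nonneg (κ : ℝ) {R : ℝ} (hR : 0 ≤ R) (m : ℕ) : 0 ≤ spaceC κ R m := by
  have := aliasConst_nonneg κ
  have := wtSum_nonneg κ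
  unfold spaceC; positivity

theorem timeC_nonneg (κ : ℝ) {R : ℝ} (hR : 0 ≤ R) (m : ℕ) : 0 ≤ timeC κ R m := by
  have := lipC_nonneg κ R
  have := wtSum_nonneg κ
  unfold timeC; positivity

theorem mesh_pos_of_mul_eq {κ h : ℝ} (hκ : 0 < κ) {N : ℕ} (hN : 0 < N)
    (hh : κ * N * h = 2 * Real.pi) : 0 < h := by
  by_contra hneg
  have : 0 < κ * N := by positivity
  nlinarith [Real.pi_pos]

/-- The difference of the discrete and the exact vector fields. -/
theorem field_difference {κ g h S R t s τ D : ℝ} (hκ : 0 < κ) {N : ℕ} (hN : Even N) (hN0 : 0 < N)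
    (hh : κ * N * h = 2 * Real.pi) {m : ℕ} (hm : 3 ≤ m) {φ : ℝ → ℤ → ℂ}
    (hφ : ExactFlow κ g S m R φ) (hR : 0 ≤ R) (ht : 0 ≤ t) (htS : t + τ ≤ S)
    (hs : s ∈ Set.Icc 0 τ) {c : ℤ → ℂ} (hc : HB κ 1 (2 * (1 + R)) c)
    (hD : HB κ 1 D (fun l => c l - trunc N (φ (t + s)) l)) :
    HB κ 1 (lipC κ R * D + spaceC κ R m * h ^ (m - 1) + 90 * wtSum κ * R ^ 3 * τ)
      (fun l => gridTri κ N (t + τ / 2) c c c l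
        - trunc N (Tri (phKer κ (t + s)) (φ (t + s)) (φ (t + s)) (φ (t + s))) l) ∧
    HB κ 1 (lipC κ R * D + spaceC κ R m * h ^ (m - 1)
        + 270 * wtSum κ * R ^ 2 * (3 ^ (m + 1) * wtSum κ * R ^ 3) * (|g| * τ ^ 2))
      (fun l => gridTri κ N (t + τ / 2) c c c l
        - trunc N (Tri (phKer κ (t + s)) (φ (t + s)) (φ (t + s)) (φ (t + s))) l
        - trunc N (fun l => Tri (phKer κ (t + τ / 2)) (φ t) (φ t) (φ t) l
            - Tri (phKer κ (t + s)) (φ t) (φ t) (φ t) l) l) := by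
  have hK := wtSum_nonneg κ
  have hτ : 0 ≤ τ := hs.1.trans hs.2
  have hm1 : 1 ≤ m := by omega
  have hts : t + s ∈ Set.Icc 0 S := ⟨by linarith [hs.1], by linarith [hs.2]⟩
  have ht0 : t ∈ Set.Icc 0 S := ⟨ht, by linarith⟩
  set u := φ (t + s) with hu
  have hub := hφ.bound _ hts
  have hvb := hφ.bound _ ht0
  have hu1 : HB κ 1 R (trunc N u) := (hub.of_le hm1).trunc N
  have hab : |t + τ / 2 - (t + s)| ≤ τ := by
    rw [abs_le]; constructor <;> linarith [hs.1, hs.2]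
  have hker : KB κ 1 m (30 * τ)
      (fun p q r => phKer κ (t + τ / 2) p q r - phKer κ (t + s) p q r) :=
    (KB_phKer_sub κ (t + τ / 2) (t + s) hm).mono (by linarith)
  -- The difference of the fields is split in four: the Lipschitz part (`I1`), aliasing of the cubic
  -- term (`I2`), truncation of its arguments (`I3`), and freezing the phase (`I4`, of order
  -- $\tau$). In the second claim the frozen-phase error at $\varphi(t)$ is removed, and `I5` gains
  -- $|g|\tau$ from the slow motion of $\varphi$.
  have I1 := HB.gridTri_sub hκ hN0 hh hc (hu1.mono (by linarith)) hD (t + τ / 2)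
  have I2 := HB.gridTri_sub_trunc hκ hN0 hh hm1 (hub.trunc N) (t + τ / 2)
  have I3 := (HB.tri_sub_tri hκ le_rfl (KB_phKer κ (t + τ / 2) 1) hu1 (hub.of_le hm1)
    (hub.trunc_sub hκ hN hN0 hh hm1)).trunc N
  have hdec : ∀ (c : ℤ → ℂ) {A : ℝ}, HB κ m A c → ∀ l,
      Tri (phKer κ (t + τ / 2)) c c c l - Tri (phKer κ (t + s)) c c c l
      = Tri (fun p q r => phKer κ (t + τ / 2) p q r - phKer κ (t + s) p q r) c c c l :=
    fun c A hc l => (Tri_kernel_sub hκ hm1 (KB_phKer κ _ m) (KB_phKer κ _ m) hc hc hc l).symm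
  have I4 := (HB.tri hκ hm1 hker hub hub hub).trunc N
  have hdiff : HB κ m (|g| * (3 ^ (m + 1) * wtSum κ * R ^ 3) * τ) (fun l => u l - φ t l) := by
    refine (hφ.sub_bound hκ hm1 ht (by linarith [hs.1]) hts.2).mono ?_
    exact mul_le_mul_of_nonneg_left (by linarith [hs.2]) (by positivity)
  have I5 := (HB.tri_sub_tri hκ hm1 hker hub hvb hdiff).trunc N
  constructor
  · refine ((((I1.add I2).add I3).add I4).mono (le_of_eq ?_)).of_norm_le_one
      fun l => le_of_eq (congrArg norm ?_)
    · unfold lipC spaceC; ring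
    · have h1 : NLSTSFP.trunc N (Tri (fun p q r => phKer κ (t + τ / 2) p q r
          - phKer κ (t + s) p q r) u u u) l = NLSTSFP.trunc N (Tri (phKer κ (t + τ / 2)) u u u) l
          - NLSTSFP.trunc N (Tri (phKer κ (t + s)) u u u) l := by
        rw [trunc_sub_trunc]; simp only [hdec u hub]
      have h2 := trunc_sub_trunc N (Tri (phKer κ (t + τ / 2)) (NLSTSFP.trunc N u)
        (NLSTSFP.trunc N u) (NLSTSFP.trunc N u)) (Tri (phKer κ (t + τ / 2)) u u u) l
      rw [h1, ← h2]
      ring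
  · refine ((((I1.add I2).add I3).add I5).mono (le_of_eq ?_)).of_norm_le_one
      fun l => le_of_eq (congrArg norm ?_)
    · unfold lipC spaceC; ring
    · have h1 : NLSTSFP.trunc N (fun l => Tri (fun p q r => phKer κ (t + τ / 2) p q r
          - phKer κ (t + s) p q r) u u u l - Tri (fun p q r => phKer κ (t + τ / 2) p q r
          - phKer κ (t + s) p q r) (φ t) (φ t) (φ t) l) l
          = NLSTSFP.trunc N (Tri (phKer κ (t + τ / 2)) u u u) l
          - NLSTSFP.trunc N (Tri (phKer κ (t + s)) u u u) l
          - NLSTSFP.trunc N (fun l => Tri (phKer κ (t + τ / 2)) (φ t) (φ t) (φ t) l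
            - Tri (phKer κ (t + s)) (φ t) (φ t) (φ t) l) l := by
        rw [trunc_sub_trunc, trunc_sub_trunc]; simp only [hdec u hub, hdec (φ t) hvb]
      have h2 := trunc_sub_trunc N (Tri (phKer κ (t + τ / 2)) (NLSTSFP.trunc N u)
        (NLSTSFP.trunc N u) (NLSTSFP.trunc N u)) (Tri (phKer κ (t + τ / 2)) u u u) l
      rw [h1, ← h2]
      ring

/-- The error recursion over one step. -/
theorem one_step {κ g h S R t τ x : ℝ} (hκ : 0 < κ) {N : ℕ} (hN : Even N) (hN0 : 0 < N)
    (hh : κ * N * h = 2 * Real.pi) {m : ℕ} (hm : 3 ≤ m) {φ χ : ℝ → ℤ → ℂ}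
    (hφ : ExactFlow κ g S m R φ) (hχ : FrozenFlow κ g N (t + τ / 2) τ χ)
    (hR : 0 ≤ R) (ht : 0 ≤ t) (hτ : 0 ≤ τ) (htS : t + τ ≤ S)
    (hsmall : |g| * τ * lipC κ R ≤ 1 / 2)
    (hx : HB κ 1 x (fun l => χ 0 l - trunc N (φ t) l)) (hx1 : x ≤ 1) :
    HB κ 1 (|g| * τ * (2 * lipC κ R * x + 2 * spaceC κ R m * h ^ (m - 1)
        + timeC κ R m * (|g| * τ ^ 2)))
      (fun l => χ τ l - trunc N (φ (t + τ)) l - (χ 0 l - trunc N (φ t) l)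
        - (-Complex.I * g) * trunc N (Tri (defKer κ τ t) (φ t) (φ t) (φ t)) l) := by
  have hK := wtSum_nonneg κ
  have ha := aliasConst_nonneg κ
  have hL := lipC_nonneg κ R
  have hSp := spaceC_nonneg κ hR m
  have hh0 := mesh_pos_of_mul_eq hκ hN0 hh
  have hm1 : 1 ≤ m := by omega
  have ht0 : t ∈ Set.Icc 0 S := ⟨ht, by linarith⟩
  have hvb := hφ.bound _ ht0
  have hmem : ∀ s ∈ Set.Icc 0 τ, t + s ∈ Set.Icc 0 S := fun s hs =>
    ⟨by linarith [hs.1], by linarith [hs.2]⟩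
  have hshift : ∀ {f : ℝ → ℂ}, ContinuousOn f (Set.Icc 0 S) →
      ContinuousOn (fun s => f (t + s)) (Set.Icc 0 τ) := fun hf =>
    hf.comp (continuous_const.add continuous_id).continuousOn fun s hs => hmem s hs
  have hV : HB κ 1 (1 + R) (χ 0) := by
    refine ((hx.mono hx1).add ((hvb.of_le hm1).trunc N)).of_norm_le_one fun l => le_of_eq ?_
    congr 1; ring
  have hχb := hχ.bound hκ hN0 hh hτ hV (by
    refine le_trans (mul_le_mul_of_nonneg_left ?_ (by positivity)) hsmall
    unfold lipC
    have : 0 ≤ (1 + aliasConst κ) * wtSum κ * (1 + R) ^ 2 := by positivity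
    nlinarith)
  set d : ℝ → ℤ → ℂ := fun s l => χ s l - NLSTSFP.trunc N (φ (t + s)) l with hd
  have hdsupp : ∀ s, ∀ l ∉ freqs N, d s l = 0 := fun s l hl => by
    simp [hd, NLSTSFP.trunc, hl, hχ.support s l hl]
  have hdcont : ∀ l, ContinuousOn (fun s => d s l) (Set.Icc 0 τ) := fun l => by
    refine (hχ.cont l).sub ?_
    unfold NLSTSFP.trunc
    split_ifs
    · exact hshift (hφ.cont l)
    · exact continuousOn_const
  set X : ℝ → ℤ → ℂ := fun s l => gridTri κ N (t + τ / 2) (χ s) (χ s) (χ s) l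
    - NLSTSFP.trunc N (Tri (phKer κ (t + s)) (φ (t + s)) (φ (t + s)) (φ (t + s))) l with hX
  have hXcont : ∀ l, ContinuousOn (fun s => X s l) (Set.Icc 0 τ) := fun l => by
    refine (hχ.contTri l).sub ?_
    unfold NLSTSFP.trunc
    split_ifs
    · exact hshift (hφ.contTri l)
    · exact continuousOn_const
  set Λ : ℝ → ℤ → ℂ := fun s => NLSTSFP.trunc N (fun l =>
    Tri (phKer κ (t + τ / 2)) (φ t) (φ t) (φ t) l - Tri (phKer κ (t + s)) (φ t) (φ t) (φ t) l)
    with hΛ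
  have hΛcont : ∀ l, Continuous (fun s => Λ s l) := fun l => by
    simp only [hΛ]
    unfold NLSTSFP.trunc
    split_ifs
    · exact continuous_const.sub ((continuous_Tri_phKer hκ (hvb.of_le hm1) l).comp
        (continuous_const.add continuous_id))
    · exact continuous_const
  have hdX : ∀ s ∈ Set.Icc 0 τ, ∀ l,
      d s l = d 0 l + ∫ r in (0 : ℝ)..s, (-Complex.I * g) * X r l := by
    intro s hs l
    have h1 := hχ.duhamel s hs l
    have h2 := hφ.duhamel t (t + s) ht (by linarith [hs.1]) (hmem s hs).2 l
    have h3 : ∫ r in t..t + s, (-Complex.I * g) * Tri (phKer κ r) (φ r) (φ r) (φ r) l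
        = ∫ r in (0 : ℝ)..s, (-Complex.I * g) *
          Tri (phKer κ (t + r)) (φ (t + r)) (φ (t + r)) (φ (t + r)) l := by
      rw [intervalIntegral.integral_comp_add_left
        (fun r => (-Complex.I * g) * Tri (phKer κ r) (φ r) (φ r) (φ r) l) t, add_zero]
    have hint1 : IntervalIntegrable (fun r => (-Complex.I * g) *
        gridTri κ N (t + τ / 2) (χ r) (χ r) (χ r) l) MeasureTheory.volume 0 s := by
      refine ContinuousOn.intervalIntegrable ?_
      rw [Set.uIcc_of_le hs.1]
      exact continuousOn_const.mul ((hχ.contTri l).mono (Set.Icc_subset_Icc_right hs.2))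
    have hint2 : IntervalIntegrable (fun r => (-Complex.I * g) *
        Tri (phKer κ (t + r)) (φ (t + r)) (φ (t + r)) (φ (t + r)) l) MeasureTheory.volume 0 s := by
      refine ContinuousOn.intervalIntegrable ?_
      rw [Set.uIcc_of_le hs.1]
      exact continuousOn_const.mul
        ((hshift (hφ.contTri l)).mono (Set.Icc_subset_Icc_right hs.2))
    by_cases hl : l ∈ freqs N
    · simp only [hX, hd, NLSTSFP.trunc, hl, if_true, mul_sub, add_zero]
      rw [intervalIntegral.integral_sub hint1 hint2, ← h1, ← h3, ← h2]
      ring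
    · have hg0 : ∀ r, X r l = 0 := fun r => by
        simp [hX, gridTri, NLSTSFP.trunc, NLSTSFP.twist, NLSTSFP.aliased, hl]
      simp [hdsupp _ l hl, hg0]
  obtain ⟨D, hD, s₀, hs₀, hmax⟩ := exists_max_HB (κ := κ) (s := 1) hτ hdcont hdsupp
  have hD0 : 0 ≤ D := (hD s₀ hs₀).nonneg
  have hfield := fun s hs => field_difference hκ hN hN0 hh hm hφ hR ht htS hs (hχb s hs) (hD s hs)
  have hd0 : HB κ 1 x (d 0) := by simpa [hd] using hx
  set P := spaceC κ R m * h ^ (m - 1) with hP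
  have hP0 : 0 ≤ P := by positivity
  set Q := 90 * wtSum κ * R ^ 3 with hQ
  have hQ0 : 0 ≤ Q := by positivity
  set L := lipC κ R with hLd
  -- The crude field bound closes the estimate of the largest error within the step, the term in `D`
  -- being absorbed since $|g|\tau L\le1/2$.
  have hDle : D ≤ 2 * x + 2 * (|g| * τ) * (P + Q * τ) := by
    have h1 : HB κ 1 (|g| * (L * D + P + Q * τ) * (s₀ - 0))
        (fun l => ∫ r in (0 : ℝ)..s₀, (-Complex.I * g) * X r l) := by
      refine HB.intervalIntegral hs₀.1 (fun l => continuousOn_const.mul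
        ((hXcont l).mono (Set.Icc_subset_Icc_right hs₀.2))) fun r hr => ?_
      rw [← norm_neg_I_mul]
      exact (hfield r ⟨hr.1, hr.2.trans hs₀.2⟩).1.const_mul _
    have h2 := hd0.add h1
    have h3 : d s₀ = fun l => d 0 l + ∫ r in (0 : ℝ)..s₀, (-Complex.I * g) * X r l :=
      funext (hdX s₀ hs₀)
    rw [← h3] at h2
    have h4 := hmax _ h2
    have h5 : |g| * (L * D + P + Q * τ) * (s₀ - 0) ≤ |g| * (L * D + P + Q * τ) * τ :=
      mul_le_mul_of_nonneg_left (by linarith [hs₀.2]) (by positivity)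
    nlinarith
  -- The refined field bound now gives the increment over the whole step, apart from the leading
  -- local error.
  have hfin : HB κ 1 (|g| * ((L * D + P + 270 * wtSum κ * R ^ 2 *
      (3 ^ (m + 1) * wtSum κ * R ^ 3) * (|g| * τ ^ 2)) * (τ - 0)))
      (fun l => (-Complex.I * g) * ∫ r in (0 : ℝ)..τ, (X r l - Λ r l)) := by
    have h1 := (HB.intervalIntegral (g := fun r l => X r l - Λ r l) hτ (fun l =>
      (hXcont l).sub (hΛcont l).continuousOn) fun r hr => (hfield r hr).2).const_mul
      (-Complex.I * g)
    rwa [norm_neg_I_mul] at h1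
  have hΛint : ∀ l, ∫ r in (0 : ℝ)..τ, Λ r l
      = NLSTSFP.trunc N (Tri (defKer κ τ t) (φ t) (φ t) (φ t)) l := fun l => by
    by_cases hl : l ∈ freqs N
    · simp only [hΛ, NLSTSFP.trunc, hl, if_true]
      exact integral_Tri_phKer_sub hκ (hvb.of_le hm1) t τ l
    · simp [hΛ, NLSTSFP.trunc, hl]
  refine (hfin.mono ?_).of_norm_le_one fun l => le_of_eq (congrArg norm ?_)
  · unfold timeC
    rw [← hLd, ← hQ]
    set G := |g| * τ with hG
    have hG0 : 0 ≤ G := by positivity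
    set Y := 270 * wtSum κ * R ^ 2 * (3 ^ (m + 1) * wtSum κ * R ^ 3) with hY
    have h1 : |g| * ((L * D + P + Y * (|g| * τ ^ 2)) * (τ - 0))
        = G * (L * D + P + Y * (|g| * τ ^ 2)) := by rw [hG]; ring
    rw [h1]
    refine mul_le_mul_of_nonneg_left ?_ hG0
    have h2 : L * D ≤ L * (2 * x + 2 * G * (P + Q * τ)) := mul_le_mul_of_nonneg_left hDle hL
    have h3 : G * L * P ≤ 1 / 2 * P := mul_le_mul_of_nonneg_right hsmall hP0
    -- The crude phase error enters only through `D`, hence with an extra factor $|g|\tau$; this is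
    -- the first summand of `timeC`.
    have h4 : L * (2 * G * (Q * τ)) = 2 * L * Q * (|g| * τ ^ 2) := by rw [hG]; ring
    nlinarith
  · have hτm : τ ∈ Set.Icc 0 τ := ⟨hτ, le_rfl⟩
    have h1 := hdX τ hτm l
    have hint1 : IntervalIntegrable (fun r => X r l) MeasureTheory.volume 0 τ := by
      refine ContinuousOn.intervalIntegrable ?_
      rw [Set.uIcc_of_le hτ]; exact hXcont l
    rw [intervalIntegral.integral_sub hint1 ((hΛcont l).intervalIntegrable _ _), hΛint,
      mul_sub, ← intervalIntegral.integral_const_mul]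
    simp only [hd, add_zero] at h1
    rw [h1]; ring

/-! ### Accumulation of the errors -/

theorem sum_trunc (N n : ℕ) (c : ℕ → ℤ → ℂ) (l : ℤ) :
    ∑ k ∈ range n, trunc N (c k) l = trunc N (fun l => ∑ k ∈ range n, c k l) l := by
  unfold NLSTSFP.trunc; split_ifs <;> simp

/-- The size of all consistency errors accumulated up to the final time. -/
noncomputable def totalC (κ R T B h τ₀ G : ℝ) (m : ℕ) : ℝ :=
  (aliasConst κ * R + 2 * T * spaceC κ R m) * h ^ (m - 1)
    + T * (18 * (3 / κ) ^ (m - 1) * wtSum κ * R ^ 3) * τ₀ ^ (m - 1)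
    + ((6 * R + 9 * (T * (3 ^ (m + 1) * wtSum κ * R ^ 3))) * (B * wtSum κ * R ^ 2)
      + T * timeC κ R m) * G

/-- A discrete Gronwall argument in which the error is written as initial error plus summed leading
terms plus summed remainders. Keeping the leading terms together lets `HB.sum_defect` exploit their
cancellation. `hsize` closes the bootstrap: an error of at most 1 is what `one_step` requires in
order to continue. -/
theorem global_error {κ g h S R T τ τ₀ B : ℝ} (hκ : 0 < κ) {N : ℕ} (hN : Even N) (hN0 : 0 < N)
    (hh : κ * N * h = 2 * Real.pi) {m : ℕ} (hm : 3 ≤ m) {φ : ℝ → ℤ → ℂ}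
    (hφ : ExactFlow κ g S m R φ) (hR : 0 ≤ R) (hτ : 0 ≤ τ) (hS : 0 ≤ S) (hT : |g| * S ≤ T)
    (hsmall : |g| * τ * lipC κ R ≤ 1 / 2) (hτ₀ : 0 < τ₀) {n₀ : ℤ} (hn₀ : 1 / τ₀ ≤ n₀)
    (hB : 0 ≤ B) (hAB : AbelBound κ τ n₀ m B) {η : ℕ → ℤ → ℂ} (hη0 : η 0 = aliased N (φ 0))
    (hη : ∀ n : ℕ, (n + 1) * τ ≤ S → ∃ χ, FrozenFlow κ g N (n * τ + τ / 2) τ χ ∧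
      χ 0 = η n ∧ χ τ = η (n + 1))
    (hsize : totalC κ R T B h τ₀ (|g| * τ ^ 2) m * Real.exp (2 * lipC κ R * T) ≤ 1) :
    ∀ n : ℕ, n * τ ≤ S → HB κ 1
      (totalC κ R T B h τ₀ (|g| * τ ^ 2) m * Real.exp (2 * lipC κ R * T))
      (fun l => η n l - trunc N (φ (n * τ)) l) := by
  have hK := wtSum_nonneg κ
  have ha := aliasConst_nonneg κ
  have hL := lipC_nonneg κ R
  have hSp := spaceC_nonneg κ hR m
  have hTm := timeC_nonneg κ hR m
  have hh0 := mesh_pos_of_mul_eq hκ hN0 hh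
  have hm1 : 1 ≤ m := by omega
  have hT0 : 0 ≤ T := le_trans (by positivity) hT
  set A := totalC κ R T B h τ₀ (|g| * τ ^ 2) m with hA
  have hA0 : 0 ≤ A := by rw [hA]; unfold totalC; positivity
  set q := 2 * lipC κ R * (|g| * τ) with hq
  have hq0 : 0 ≤ q := by positivity
  -- On the long time interval the number of steps times $|g|\tau$ stays below $T$, so an $n$-fold
  -- sum of terms carrying $|g|\tau$ costs only a factor $T$.
  have hgt : ∀ n : ℕ, n * τ ≤ S → n * (|g| * τ) ≤ T := fun n hn =>
    le_trans (by nlinarith [abs_nonneg g]) hT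
  have hexp : ∀ n : ℕ, n * τ ≤ S → A * (1 + q) ^ n ≤ A * Real.exp (2 * lipC κ R * T) := by
    intro n hn
    refine mul_le_mul_of_nonneg_left ?_ hA0
    calc (1 + q) ^ n ≤ Real.exp q ^ n :=
          pow_le_pow_left₀ (by linarith) (by linarith [Real.add_one_le_exp q]) n
      _ = Real.exp (n * q) := (Real.exp_nat_mul q n).symm
      _ ≤ _ := Real.exp_le_exp.mpr (by
        rw [hq, show (n : ℝ) * (2 * lipC κ R * (|g| * τ)) = 2 * lipC κ R * (n * (|g| * τ)) by ring]
        exact mul_le_mul_of_nonneg_left (hgt n hn) (by positivity))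
  suffices hmain : ∀ n : ℕ, n * τ ≤ S →
      HB κ 1 (A * (1 + q) ^ n) (fun l => η n l - NLSTSFP.trunc N (φ (n * τ)) l) from
    fun n hn => (hmain n hn).mono (hexp n hn)
  intro n
  -- The summed form of the error at `n` uses the bounds at all earlier steps.
  induction n using Nat.strong_induction_on with
  | _ n ih =>
  intro hn
  have hbd : ∀ k : ℕ, k ≤ n → (k : ℝ) * τ ∈ Set.Icc 0 S := fun k hk =>
    ⟨by positivity, le_trans (mul_le_mul_of_nonneg_right (by exact_mod_cast hk) hτ) hn⟩
  set e : ℕ → ℤ → ℂ := fun n l => η n l - NLSTSFP.trunc N (φ (n * τ)) l with he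
  set lead : ℕ → ℤ → ℂ := fun k =>
    Tri (defKer κ τ (k * τ)) (φ (k * τ)) (φ (k * τ)) (φ (k * τ)) with hlead
  set rem : ℕ → ℤ → ℂ := fun k l => e (k + 1) l - e k l
    - (-Complex.I * g) * NLSTSFP.trunc N (lead k) l with hrem
  have h0 : HB κ 1 (aliasConst κ * h ^ (m - 1) * R) (e 0) := by
    have := (hφ.bound 0 ⟨le_rfl, hS⟩).aliased_sub_trunc hκ hN0 hh hm1
    simpa [he, hη0] using this
  have hremb : ∀ k < n, HB κ 1 (q * (A * (1 + q) ^ k)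
      + |g| * τ * (2 * spaceC κ R m * h ^ (m - 1) + timeC κ R m * (|g| * τ ^ 2))) (rem k) := by
    intro k hk
    have hkS := hbd k hk.le
    have hk1 := hbd (k + 1) hk
    have hks : (k : ℝ) * τ + τ = ((k + 1 : ℕ) : ℝ) * τ := by push_cast; ring
    obtain ⟨χ, hχ, hχ0, hχτ⟩ := hη k (by have := hk1.2; push_cast at this; exact this)
    have h1 := one_step hκ hN hN0 hh hm hφ hχ hR hkS.1 hτ (by rw [hks]; exact hk1.2) hsmall
      (by rw [hχ0]; exact ih k hk hkS.2) ((hexp k hkS.2).trans hsize)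
    rw [hχ0, hχτ, hks] at h1
    exact h1.mono (le_of_eq (by rw [hq]; ring))
  have hremsum := HB.sum hremb
  have hleadsum := (HB.sum_defect (B := B) (τ₀ := τ₀) (R := R)
    (D := |g| * (3 ^ (m + 1) * wtSum κ * R ^ 3) * τ) (n := n) hκ hτ hτ₀ hn₀ hm1 hB hAB
    (φ := fun k => φ (k * τ)) (fun k hk => hφ.bound _ (hbd k hk.le)) (fun k hk => by
      have h1 := hφ.sub_bound hκ hm1 (hbd k (by omega)).1
        (t := ((k + 1 : ℕ) : ℝ) * τ) (by push_cast; linarith) (hbd (k + 1) hk.le).2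
      exact h1.mono (le_of_eq (by push_cast; ring))) (by positivity) hR)
  have hleadsum' := (hleadsum.trunc N).const_mul (-Complex.I * g)
  rw [norm_neg_I_mul] at hleadsum'
  have hsum := (h0.add hleadsum').add hremsum
  refine (hsum.mono ?_).of_norm_le_one fun l => le_of_eq (congrArg norm ?_)
  · rw [Finset.sum_add_distrib, ← Finset.mul_sum, ← Finset.mul_sum, Finset.sum_const,
      Finset.card_range, nsmul_eq_mul]
    -- The bound $A(1+q)^k$ reproduces itself exactly under summation.
    have hgeom : q * (A * ∑ k ∈ range n, (1 + q) ^ k) = A * (1 + q) ^ n - A := by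
      have := geom_sum_mul (1 + q) n
      rw [add_sub_cancel_left] at this
      calc _ = A * ((∑ k ∈ range n, (1 + q) ^ k) * q) := by ring
        _ = _ := by rw [this]; ring
    rw [hgeom]
    have hng := hgt n hn
    have e1 : |g| * (n * (18 * (3 / κ) ^ (m - 1) * τ * τ₀ ^ (m - 1) * wtSum κ * R ^ 3))
        ≤ T * (18 * (3 / κ) ^ (m - 1) * wtSum κ * R ^ 3) * τ₀ ^ (m - 1) := by
      have : 0 ≤ 18 * (3 / κ) ^ (m - 1) * wtSum κ * R ^ 3 * τ₀ ^ (m - 1) := by positivity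
      calc _ = (n * (|g| * τ)) * (18 * (3 / κ) ^ (m - 1) * wtSum κ * R ^ 3 * τ₀ ^ (m - 1)) := by
            ring
        _ ≤ T * _ := mul_le_mul_of_nonneg_right hng this
        _ = _ := by ring
    -- The $g$ in front of the leading errors supplies $|g|\tau^2$ for the boundary terms; the $n$
    -- increments bring a further $n|g|\tau\le T$.
    have e2 : |g| * ((6 * R + 9 * (n * (|g| * (3 ^ (m + 1) * wtSum κ * R ^ 3) * τ)))
          * (B * τ ^ 2 * wtSum κ * R ^ 2))
        ≤ (6 * R + 9 * (T * (3 ^ (m + 1) * wtSum κ * R ^ 3))) * (B * wtSum κ * R ^ 2)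
          * (|g| * τ ^ 2) := by
      calc _ = (6 * R + 9 * ((n * (|g| * τ)) * (3 ^ (m + 1) * wtSum κ * R ^ 3)))
            * (B * wtSum κ * R ^ 2) * (|g| * τ ^ 2) := by ring
        _ ≤ _ := by gcongr
    have e3 : n * (|g| * τ * (2 * spaceC κ R m * h ^ (m - 1) + timeC κ R m * (|g| * τ ^ 2)))
        ≤ T * (2 * spaceC κ R m * h ^ (m - 1) + timeC κ R m * (|g| * τ ^ 2)) := by
      rw [← mul_assoc]
      exact mul_le_mul_of_nonneg_right hng (by positivity)
    have e4 : A = (aliasConst κ * R + 2 * T * spaceC κ R m) * h ^ (m - 1)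
        + T * (18 * (3 / κ) ^ (m - 1) * wtSum κ * R ^ 3) * τ₀ ^ (m - 1)
        + ((6 * R + 9 * (T * (3 ^ (m + 1) * wtSum κ * R ^ 3))) * (B * wtSum κ * R ^ 2)
          + T * timeC κ R m) * (|g| * τ ^ 2) := rfl
    linarith
  · have h1 : ∑ k ∈ range n, rem k l = e n l - e 0 l
        - (-Complex.I * g) * NLSTSFP.trunc N (fun l => ∑ k ∈ range n, lead k l) l := by
      simp only [hrem]
      rw [Finset.sum_sub_distrib, Finset.sum_range_sub (fun k => e k l), ← Finset.mul_sum,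
        sum_trunc]
    rw [h1]
    ring

/-! ### Fourier modes and Fourier coefficients of periodic functions -/

theorem mu_eq (a b : ℝ) (l : ℤ) : mu a b l = mu a b 1 * l := by
  unfold mu; push_cast; ring

theorem mu_one_pos {a b : ℝ} (hab : a < b) : 0 < mu a b 1 := by
  have : 0 < b - a := sub_pos.mpr hab
  have := Real.pi_pos
  unfold mu; push_cast; positivity

theorem wt_mu (a b : ℝ) (l : ℤ) : 1 + mu a b l ^ 2 = wt (mu a b 1) l := by
  rw [mu_eq, wt]

theorem mode_eq_ph (a b : ℝ) (l : ℤ) (x : ℝ) : mode a b l x = ph (mu a b l * (x - a)) := rfl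

theorem norm_mode (a b : ℝ) (l : ℤ) (x : ℝ) : ‖mode a b l x‖ = 1 := norm_ph _

theorem mode_add (a b : ℝ) (k l : ℤ) (x : ℝ) :
    mode a b (k + l) x = mode a b k x * mode a b l x := by
  rw [mode_eq_ph, mode_eq_ph, mode_eq_ph, ← ph_add, mu_eq, mu_eq a b k, mu_eq a b l]
  congr 1; push_cast; ring

theorem mode_neg (a b : ℝ) (l : ℤ) (x : ℝ) :
    mode a b (-l) x = (starRingEnd ℂ) (mode a b l x) := by
  rw [mode_eq_ph, mode_eq_ph, ← ph_neg, mu_eq, mu_eq a b l]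
  congr 1; push_cast; ring

theorem mode_zero (a b : ℝ) (x : ℝ) : mode a b 0 x = 1 := by
  rw [mode_eq_ph, mu_eq]; simp [ph_zero]

theorem continuous_mode (a b : ℝ) (l : ℤ) : Continuous (mode a b l) :=
  continuous_ph.comp (by fun_prop)

theorem hasDerivAt_mode (a b : ℝ) (l : ℤ) (x : ℝ) :
    HasDerivAt (mode a b l) (Complex.I * mu a b l * mode a b l x) x := by
  have h1 := (hasDerivAt_ph_mul (mu a b l) (x - a)).comp_sub_const x a
  have h2 : (fun y => ph ((y - a) * mu a b l)) = mode a b l := by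
    funext y; rw [mode_eq_ph, mul_comm]
  rw [h2] at h1
  convert! h1 using 2
  rw [mode_eq_ph, mul_comm]

theorem ph_int_mul_two_pi (l : ℤ) : ph (l * (2 * Real.pi)) = 1 := by
  unfold ph
  rw [Complex.exp_eq_one_iff]
  exact ⟨l, by push_cast; ring⟩

theorem mode_left (a b : ℝ) (l : ℤ) : mode a b l a = 1 := by
  rw [mode_eq_ph, sub_self, mul_zero, ph_zero]

theorem mode_right {a b : ℝ} (hab : a < b) (l : ℤ) : mode a b l b = 1 := by
  rw [mode_eq_ph, mu, div_mul_cancel₀ _ (sub_pos.mpr hab).ne', ← ph_int_mul_two_pi l]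
  congr 1; ring

theorem coeff_mul_mode (a b : ℝ) (u : ℝ → ℂ) (k l : ℤ) :
    coeff a b (fun x => u x * mode a b k x) l = coeff a b u (l - k) := by
  unfold coeff
  congr 2
  funext x
  rw [show -(l - k) = k + -l by ring, mode_add]; ring

theorem coeff_const_mul (a b : ℝ) (z : ℂ) (u : ℝ → ℂ) (l : ℤ) :
    coeff a b (fun x => z * u x) l = z * coeff a b u l := by
  unfold coeff
  rw [show (fun x => z * u x * mode a b (-l) x) = fun x => z * (u x * mode a b (-l) x) by
    funext x; ring, intervalIntegral.integral_const_mul]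
  ring

theorem coeff_sub {a b : ℝ} {u v : ℝ → ℂ} (hu : Continuous u) (hv : Continuous v) (l : ℤ) :
    coeff a b (fun x => u x - v x) l = coeff a b u l - coeff a b v l := by
  have h1 : IntervalIntegrable (fun x => u x * mode a b (-l) x) MeasureTheory.volume a b :=
    (hu.mul (continuous_mode a b _)).intervalIntegrable _ _
  have h2 : IntervalIntegrable (fun x => v x * mode a b (-l) x) MeasureTheory.volume a b :=
    (hv.mul (continuous_mode a b _)).intervalIntegrable _ _
  unfold coeff
  rw [← mul_sub, ← intervalIntegral.integral_sub h1 h2]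
  congr 2
  funext x; ring

/-- Fourier coefficients of a derivative. -/
theorem coeff_deriv {a b : ℝ} (hab : a < b) {u u' : ℝ → ℂ} (hu : ∀ x, HasDerivAt u (u' x) x)
    (hu' : Continuous u') (hp : u b = u a) (l : ℤ) :
    coeff a b u' l = Complex.I * mu a b l * coeff a b u l := by
  have hmodec : Continuous fun x => Complex.I * mu a b (-l) * mode a b (-l) x :=
    continuous_const.mul (continuous_mode a b (-l))
  have h1 := intervalIntegral.integral_mul_deriv_eq_deriv_mul (a := a) (b := b)
    (fun x _ => hu x) (fun x _ => hasDerivAt_mode a b (-l) x)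
    (hu'.intervalIntegrable _ _) (hmodec.intervalIntegrable _ _)
  rw [mode_left, mode_right hab, hp, sub_self, zero_sub] at h1
  have h2 : ∫ x in a..b, u x * (Complex.I * mu a b (-l) * mode a b (-l) x)
      = Complex.I * mu a b (-l) * ∫ x in a..b, u x * mode a b (-l) x := by
    rw [← intervalIntegral.integral_const_mul]
    congr 1; funext x; ring
  rw [h2] at h1
  have h3 : ((mu a b (-l) : ℝ) : ℂ) = -(mu a b l : ℂ) := by
    rw [mu_eq, mu_eq a b l]; push_cast; ring
  rw [h3] at h1
  unfold coeff
  rw [← neg_neg (∫ x in a..b, u' x * mode a b (-l) x), ← h1]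
  ring

theorem coeff_iteratedDeriv_two {a b : ℝ} (hab : a < b) {u : ℝ → ℂ} (hu : ContDiff ℝ 2 u)
    (hp : Function.Periodic u (b - a)) (l : ℤ) :
    coeff a b (iteratedDeriv 2 u) l = -(mu a b l : ℂ) ^ 2 * coeff a b u l := by
  have hd : ContDiff ℝ 1 (deriv u) := by
    have : ContDiff ℝ (1 + 1) u := by simpa [one_add_one_eq_two] using hu
    exact (contDiff_succ_iff_deriv.mp this).2.2
  have h1 : ∀ x, HasDerivAt u (deriv u x) x := fun x =>
    (hu.differentiable (by norm_num) x).hasDerivAt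
  have h2 : ∀ x, HasDerivAt (deriv u) (iteratedDeriv 2 u x) x := fun x => by
    rw [iteratedDeriv_succ, iteratedDeriv_one]
    exact (hd.differentiable (by norm_num) x).hasDerivAt
  have hc : Continuous (iteratedDeriv 2 u) := hu.continuous_iteratedDeriv 2 le_rfl
  have hpu : u b = u a := by simpa using hp a
  have hpd : deriv u b = deriv u a := by
    have h3 : (fun x => u (x + (b - a))) = u := funext hp
    have h4 := deriv_comp_add_const (f := u) (b - a) a
    rw [h3, add_sub_cancel] at h4
    exact h4.symm
  rw [coeff_deriv hab h2 hc hpd, coeff_deriv hab h1 hd.continuous hpu]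
  have := Complex.I_sq
  linear_combination ((mu a b l : ℂ) ^ 2 * coeff a b u l) * this

/-- A continuous periodic function with summable coefficients is the sum of its Fourier series. -/
theorem hasSum_mode {a b : ℝ} (hab : a < b) {u : ℝ → ℂ} (hu : Continuous u)
    (hp : Function.Periodic u (b - a)) (hs : Summable fun l => ‖coeff a b u l‖) (x : ℝ) :
    HasSum (fun l => coeff a b u l * mode a b l x) (u x) := by
  have : Fact (0 < b - a) := ⟨sub_pos.mpr hab⟩
  have hT : (b - a) ≠ 0 := (sub_pos.mpr hab).ne'
  -- The modes here are based at `a`, those on the circle at 0; the translate of `u` by `a` matches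
  -- them.
  have hv : Function.Periodic (fun y => u (a + y)) (b - a) := fun y => by
    simp only [← add_assoc]; exact hp (a + y)
  have hcont : Continuous (hv.lift : AddCircle (b - a) → ℂ) :=
    continuous_coinduced_dom.mpr (hu.comp (continuous_const.add continuous_id))
  set F : C(AddCircle (b - a), ℂ) := ⟨hv.lift, hcont⟩ with hF
  have hmode : ∀ (l : ℤ) (y : ℝ), fourier l (y : AddCircle (b - a)) = mode a b l (a + y) := by
    intro l y
    rw [fourier_coe_apply, mode, mu]
    congr 1
    push_cast
    ring
  have hFy : ∀ y : ℝ, F (y : AddCircle (b - a)) = u (a + y) := fun y => hv.lift_coe y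
  have hcoef : ∀ l, fourierCoeff F l = coeff a b u l := fun l => by
    rw [fourierCoeff_eq_intervalIntegral _ _ 0, zero_add, coeff]
    have h1 : ∀ y : ℝ, fourier (-l) (y : AddCircle (b - a)) • F (y : AddCircle (b - a))
        = (fun x => u x * mode a b (-l) x) (a + y) := fun y => by
      rw [hmode, hFy, smul_eq_mul, mul_comm]
    simp only [h1]
    rw [intervalIntegral.integral_comp_add_left (fun x => u x * mode a b (-l) x) a, add_zero,
      add_sub_cancel, Complex.real_smul]
    push_cast
    rfl
  have h2 : Summable (fourierCoeff F) := by
    rw [show fourierCoeff F = coeff a b u from funext hcoef]; exact hs.of_norm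
  have h3 := has_pointwise_sum_fourier_series_of_summable h2 ((x - a : ℝ) : AddCircle (b - a))
  simp only [hcoef, hmode, hFy, smul_eq_mul, add_sub_cancel] at h3
  exact h3

/-- Termwise computation of Fourier coefficients. -/
theorem hasSum_coeff {a b : ℝ} {ι : Type*} [Countable ι] {f : ι → ℝ → ℂ} {u : ℝ → ℂ}
    {B : ι → ℝ} (hf : ∀ i, Continuous (f i)) (hB : Summable B) (hfB : ∀ i x, ‖f i x‖ ≤ B i)
    (hu : ∀ x, HasSum (fun i => f i x) (u x)) (l : ℤ) :
    HasSum (fun i => coeff a b (f i) l) (coeff a b u l) := by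
  unfold coeff
  refine HasSum.mul_left _ ?_
  refine intervalIntegral.hasSum_integral_of_dominated_convergence (fun i _ => B i) (fun i => ?_)
    (fun i => ?_) ?_ ?_ ?_
  · exact ((hf i).mul (continuous_mode a b _)).aestronglyMeasurable
  · refine Filter.Eventually.of_forall fun x _ => ?_
    rw [norm_mul, norm_mode, mul_one]; exact hfB i x
  · exact Filter.Eventually.of_forall fun _ _ => hB
  · exact intervalIntegrable_const
  · exact Filter.Eventually.of_forall fun x _ => (hu x).mul_right _

theorem hasSum_mul_of_summable_norm {f g : ℤ → ℂ} {z w : ℂ} (h : HasSum f z) (h' : HasSum g w)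
    (hf : Summable fun l => ‖f l‖) (hg : Summable fun l => ‖g l‖) :
    HasSum (fun i : ℤ × ℤ => f i.1 * g i.2) (z * w) :=
  h.mul h' (summable_mul_of_summable_norm hf hg)

theorem hasSum_conj {f : ℤ → ℂ} {z : ℂ} (h : HasSum f z) :
    HasSum (fun l => (starRingEnd ℂ) (f l)) ((starRingEnd ℂ) z) :=
  h.map (starRingEnd ℂ) Complex.continuous_conj

/-- Only the first two factors are expanded; a product of their modes acts on the third by a shift
of its coefficients. Hence only two factors need summable coefficients. -/
theorem hasSum_triple {a b : ℝ} (hab : a < b) {u v : ℝ → ℂ} (hu : Continuous u)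
    (hv : Continuous v) (hup : Function.Periodic u (b - a)) (hvp : Function.Periodic v (b - a))
    (hus : Summable fun l => ‖coeff a b u l‖) (hvs : Summable fun l => ‖coeff a b v l‖)
    (w : ℝ → ℂ) (x : ℝ) :
    HasSum (fun i : ℤ × ℤ => (coeff a b u i.1 * (starRingEnd ℂ) (coeff a b v i.2)) *
      (w x * mode a b (i.1 - i.2) x)) (u x * (starRingEnd ℂ) (v x) * w x) := by
  have hux : Summable fun l => ‖coeff a b u l * mode a b l x‖ := by
    simpa only [norm_mul, norm_mode, mul_one] using hus
  have hvx : Summable fun l => ‖(starRingEnd ℂ) (coeff a b v l * mode a b l x)‖ := by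
    simpa only [RCLike.norm_conj, norm_mul, norm_mode, mul_one] using hvs
  have h3 := hasSum_mul_of_summable_norm
    (g := fun l => (starRingEnd ℂ) (coeff a b v l * mode a b l x))
    (hasSum_mode hab hu hup hus x) (hasSum_conj (hasSum_mode hab hv hvp hvs x)) hux hvx
  have h4 := h3.mul_right (w x)
  have h5 : ∀ i : ℤ × ℤ, (coeff a b u i.1 * (starRingEnd ℂ) (coeff a b v i.2)) *
      (w x * mode a b (i.1 - i.2) x) = coeff a b u i.1 * mode a b i.1 x *
        (starRingEnd ℂ) (coeff a b v i.2 * mode a b i.2 x) * w x := fun i => by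
    rw [sub_eq_add_neg, mode_add, mode_neg, map_mul]
    ring
  rw [funext h5]
  exact h4

/-- The Fourier coefficients of a trilinear product. -/
theorem coeff_triple {a b : ℝ} (hab : a < b) {u v w : ℝ → ℂ} (hu : Continuous u)
    (hv : Continuous v) (hw : Continuous w) (hup : Function.Periodic u (b - a))
    (hvp : Function.Periodic v (b - a)) (hus : Summable fun l => ‖coeff a b u l‖)
    (hvs : Summable fun l => ‖coeff a b v l‖) {A : ℝ} (hA : ∀ x, ‖w x‖ ≤ A) (l : ℤ) :
    coeff a b (fun x => u x * (starRingEnd ℂ) (v x) * w x) l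
      = Tri (fun _ _ _ => 1) (coeff a b u) (coeff a b v) (coeff a b w) l := by
  have hsum2 : Summable fun x : ℤ × ℤ => ‖coeff a b u x.1‖ * ‖coeff a b v x.2‖ :=
    hus.mul_of_nonneg hvs (fun _ => norm_nonneg _) (fun _ => norm_nonneg _)
  have h1 := hasSum_coeff (a := a) (b := b) (ι := ℤ × ℤ)
    (f := fun i x => (coeff a b u i.1 * (starRingEnd ℂ) (coeff a b v i.2)) *
      (w x * mode a b (i.1 - i.2) x))
    (B := fun i => ‖coeff a b u i.1‖ * ‖coeff a b v i.2‖ * A)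
    (fun i => continuous_const.mul (hw.mul (continuous_mode a b _))) (hsum2.mul_right A)
    (fun i x => by
      rw [norm_mul, norm_mul, norm_mul, norm_mode, mul_one, RCLike.norm_conj]
      exact mul_le_mul_of_nonneg_left (hA x) (by positivity))
    (hasSum_triple hab hu hv hup hvp hus hvs w) l
  rw [← h1.tsum_eq]
  unfold Tri
  refine tsum_congr fun i => ?_
  rw [coeff_const_mul, coeff_mul_mode, triTerm, one_mul,
    show l - (i.1 - i.2) = l - i.1 + i.2 by ring]

theorem norm_sq_mul_self (z : ℂ) : ((‖z‖ ^ 2 : ℝ) : ℂ) * z = z * (starRingEnd ℂ) z * z := by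
  rw [Complex.mul_conj, Complex.normSq_eq_norm_sq]

theorem norm_le_of_HB {a b A : ℝ} (hab : a < b) {u : ℝ → ℂ} (hu : Continuous u)
    (hp : Function.Periodic u (b - a)) {s : ℕ} (hs : 1 ≤ s)
    (hA : HB (mu a b 1) s A (coeff a b u)) (x : ℝ) :
    ‖u x‖ ≤ Real.sqrt (wtSum (mu a b 1)) * A := by
  have hsum := hA.summable_norm (mu_one_pos hab) hs
  have h1 := hasSum_mode hab hu hp hsum x
  rw [← h1.tsum_eq]
  refine (norm_tsum_le_tsum_norm ?_).trans ?_
  · simpa [norm_mul, norm_mode] using hsum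
  · simp only [norm_mul, norm_mode, mul_one]
    exact hA.tsum_norm_le (mu_one_pos hab) hs

theorem MemHper.HB {a b : ℝ} {s : ℕ} {u : ℝ → ℂ} (h : MemHper a b s u) :
    HB (mu a b 1) s (hNorm a b s u) (coeff a b u) := by
  refine HB.of_sum_le (Real.sqrt_nonneg _) fun F => ?_
  rw [hNorm, Real.sq_sqrt (tsum_nonneg fun l => by positivity)]
  simp only [← wt_mu]
  exact h.2.2.sum_le_tsum F fun l _ => by positivity

theorem HB.hNorm_le {a b A : ℝ} {s : ℕ} {u : ℝ → ℂ}
    (h : NLSTSFP.HB (mu a b 1) s A (coeff a b u)) : hNorm a b s u ≤ A := by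
  rw [hNorm]
  refine Real.sqrt_le_iff.mpr ⟨h.nonneg, ?_⟩
  simp only [wt_mu]
  exact Real.tsum_le_of_sum_le (fun l => mul_nonneg (pow_nonneg (wt_pos _ l).le _) (sq_nonneg _))
    fun F => h.sum_le F

theorem continuousOn_coeff {a b A : ℝ} {v : ℝ → ℝ → ℂ} {X : Set ℝ}
    (hc : ∀ t ∈ X, Continuous (v t)) (hA : ∀ t ∈ X, ∀ x, ‖v t x‖ ≤ A)
    (ht : ∀ x, ContinuousOn (fun t => v t x) X) (l : ℤ) :
    ContinuousOn (fun t => coeff a b (v t) l) X := by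
  unfold coeff
  refine continuousOn_const.mul fun t₀ ht₀ => ?_
  refine intervalIntegral.continuousWithinAt_of_dominated_interval (bound := fun _ => A) ?_ ?_
    intervalIntegrable_const ?_
  · filter_upwards [self_mem_nhdsWithin] with t ht'
    exact ((hc t ht').mul (continuous_mode a b _)).aestronglyMeasurable
  · filter_upwards [self_mem_nhdsWithin] with t ht'
    refine Filter.Eventually.of_forall fun x _ => ?_
    rw [norm_mul, norm_mode, mul_one]
    exact hA t ht' x
  · exact Filter.Eventually.of_forall fun x _ => (ht x t₀ ht₀).mul continuousWithinAt_const

/-! ### The exact solution satisfies Duhamel's formula -/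

section solution

variable {a b σ ε S R : ℝ} {m : ℕ} {ψ : ℝ → ℝ → ℂ}

theorem BoundedBy.HB_coeff (hψ : BoundedBy a b m S R ψ) {t : ℝ} (ht : t ∈ Set.Icc 0 S) :
    HB (mu a b 1) m R (coeff a b (ψ t)) :=
  (hψ.1 t ht).1.HB.mono (hψ.1 t ht).2

theorem IsSolution.timeDeriv_eq (h : IsSolution a b σ ε S ψ) {t : ℝ} (ht : t ∈ Set.Ioo 0 S) :
    timeDeriv ψ t = fun x => Complex.I * iteratedDeriv 2 (ψ t) x
      - (Complex.I * ((σ * ε ^ 2 : ℝ) : ℂ)) * (((‖ψ t x‖ ^ 2 : ℝ) : ℂ) * ψ t x) := by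
  funext x
  have h1 := h.equation t ht x
  have h2 := Complex.I_sq
  push_cast at h1 ⊢
  linear_combination (-Complex.I) * h1 + timeDeriv ψ t x * h2

theorem IsSolution.continuous_timeDeriv (h : IsSolution a b σ ε S ψ) {t : ℝ}
    (ht : t ∈ Set.Ioo 0 S) : Continuous (timeDeriv ψ t) := by
  have h1 := h.contDiff_space t ⟨ht.1.le, ht.2.le⟩
  have h2 : Continuous (iteratedDeriv 2 (ψ t)) := h1.continuous_iteratedDeriv 2 le_rfl
  have h3 := h1.continuous
  rw [h.timeDeriv_eq ht]
  fun_prop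

theorem IsSolution.norm_le (hab : a < b) (h : IsSolution a b σ ε S ψ)
    (hψ : BoundedBy a b m S R ψ) (hm : 1 ≤ m) {t : ℝ} (ht : t ∈ Set.Icc 0 S) (x : ℝ) :
    ‖ψ t x‖ ≤ Real.sqrt (wtSum (mu a b 1)) * R :=
  norm_le_of_HB hab (h.contDiff_space t ht).continuous (h.periodic t ht) hm (hψ.HB_coeff ht) x

theorem IsSolution.coeff_cubic (hab : a < b) (h : IsSolution a b σ ε S ψ)
    (hψ : BoundedBy a b m S R ψ) (hm : 1 ≤ m) {t : ℝ} (ht : t ∈ Set.Icc 0 S) (l : ℤ) :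
    coeff a b (fun x => ((‖ψ t x‖ ^ 2 : ℝ) : ℂ) * ψ t x) l
      = Tri (fun _ _ _ => 1) (coeff a b (ψ t)) (coeff a b (ψ t)) (coeff a b (ψ t)) l := by
  have hc := (h.contDiff_space t ht).continuous
  have hp := h.periodic t ht
  have hs := (hψ.HB_coeff ht).summable_norm (mu_one_pos hab) hm
  simp only [norm_sq_mul_self]
  exact coeff_triple hab hc hc hc hp hp hs hs (h.norm_le hab hψ hm ht) l

/-- The majorant for differentiating under the integral is the supremum bound on $\partial_t\psi$
coming from $H^{m-2}\subset H^1$; this is the role of `3 ≤ m`. -/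
theorem IsSolution.hasDerivAt_coeff (hab : a < b) (h : IsSolution a b σ ε S ψ)
    (hψ : BoundedBy a b m S R ψ) (hm : 3 ≤ m) {t : ℝ} (ht : t ∈ Set.Ioo 0 S) (l : ℤ) :
    HasDerivAt (fun t => coeff a b (ψ t) l) (coeff a b (timeDeriv ψ t) l) t := by
  have hI : ∀ {s}, s ∈ Set.Ioo 0 S → s ∈ Set.Icc 0 S := fun hs => ⟨hs.1.le, hs.2.le⟩
  have hnhds : Set.Ioo 0 S ∈ nhds t := Ioo_mem_nhds ht.1 ht.2
  have hbound : ∀ s ∈ Set.Ioo 0 S, ∀ x,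
      ‖timeDeriv ψ s x‖ ≤ Real.sqrt (wtSum (mu a b 1)) * R := fun s hs x =>
    norm_le_of_HB hab (h.continuous_timeDeriv hs) (hψ.2 s hs).1.1 (s := m - 2) (by omega)
      ((hψ.2 s hs).1.HB.mono (hψ.2 s hs).2) x
  have hc : ∀ s ∈ Set.Ioo 0 S, Continuous fun x => ψ s x * mode a b (-l) x := fun s hs =>
    (h.contDiff_space s (hI hs)).continuous.mul (continuous_mode a b _)
  refine (intervalIntegral.hasDerivAt_integral_of_dominated_loc_of_deriv_le
    (F := fun s x => ψ s x * mode a b (-l) x) (F' := fun s x => timeDeriv ψ s x * mode a b (-l) x)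
    (bound := fun _ => Real.sqrt (wtSum (mu a b 1)) * R) hnhds ?_ ?_ ?_ ?_ ?_ ?_).2.const_mul _
  · filter_upwards [hnhds] with s hs
    exact (hc s hs).aestronglyMeasurable
  · exact (hc t ht).intervalIntegrable _ _
  · exact ((h.continuous_timeDeriv ht).mul (continuous_mode a b _)).aestronglyMeasurable
  · refine Filter.Eventually.of_forall fun x _ s hs => ?_
    rw [norm_mul, norm_mode, mul_one]
    exact hbound s hs x
  · exact intervalIntegrable_const
  · exact Filter.Eventually.of_forall fun x _ s hs =>
      (h.differentiable_time s hs x).hasDerivAt.mul_const _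

theorem IsSolution.coeff_timeDeriv (hab : a < b) (h : IsSolution a b σ ε S ψ)
    (hψ : BoundedBy a b m S R ψ) (hm : 1 ≤ m) {t : ℝ} (ht : t ∈ Set.Ioo 0 S) (l : ℤ) :
    coeff a b (timeDeriv ψ t) l = -Complex.I * (((mu a b 1 * l) ^ 2 : ℝ) : ℂ) * coeff a b (ψ t) l
      + (-Complex.I * ((σ * ε ^ 2 : ℝ) : ℂ)) *
        Tri (fun _ _ _ => 1) (coeff a b (ψ t)) (coeff a b (ψ t)) (coeff a b (ψ t)) l := by
  have ht' : t ∈ Set.Icc 0 S := ⟨ht.1.le, ht.2.le⟩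
  have h1 := h.contDiff_space t ht'
  have h2 : Continuous (iteratedDeriv 2 (ψ t)) := h1.continuous_iteratedDeriv 2 le_rfl
  have h3 := h1.continuous
  rw [h.timeDeriv_eq ht, coeff_sub (by fun_prop) (by fun_prop), coeff_const_mul, coeff_const_mul,
    coeff_iteratedDeriv_two hab h1 (h.periodic t ht'), h.coeff_cubic hab hψ hm ht', ← mu_eq]
  push_cast
  ring

theorem exactFlow_of_solution (hab : a < b) (h : IsSolution a b σ ε S ψ)
    (hψ : BoundedBy a b m S R ψ) (hm : 3 ≤ m) :
    ExactFlow (mu a b 1) (σ * ε ^ 2) S m R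
      (fun t => twist (mu a b 1) t (coeff a b (ψ t))) := by
  have hm1 : 1 ≤ m := by omega
  set κ := mu a b 1 with hκd
  have hcont : ∀ l, ContinuousOn (fun t => coeff a b (ψ t) l) (Set.Icc 0 S) :=
    continuousOn_coeff (fun t ht => (h.contDiff_space t ht).continuous)
      (fun t ht x => h.norm_le hab hψ hm1 ht x) h.continuous_time
  have hcontT : ∀ l, ContinuousOn (fun t => Tri (fun _ _ _ => 1) (coeff a b (ψ t))
      (coeff a b (ψ t)) (coeff a b (ψ t)) l) (Set.Icc 0 S) := fun l => by
    have hA0 : ∀ t ∈ Set.Icc 0 S, 0 ≤ Real.sqrt (wtSum (mu a b 1)) * R := fun t ht =>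
      (norm_nonneg _).trans (h.norm_le hab hψ hm1 ht 0)
    refine (continuousOn_coeff (a := a) (b := b)
      (v := fun t x => ((‖ψ t x‖ ^ 2 : ℝ) : ℂ) * ψ t x)
      (A := (Real.sqrt (wtSum (mu a b 1)) * R) ^ 3) (fun t ht => ?_) (fun t ht x => ?_)
      (fun x => ?_) l).congr fun t ht => (h.coeff_cubic hab hψ hm1 ht l).symm
    · have := (h.contDiff_space t ht).continuous
      fun_prop
    · rw [norm_mul, Complex.norm_real, Real.norm_eq_abs, abs_of_nonneg (by positivity), ← pow_succ]
      exact pow_le_pow_left₀ (norm_nonneg _) (h.norm_le hab hψ hm1 ht x) 3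
    · have h1 := h.continuous_time x
      exact (Complex.continuous_ofReal.comp_continuousOn (h1.norm.pow 2)).mul h1
  have hTri : ∀ t l, Tri (phKer κ t) (twist κ t (coeff a b (ψ t))) (twist κ t (coeff a b (ψ t)))
      (twist κ t (coeff a b (ψ t))) l = twist κ t (Tri (fun _ _ _ => 1) (coeff a b (ψ t))
        (coeff a b (ψ t)) (coeff a b (ψ t))) l := fun t l => by
    have h1 : twist κ (-t) (twist κ t (coeff a b (ψ t))) = coeff a b (ψ t) := by
      simpa using twist_twist_neg κ (-t) (coeff a b (ψ t))
    rw [← twist_Tri, h1]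
  have hcontTri : ∀ l, ContinuousOn (fun t => Tri (phKer κ t) (twist κ t (coeff a b (ψ t)))
      (twist κ t (coeff a b (ψ t))) (twist κ t (coeff a b (ψ t))) l) (Set.Icc 0 S) := fun l => by
    simp only [hTri]
    exact (continuous_ph_mul _).continuousOn.mul (hcontT l)
  have hcontφ : ∀ l, ContinuousOn (fun t => twist κ t (coeff a b (ψ t)) l) (Set.Icc 0 S) :=
    fun l => (continuous_ph_mul _).continuousOn.mul (hcont l)
  refine ⟨fun t ht => (hψ.HB_coeff ht).twist t, hcontφ, hcontTri, fun s t hs hst ht l => ?_⟩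
  have hsub : Set.Icc s t ⊆ Set.Icc 0 S := Set.Icc_subset_Icc hs ht
  -- The equation holds for interior times only; continuity up to the end points is enough for the
  -- fundamental theorem of calculus.
  refine (intervalIntegral.integral_eq_sub_of_hasDerivAt_of_le hst ((hcontφ l).mono hsub)
    (fun r hr => ?_) ?_).symm
  · have hr' : r ∈ Set.Ioo 0 S := ⟨hs.trans_lt hr.1, hr.2.trans_le ht⟩
    have h1 := h.hasDerivAt_coeff hab hψ hm hr' l
    rw [h.coeff_timeDeriv hab hψ hm1 hr'] at h1
    have h2 := (hasDerivAt_ph_mul ((κ * l) ^ 2) r).mul h1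
    rw [hTri]
    unfold twist
    convert! h2 using 1
    rw [← hκd]
    ring
  · refine ContinuousOn.intervalIntegrable ?_
    rw [Set.uIcc_of_le hst]
    exact continuousOn_const.mul ((hcontTri l).mono hsub)

end solution

/-! ### The discrete Fourier transform -/

theorem sum_ph_range {N : ℕ} (hN : 0 < N) (k : ℤ) :
    ∑ j ∈ range N, ph (j * (2 * Real.pi * k / N)) = if (N : ℤ) ∣ k then (N : ℂ) else 0 := by
  have hN' : (N : ℝ) ≠ 0 := by exact_mod_cast hN.ne'
  split_ifs with hk
  · obtain ⟨n, rfl⟩ := hk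
    have : ∀ j ∈ range N, ph (j * (2 * Real.pi * ((N * n : ℤ) : ℝ) / N)) = 1 := fun j _ => by
      rw [← ph_int_mul_two_pi (j * n)]
      congr 1
      push_cast
      field_simp
    rw [Finset.sum_congr rfl this]
    simp
  · set ζ := ph (2 * Real.pi * k / N) with hζ
    have hpow : ∀ j : ℕ, ph (j * (2 * Real.pi * k / N)) = ζ ^ j := fun j => by
      rw [hζ, ph, ph, ← Complex.exp_nat_mul]
      congr 1; push_cast; ring
    simp only [hpow]
    have h1 : ζ ^ N = 1 := by
      rw [← hpow, ← ph_int_mul_two_pi k]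
      congr 1; field_simp
    have h2 : ζ ≠ 1 := fun h => by
      rw [hζ, ph, Complex.exp_eq_one_iff] at h
      obtain ⟨n, hn⟩ := h
      apply hk
      refine ⟨n, ?_⟩
      have h3 : (2 * Real.pi * k / N : ℝ) = n * (2 * Real.pi) := by
        have h4 : Complex.I * ((2 * Real.pi * k / N : ℝ) : ℂ)
            = Complex.I * ((n * (2 * Real.pi) : ℝ) : ℂ) := by rw [hn]; push_cast; ring
        exact_mod_cast mul_left_cancel₀ Complex.I_ne_zero h4
      have hπ := Real.pi_ne_zero
      have h5 : (k : ℝ) = N * n := by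
        field_simp at h3
        linarith
      exact_mod_cast h5
    rw [geom_sum_eq h2, h1, sub_self, zero_div]

theorem mode_gridPt {a b : ℝ} (hab : a < b) (N : ℕ) (l : ℤ) (j : ℕ) :
    mode a b l (gridPt a b N j) = ph (j * (2 * Real.pi * l / N)) := by
  have : b - a ≠ 0 := (sub_pos.mpr hab).ne'
  rw [mode_eq_ph, gridPt, mesh, mu]
  congr 1
  field_simp
  ring

theorem sum_mode_gridPt {a b : ℝ} (hab : a < b) {N : ℕ} (hN : 0 < N) (k l : ℤ) :
    (1 / (N : ℂ)) * ∑ j : Fin N, mode a b k (gridPt a b N j) * mode a b (-l) (gridPt a b N j)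
      = if (N : ℤ) ∣ k - l then 1 else 0 := by
  have hN' : (N : ℂ) ≠ 0 := by exact_mod_cast hN.ne'
  simp only [← mode_add]
  simp only [mode_gridPt hab]
  rw [Fin.sum_univ_eq_sum_range (fun j => ph (j * (2 * Real.pi * ((k + -l : ℤ) : ℝ) / N))) N,
    sum_ph_range hN, ← sub_eq_add_neg]
  split_ifs
  · rw [one_div, inv_mul_cancel₀ hN']
  · rw [mul_zero]

/-- The discrete coefficients of a grid function, extended by zero. -/
noncomputable def gridCoeff (a b : ℝ) (N : ℕ) (u : Fin (N + 1) → ℂ) (l : ℤ) : ℂ :=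
  if l ∈ freqs N then discCoeff a b N u l else 0

/-- The discrete coefficients of the samples of a Fourier series. -/
theorem gridCoeff_of_hasSum {a b : ℝ} (hab : a < b) {N : ℕ} (hN : 0 < N) {c : ℤ → ℂ}
    {u : Fin (N + 1) → ℂ}
    (hu : ∀ j : Fin N, HasSum (fun l => c l * mode a b l (gridPt a b N j)) (u j.castSucc)) :
    gridCoeff a b N u = aliased N c := by
  funext l
  unfold gridCoeff aliased
  split_ifs
  · have h1 : HasSum (fun k => (1 / (N : ℂ)) * ∑ j : Fin N, c k * mode a b k (gridPt a b N j)
        * mode a b (-l) (gridPt a b N j)) (discCoeff a b N u l) := by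
      unfold discCoeff
      exact (hasSum_sum fun j _ => (hu j).mul_right _).mul_left _
    have h2 : ∀ k, (1 / (N : ℂ)) * ∑ j : Fin N, c k * mode a b k (gridPt a b N j)
        * mode a b (-l) (gridPt a b N j) = if (N : ℤ) ∣ k - l then c k else 0 := fun k => by
      simp only [mul_assoc]
      rw [← Finset.mul_sum, mul_left_comm, sum_mode_gridPt hab hN]
      split_ifs <;> simp
    rw [funext h2] at h1
    rw [← h1.tsum_eq]
    have hinj : Function.Injective fun k : ℤ => l + k * (N : ℤ) := fun k k' hk => by
      simpa [hN.ne'] using hk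
    -- Orthogonality on the grid keeps exactly the frequencies congruent to $l$ modulo $N$, here
    -- parametrised by $l+kN$.
    rw [← hinj.tsum_eq (f := fun k => if (N : ℤ) ∣ k - l then c k else 0)]
    · refine tsum_congr fun k => ?_
      simp
    · intro k hk
      by_cases hd : (N : ℤ) ∣ k - l
      · obtain ⟨n, hn⟩ := hd
        exact ⟨n, by simp only; linarith⟩
      · simp [hd] at hk
  · rfl

theorem gridCoeff_of_support {N : ℕ} {u : Fin (N + 1) → ℂ} {a b : ℝ} :
    ∀ l ∉ freqs N, gridCoeff a b N u l = 0 := fun l hl => by simp [gridCoeff, hl]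

theorem aliased_of_support {N : ℕ} {c : ℤ → ℂ} (h : ∀ l ∉ freqs N, c l = 0) :
    aliased N c = c := by
  funext l
  unfold aliased
  split_ifs with hl
  · rw [tsum_eq_single 0]
    · simp
    · intro k hk
      refine h _ fun hl' => ?_
      rw [freqs, Finset.mem_Ico] at hl hl'
      rcases lt_or_gt_of_ne hk with h1 | h1
      · nlinarith [Int.natCast_nonneg N, Int.ediv_mul_le (N : ℤ) (show (2 : ℤ) ≠ 0 by norm_num)]
      · nlinarith [Int.natCast_nonneg N, Int.ediv_mul_le (N : ℤ) (show (2 : ℤ) ≠ 0 by norm_num)]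
  · exact (h l hl).symm

theorem hasSum_of_support {a b : ℝ} {N : ℕ} {c : ℤ → ℂ} (h : ∀ l ∉ freqs N, c l = 0) (x : ℝ) :
    HasSum (fun l => c l * mode a b l x) (∑ l ∈ freqs N, c l * mode a b l x) :=
  hasSum_sum_of_ne_finset_zero fun l hl => by rw [h l hl, zero_mul]

theorem gridCoeff_trigPoly {a b : ℝ} (hab : a < b) {N : ℕ} (hN : 0 < N) {c : ℤ → ℂ}
    (h : ∀ l ∉ freqs N, c l = 0) :
    gridCoeff a b N (fun j => ∑ l ∈ freqs N, c l * mode a b l (gridPt a b N j)) = c := by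
  rw [gridCoeff_of_hasSum hab hN (c := c), aliased_of_support h]
  intro j
  simpa using hasSum_of_support h (gridPt a b N j)

/-- Fourier coefficients of a trigonometric polynomial. -/
theorem coeff_trigPoly {a b : ℝ} (hab : a < b) {N : ℕ} {c : ℤ → ℂ}
    (h : ∀ l ∉ freqs N, c l = 0) :
    coeff a b (fun x => ∑ l ∈ freqs N, c l * mode a b l x) = c := by
  funext k
  have hone : ∀ l, coeff a b (mode a b l) k = if k = l then 1 else 0 := fun l => by
    -- Orthogonality of the modes follows from the rule for derivatives: $(\mu_l-\mu_k)$ times the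
    -- coefficient is zero.
    have h1 := coeff_deriv hab (fun x => hasDerivAt_mode a b l x)
      (continuous_const.mul (continuous_mode a b l)) ((mode_right hab l).trans (mode_left a b l).symm) k
    rw [coeff_const_mul] at h1
    split_ifs with hkl
    · subst hkl
      unfold coeff
      simp only [← mode_add, add_neg_cancel, mode_zero]
      have : ((b - a : ℝ) : ℂ) ≠ 0 := by exact_mod_cast (sub_pos.mpr hab).ne'
      rw [intervalIntegral.integral_const, Complex.real_smul, mul_one, one_div_mul_cancel this]
    · have h2 : Complex.I * ((mu a b l - mu a b k : ℝ) : ℂ) * coeff a b (mode a b l) k = 0 := by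
        push_cast; linear_combination h1
      have h3 : mu a b l - mu a b k ≠ 0 := by
        rw [mu_eq, mu_eq a b k, ← mul_sub]
        refine mul_ne_zero (mu_one_pos hab).ne' (sub_ne_zero.mpr ?_)
        exact_mod_cast Ne.symm hkl
      have h4 : Complex.I * ((mu a b l - mu a b k : ℝ) : ℂ) ≠ 0 :=
        mul_ne_zero Complex.I_ne_zero (by exact_mod_cast h3)
      exact (mul_eq_zero.mp h2).resolve_left h4
  have h1 := hasSum_coeff (a := a) (b := b) (ι := ℤ) (f := fun l x => c l * mode a b l x)
    (u := fun x => ∑ l ∈ freqs N, c l * mode a b l x) (B := fun l => ‖c l‖)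
    (fun l => continuous_const.mul (continuous_mode a b l))
    (summable_of_ne_finset_zero (s := freqs N) fun l hl => by rw [h l hl, norm_zero])
    (fun l x => by rw [norm_mul, norm_mode, mul_one]) (fun x => hasSum_of_support h x) k
  rw [← h1.tsum_eq]
  simp only [coeff_const_mul, hone]
  simp

theorem interp_eq (a b : ℝ) (N : ℕ) (u : Fin (N + 1) → ℂ) :
    interp a b N u = fun x => ∑ l ∈ freqs N, gridCoeff a b N u l * mode a b l x := by
  funext x
  exact Finset.sum_congr rfl fun l hl => by simp [gridCoeff, hl]

theorem coeff_interp {a b : ℝ} (hab : a < b) (N : ℕ) (u : Fin (N + 1) → ℂ) :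
    coeff a b (interp a b N u) = gridCoeff a b N u := by
  rw [interp_eq]
  exact coeff_trigPoly hab gridCoeff_of_support

theorem continuous_interp (a b : ℝ) (N : ℕ) (u : Fin (N + 1) → ℂ) :
    Continuous (interp a b N u) :=
  continuous_finsetSum _ fun l _ => continuous_const.mul (continuous_mode a b l)

theorem periodic_mode {a b : ℝ} (hab : a < b) (l : ℤ) : Function.Periodic (mode a b l) (b - a) :=
  fun x => by
    have h1 : mu a b l * (x + (b - a) - a) = mu a b l * (x - a) + l * (2 * Real.pi) := by
      have : b - a ≠ 0 := (sub_pos.mpr hab).ne'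
      unfold mu; field_simp; ring
    rw [mode_eq_ph, h1, ph_add, ph_int_mul_two_pi, mul_one, mode_eq_ph]

theorem periodic_interp {a b : ℝ} (hab : a < b) (N : ℕ) (u : Fin (N + 1) → ℂ) :
    Function.Periodic (interp a b N u) (b - a) := fun x => by
  unfold interp
  simp only [periodic_mode hab _ x]

/-- The interpolant takes the prescribed values on the grid. -/
theorem interp_gridPt {a b : ℝ} (hab : a < b) {N : ℕ} (hN : 0 < N) (hE : Even N)
    (u : Fin (N + 1) → ℂ) (j : Fin N) : interp a b N u (gridPt a b N j) = u j.castSucc := by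
  have hN' : (N : ℂ) ≠ 0 := by exact_mod_cast hN.ne'
  have hker : ∀ i : Fin N, ∑ l ∈ freqs N, mode a b (-l) (gridPt a b N i) *
      mode a b l (gridPt a b N j) = if i = j then (N : ℂ) else 0 := fun i => by
    obtain ⟨n, hn⟩ := hE
    have hfr : freqs N = (range N).image fun k : ℕ => (k : ℤ) - n := by
      ext l
      simp only [freqs, Finset.mem_Ico, Finset.mem_image, Finset.mem_range]
      constructor
      · intro hl
        exact ⟨(l + n).toNat, by omega, by omega⟩
      · rintro ⟨k, hk, rfl⟩
        omega
    rw [hfr, Finset.sum_image fun k _ k' _ h => by simpa using h]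
    set d : ℤ := (j : ℤ) - (i : ℤ) with hd
    have hterm : ∀ k ∈ range N, mode a b (-((k : ℤ) - n)) (gridPt a b N i) *
        mode a b ((k : ℤ) - n) (gridPt a b N j)
        = ph (-(n * (2 * Real.pi * d / N))) * ph (k * (2 * Real.pi * d / N)) := fun k _ => by
      rw [mode_gridPt hab, mode_gridPt hab, ← ph_add, ← ph_add, hd]
      congr 1
      push_cast
      ring
    rw [Finset.sum_congr rfl hterm, ← Finset.mul_sum, sum_ph_range hN]
    by_cases hij : i = j
    · subst hij
      simp [hd, ph_zero]
    · have : ¬ (N : ℤ) ∣ d := fun ⟨k, hk⟩ => by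
        have h1 := i.2
        have h2 := j.2
        have h3 : |d| < N := by rw [hd, abs_lt]; omega
        rw [hk, abs_mul, Nat.abs_cast] at h3
        have h4 : k = 0 := by
          by_contra hne
          nlinarith [Int.one_le_abs hne, (Nat.cast_pos.mpr hN : (0 : ℤ) < N)]
        rw [h4, mul_zero, hd] at hk
        exact hij (Fin.ext (by omega))
      simp [this, hij]
  unfold interp discCoeff
  calc ∑ l ∈ freqs N, (1 / (N : ℂ) * ∑ i : Fin N, u i.castSucc * mode a b (-l) (gridPt a b N i)) *
        mode a b l (gridPt a b N j)
      = 1 / (N : ℂ) * ∑ i : Fin N, u i.castSucc * ∑ l ∈ freqs N,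
          mode a b (-l) (gridPt a b N i) * mode a b l (gridPt a b N j) := by
        simp only [Finset.mul_sum, Finset.sum_mul]
        rw [Finset.sum_comm]
        refine Finset.sum_congr rfl fun i _ => Finset.sum_congr rfl fun l _ => ?_
        ring
    _ = u j.castSucc := by
        simp only [hker]
        simp only [mul_ite, mul_zero, Finset.sum_ite_eq', Finset.mem_univ, if_true]
        field_simp

theorem HB_gridCoeff (κ a b : ℝ) (N : ℕ) (u : Fin (N + 1) → ℂ) :
    HB κ 1 (partNorm κ 1 (freqs N) (gridCoeff a b N u)) (gridCoeff a b N u) :=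
  HB.of_support gridCoeff_of_support

/-- Discrete coefficients of a product on the grid. -/
theorem gridCoeff_triple {a b : ℝ} (hab : a < b) {N : ℕ} (hN : 0 < N) (hE : Even N)
    (u v w : Fin (N + 1) → ℂ) :
    gridCoeff a b N (fun j => u j * (starRingEnd ℂ) (v j) * w j)
      = aliased N (Tri (fun _ _ _ => 1) (gridCoeff a b N u) (gridCoeff a b N v)
          (gridCoeff a b N w)) := by
  have hκ := mu_one_pos hab
  have hs : ∀ u : Fin (N + 1) → ℂ, Summable fun l => ‖coeff a b (interp a b N u) l‖ := fun u => by
    rw [coeff_interp hab]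
    exact (HB_gridCoeff (mu a b 1) a b N u).summable_norm hκ le_rfl
  have hb : ∀ x, ‖interp a b N w x‖ ≤ _ := norm_le_of_HB hab (continuous_interp a b N w)
    (periodic_interp hab N w) le_rfl (by rw [coeff_interp hab]; exact HB_gridCoeff (mu a b 1) a b N w)
  have hcu := continuous_interp a b N u
  have hcv := continuous_interp a b N v
  have hcw := continuous_interp a b N w
  -- The grid product is the sampled product of the interpolants, whose Fourier coefficients are the
  -- convolution; sampling then aliases them.
  have h1 := coeff_triple hab hcu hcv hcw (periodic_interp hab N u) (periodic_interp hab N v)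
    (hs u) (hs v) hb
  rw [coeff_interp hab, coeff_interp hab, coeff_interp hab] at h1
  have h2 : Summable fun l => ‖coeff a b (fun x => interp a b N u x *
      (starRingEnd ℂ) (interp a b N v x) * interp a b N w x) l‖ := by
    simp only [h1]
    exact (HB.tri hκ le_rfl (KB_one _ 1) (HB_gridCoeff _ a b N u) (HB_gridCoeff _ a b N v)
      (HB_gridCoeff _ a b N w)).summable_norm hκ le_rfl
  refine gridCoeff_of_hasSum hab hN fun j => ?_
  have h3 := hasSum_mode hab ((hcu.mul (Complex.continuous_conj.comp hcv)).mul hcw)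
    (fun x => by
      simp only [Function.comp_apply, Pi.mul_apply, periodic_interp hab N _ x]) h2 (gridPt a b N j)
  have h4 : (fun x => interp a b N u x * (starRingEnd ℂ) (interp a b N v x) * interp a b N w x)
      (gridPt a b N j) = u j.castSucc * (starRingEnd ℂ) (v j.castSucc) * w j.castSucc := by
    simp only [interp_gridPt hab hN hE]
  rw [← h4]
  have h5 : (fun l => Tri (fun _ _ _ => 1) (gridCoeff a b N u) (gridCoeff a b N v)
      (gridCoeff a b N w) l * mode a b l (gridPt a b N j)) = fun l => coeff a b (fun x =>
      interp a b N u x * (starRingEnd ℂ) (interp a b N v x) * interp a b N w x) l *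
        mode a b l (gridPt a b N j) := by
    funext l; rw [h1]
  rw [h5]
  exact h3

/-! ### The splitting scheme as a sequence of frozen flows -/

theorem twist_zero (κ : ℝ) (c : ℤ → ℂ) : twist κ 0 c = c := by
  funext l; simp [twist, ph_zero]

theorem twist_of_support {κ t : ℝ} {N : ℕ} {c : ℤ → ℂ} (h : ∀ l ∉ freqs N, c l = 0) :
    ∀ l ∉ freqs N, twist κ t c l = 0 := fun l hl => by rw [twist, h l hl, mul_zero]

theorem gridCoeff_halfStep {a b : ℝ} (hab : a < b) {N : ℕ} (hN : 0 < N) (τ : ℝ)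
    (u : Fin (N + 1) → ℂ) :
    gridCoeff a b N (halfStep a b N τ u) = twist (mu a b 1) (-(τ / 2)) (gridCoeff a b N u) := by
  rw [← gridCoeff_trigPoly hab hN (twist_of_support (κ := mu a b 1) (t := -(τ / 2))
    (gridCoeff_of_support (a := a) (b := b) (u := u)))]
  congr 1
  funext j
  refine Finset.sum_congr rfl fun l hl => ?_
  rw [twist, gridCoeff, if_pos hl, ph, mu_eq a b l]
  congr 3
  push_cast
  ring

theorem norm_nonlinStep (N : ℕ) (σ ε τ : ℝ) (v : Fin (N + 1) → ℂ) (j : Fin (N + 1)) :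
    ‖nonlinStep N σ ε τ v j‖ = ‖v j‖ := by
  have : nonlinStep N σ ε τ v j = ph (-(σ * ε ^ 2 * τ * ‖v j‖ ^ 2)) * v j := by
    unfold nonlinStep ph; congr 2; push_cast; ring
  rw [this, norm_mul, norm_ph, one_mul]

theorem nonlinStep_zero (N : ℕ) (σ ε : ℝ) (v : Fin (N + 1) → ℂ) : nonlinStep N σ ε 0 v = v := by
  funext j; simp [nonlinStep]

theorem hasDerivAt_nonlinStep (N : ℕ) (σ ε s : ℝ) (v : Fin (N + 1) → ℂ) (j : Fin (N + 1)) :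
    HasDerivAt (fun s => nonlinStep N σ ε s v j) ((-Complex.I * ((σ * ε ^ 2 : ℝ) : ℂ)) *
      (nonlinStep N σ ε s v j * (starRingEnd ℂ) (nonlinStep N σ ε s v j) *
        nonlinStep N σ ε s v j)) s := by
  have h0 : ∀ s, nonlinStep N σ ε s v j = ph (s * (-(σ * ε ^ 2 * ‖v j‖ ^ 2))) * v j := fun s => by
    unfold nonlinStep ph; congr 2; push_cast; ring
  have h1 := (hasDerivAt_ph_mul (-(σ * ε ^ 2 * ‖v j‖ ^ 2)) s).mul_const (v j)
  have h2 : nonlinStep N σ ε s v j * (starRingEnd ℂ) (nonlinStep N σ ε s v j)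
      = ((‖v j‖ ^ 2 : ℝ) : ℂ) := by
    rw [Complex.mul_conj, Complex.normSq_eq_norm_sq, norm_nonlinStep]
  rw [h2]
  simp only [h0]
  convert! h1 using 1
  push_cast
  ring

theorem hasDerivAt_gridCoeff {a b : ℝ} {N : ℕ} {y : ℝ → Fin (N + 1) → ℂ} {y' : Fin (N + 1) → ℂ}
    {s : ℝ} (h : ∀ j, HasDerivAt (fun s => y s j) (y' j) s) (l : ℤ) :
    HasDerivAt (fun s => gridCoeff a b N (y s) l) (gridCoeff a b N y' l) s := by
  unfold gridCoeff discCoeff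
  split_ifs
  · exact (HasDerivAt.fun_sum fun j _ => (h _).mul_const _).const_mul _
  · exact hasDerivAt_const _ _

theorem gridCoeff_const_mul (a b : ℝ) (N : ℕ) (z : ℂ) (u : Fin (N + 1) → ℂ) (l : ℤ) :
    gridCoeff a b N (fun j => z * u j) l = z * gridCoeff a b N u l := by
  unfold gridCoeff discCoeff
  split_ifs
  · simp only [mul_assoc, ← Finset.mul_sum]; ring
  · simp

theorem gridTri_twist_gridCoeff {a b : ℝ} (hab : a < b) {N : ℕ} (hN : 0 < N) (hE : Even N) (t : ℝ)
    (u v w : Fin (N + 1) → ℂ) :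
    gridTri (mu a b 1) N t (twist (mu a b 1) t (gridCoeff a b N u))
      (twist (mu a b 1) t (gridCoeff a b N v)) (twist (mu a b 1) t (gridCoeff a b N w))
      = twist (mu a b 1) t (gridCoeff a b N (fun j => u j * (starRingEnd ℂ) (v j) * w j)) := by
  have h1 : ∀ c, twist (mu a b 1) (-t) (twist (mu a b 1) t c) = c := fun c => by
    simpa using twist_twist_neg (mu a b 1) (-t) c
  rw [gridTri, h1, h1, h1, gridCoeff_triple hab hN hE]

/-- The nonlinear step of the splitting scheme as a flow. -/
theorem frozenFlow_nonlinStep {a b : ℝ} (hab : a < b) {N : ℕ} (hN : 0 < N) (hE : Even N)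
    (σ ε t τ : ℝ) (v : Fin (N + 1) → ℂ) :
    FrozenFlow (mu a b 1) (σ * ε ^ 2) N t τ
      (fun s => twist (mu a b 1) t (gridCoeff a b N (nonlinStep N σ ε s v))) := by
  set κ := mu a b 1
  have hd : ∀ s l, HasDerivAt (fun s => twist κ t (gridCoeff a b N (nonlinStep N σ ε s v)) l)
      ((-Complex.I * ((σ * ε ^ 2 : ℝ) : ℂ)) * twist κ t (gridCoeff a b N (fun j =>
        nonlinStep N σ ε s v j * (starRingEnd ℂ) (nonlinStep N σ ε s v j) *
        nonlinStep N σ ε s v j)) l) s := fun s l => by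
    have h1 := (hasDerivAt_gridCoeff (a := a) (b := b)
      (fun j => hasDerivAt_nonlinStep N σ ε s v j) l).const_mul (ph (t * (κ * l) ^ 2))
    rw [gridCoeff_const_mul] at h1
    unfold twist
    convert! h1 using 1
    ring
  have hcT : ∀ l, Continuous fun s => twist κ t (gridCoeff a b N (fun j =>
        nonlinStep N σ ε s v j * (starRingEnd ℂ) (nonlinStep N σ ε s v j) *
        nonlinStep N σ ε s v j)) l := fun l => by
    have h0 : ∀ j, Continuous fun s => nonlinStep N σ ε s v j := fun j =>
      continuous_iff_continuousAt.mpr fun s => (hasDerivAt_nonlinStep N σ ε s v j).continuousAt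
    unfold twist gridCoeff discCoeff
    split_ifs
    · exact continuous_const.mul (continuous_const.mul (continuous_finsetSum _ fun j _ =>
        (((h0 _).mul (Complex.continuous_conj.comp (h0 _))).mul (h0 _)).mul continuous_const))
    · exact continuous_const
  refine ⟨fun s => twist_of_support gridCoeff_of_support, fun l => ?_, fun l => ?_, fun s _ => ?_,
    fun s hs l => ?_⟩
  · exact fun s _ => (hd s l).continuousAt.continuousWithinAt
  · simp only [κ, gridTri_twist_gridCoeff hab hN hE]
    exact (hcT l).continuousOn
  -- The nonlinear step preserves every modulus on the grid, so $|u_j|^2$ may be evaluated at time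
  -- zero; this is the property `linear`.
  · simp only [κ, gridTri_twist_gridCoeff hab hN hE]
    congr 2
    funext j
    rw [Complex.mul_conj, Complex.mul_conj, Complex.normSq_eq_norm_sq, Complex.normSq_eq_norm_sq,
      norm_nonlinStep, norm_nonlinStep]
  · simp only [κ, gridTri_twist_gridCoeff hab hN hE]
    exact (intervalIntegral.integral_eq_sub_of_hasDerivAt (fun r _ => hd r l)
      ((continuous_const.mul (hcT l)).intervalIntegrable _ _)).symm

/-- The discrete coefficients of the splitting scheme in the twisted variable. -/
noncomputable def tsfpCoeff (a b : ℝ) (N : ℕ) (σ ε τ : ℝ) (ψ₀ : ℝ → ℂ) (n : ℕ) : ℤ → ℂ :=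
  twist (mu a b 1) (n * τ) (gridCoeff a b N (tsfp a b N σ ε τ ψ₀ n))

theorem tsfpCoeff_zero {a b : ℝ} (hab : a < b) {N : ℕ} (hN : 0 < N) (σ ε τ : ℝ) {ψ₀ : ℝ → ℂ}
    (hc : Continuous ψ₀) (hp : Function.Periodic ψ₀ (b - a))
    (hs : Summable fun l => ‖coeff a b ψ₀ l‖) :
    tsfpCoeff a b N σ ε τ ψ₀ 0 = aliased N (twist (mu a b 1) 0 (coeff a b ψ₀)) := by
  rw [tsfpCoeff, Nat.cast_zero, zero_mul, twist_zero, twist_zero]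
  refine gridCoeff_of_hasSum hab hN fun j => ?_
  exact hasSum_mode hab hc hp hs _

/-- A half step is a twist by $-\tau/2$. Combined with the twists at $n\tau$ and $(n+1)\tau$, it
places both ends of the nonlinear step at the common midpoint time, so the scheme too has no linear
part left. -/
theorem exists_frozenFlow_tsfp {a b : ℝ} (hab : a < b) {N : ℕ} (hN : 0 < N) (hE : Even N)
    (σ ε τ : ℝ) (ψ₀ : ℝ → ℂ) (n : ℕ) :
    ∃ χ, FrozenFlow (mu a b 1) (σ * ε ^ 2) N (n * τ + τ / 2) τ χ ∧
      χ 0 = tsfpCoeff a b N σ ε τ ψ₀ n ∧ χ τ = tsfpCoeff a b N σ ε τ ψ₀ (n + 1) := by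
  refine ⟨_, frozenFlow_nonlinStep hab hN hE σ ε (n * τ + τ / 2) τ
    (halfStep a b N τ (tsfp a b N σ ε τ ψ₀ n)), ?_, ?_⟩
  · simp only [nonlinStep_zero, gridCoeff_halfStep hab hN]
    rw [twist_add]
    unfold tsfpCoeff
    congr 1
    ring
  · unfold tsfpCoeff
    rw [tsfp, gridCoeff_halfStep hab hN, twist_add]
    congr 1
    push_cast
    ring

/-! ### Constants and the final error bound -/

theorem mu_mul_mesh {a b : ℝ} (hab : a < b) {N : ℕ} (hN : 0 < N) :
    mu a b 1 * N * mesh a b N = 2 * Real.pi := by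
  have h1 : b - a ≠ 0 := (sub_pos.mpr hab).ne'
  have h2 : (N : ℝ) ≠ 0 := by exact_mod_cast hN.ne'
  unfold mu mesh
  push_cast
  field_simp

theorem nonresConst_pos {a b α ν : ℝ} (hab : a < b) (hα : 0 < α) (hν : 0 < ν) :
    0 < nonresConst a b α ν := by
  have hs : Summable fun k : ℕ => 1 / ((k : ℝ) + 1) ^ (1 + ν) := by
    have := (summable_nat_add_iff 1).mpr
      (Real.summable_one_div_nat_rpow.mpr (show 1 < 1 + ν by linarith))
    simpa using this
  have h1 : 0 < ∑' k : ℕ, 1 / ((k : ℝ) + 1) ^ (1 + ν) :=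
    hs.tsum_pos (fun k => by positivity) 0 (by positivity)
  have := mu_one_pos hab
  unfold nonresConst
  positivity

theorem AbelBound.mono {κ τ B B' : ℝ} {n : ℤ} {m : ℕ} (h : AbelBound κ τ n m B) (hB : B ≤ B') :
    AbelBound κ τ n m B' := fun p q r hl hr => by
  have hM : 0 ≤ jbMax κ p q r ^ m := pow_nonneg (by linarith [one_le_jbMax κ p q r]) m
  refine (h p q r hl hr).trans ?_
  gcongr

/-- The factor $(1+\tau_0)^2/\tau_0^2$ in the step condition is exactly what
$\lceil1/\tau_0\rceil\le(1+\tau_0)/\tau_0$ requires. -/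
theorem abelBound_of_smallStep {a b α τ₀ τ : ℝ} (hab : a < b) (hα₀ : 0 < α) (hα₁ : α < 1)
    (hτ₀ : 0 < τ₀) (h : SmallStep a b α τ₀ τ) {m : ℕ} (hm : 3 ≤ m) :
    AbelBound (mu a b 1) τ ⌈1 / τ₀⌉ m (30 * (α * Real.pi / (4 * Real.sin (α * Real.pi)))) := by
  have hκ := mu_one_pos hab
  refine abelBound_of_small h.1 hα₀ hα₁ ?_ hm hκ
  have h1 : ((⌈1 / τ₀⌉ : ℤ) : ℝ) ≤ (1 + τ₀) / τ₀ := by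
    have := Int.ceil_lt_add_one (1 / τ₀)
    rw [add_div, div_self hτ₀.ne']
    exact this.le
  have h0 : (0 : ℝ) ≤ ((⌈1 / τ₀⌉ : ℤ) : ℝ) :=
    le_trans (by positivity) (Int.le_ceil (1 / τ₀))
  have h2 := h.2.le
  calc τ * mu a b 1 ^ 2 * ((⌈1 / τ₀⌉ : ℤ) : ℝ) ^ 2
      ≤ (α * (Real.pi / (mu a b 1 ^ 2 * (1 + τ₀) ^ 2)) * τ₀ ^ 2) * mu a b 1 ^ 2
          * ((1 + τ₀) / τ₀) ^ 2 := by
        have := Real.pi_pos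
        gcongr
    _ = α * Real.pi := by
        have : 1 + τ₀ ≠ 0 := by positivity
        field_simp

/-- The coefficient of `ε²τ²` in the global error. -/
noncomputable def splitC (κ R T B : ℝ) (m : ℕ) : ℝ :=
  (6 * R + 9 * (T * (3 ^ (m + 1) * wtSum κ * R ^ 3))) * (B * wtSum κ * R ^ 2) + T * timeC κ R m

theorem splitC_nonneg {κ R T B : ℝ} (hR : 0 ≤ R) (hT : 0 ≤ T) (hB : 0 ≤ B) (m : ℕ) :
    0 ≤ splitC κ R T B m := by
  have := timeC_nonneg κ hR m
  have := wtSum_nonneg κ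
  unfold splitC; positivity

/-- The coefficient of `h ^ (m - 1)` in the global error. -/
noncomputable def meshC (κ R T : ℝ) (m : ℕ) : ℝ := aliasConst κ * R + 2 * T * spaceC κ R m

theorem meshC_nonneg {κ R T : ℝ} (hR : 0 ≤ R) (hT : 0 ≤ T) (m : ℕ) : 0 ≤ meshC κ R T m := by
  have := aliasConst_nonneg κ
  have := spaceC_nonneg κ hR m
  unfold meshC; positivity

/-- The coefficient of `τ₀ ^ (m - 1)` in the global error. -/
noncomputable def cutoffC (κ R T : ℝ) (m : ℕ) : ℝ :=
  T * (18 * (3 / κ) ^ (m - 1) * wtSum κ * R ^ 3)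

theorem cutoffC_nonneg {κ R T : ℝ} (hκ : 0 < κ) (hR : 0 ≤ R) (hT : 0 ≤ T) (m : ℕ) :
    0 ≤ cutoffC κ R T m := by
  have := wtSum_nonneg κ
  unfold cutoffC; positivity

theorem BoundedBy.hNorm_one_le_supH1 {a b S R : ℝ} {m : ℕ} {ψ : ℝ → ℝ → ℂ}
    (hψ : BoundedBy a b m S R ψ) (hm : 1 ≤ m) {t : ℝ} (ht : t ∈ Set.Icc 0 S) :
    hNorm a b 1 (ψ t) ≤ supH1 a b S ψ := by
  refine le_ciSup (f := fun t : Set.Icc (0 : ℝ) S => hNorm a b 1 (ψ t)) ⟨R, ?_⟩ ⟨t, ht⟩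
  rintro _ ⟨s, rfl⟩
  exact ((hψ.HB_coeff s.2).of_le hm).hNorm_le

theorem MemHper.of_le {a b : ℝ} {s s' : ℕ} {u : ℝ → ℂ} (h : MemHper a b s' u) (hs : s ≤ s') :
    MemHper a b s u := by
  refine ⟨h.1, h.2.1, h.2.2.of_nonneg_of_le (fun l => by positivity) fun l => ?_⟩
  gcongr
  nlinarith [sq_nonneg (mu a b l)]

theorem BoundedBy.mono {a b S R R' : ℝ} {m : ℕ} {ψ : ℝ → ℝ → ℂ} (h : BoundedBy a b m S R ψ)
    (hR : R ≤ R') : BoundedBy a b m S R' ψ :=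
  ⟨fun t ht => ⟨(h.1 t ht).1, (h.1 t ht).2.trans hR⟩,
    fun t ht => ⟨(h.2 t ht).1, (h.2 t ht).2.trans hR⟩⟩

theorem mul_pow_le_third {C x : ℝ} (hC : 1 ≤ C) (hx : 0 < x) (hx' : x ≤ 1 / (3 * C)) {k : ℕ}
    (hk : k ≠ 0) : C * x ^ k ≤ 1 / 3 := by
  have h1 : 1 / (3 * C) ≤ 1 := by rw [div_le_one (by positivity)]; linarith
  have h2 : x ^ k ≤ x := pow_le_of_le_one hx.le (hx'.trans h1) hk
  rw [le_div_iff₀ (by positivity)] at hx'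
  nlinarith

/-- Both quantities are controlled by $x=\varepsilon\tau\le1$, since $x^2\le x$ and
$\varepsilon^2\tau\le x$; this is why the restriction reads $\tau\le\tau_1/\varepsilon$. -/
theorem timeStep_small {D L ε τ : ℝ} (hD : 1 ≤ D) (hL : 0 ≤ L) (hε : 0 < ε) (hε1 : ε ≤ 1)
    (hτ : 0 < τ) (hτ₁ : τ ≤ 1 / (3 * D + 2 * L) / ε) :
    D * (ε ^ 2 * τ ^ 2) ≤ 1 / 3 ∧ ε ^ 2 * τ * L ≤ 1 / 2 := by
  have hden : 0 < 3 * D + 2 * L := by positivity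
  rw [le_div_iff₀ hε, le_div_iff₀ hden] at hτ₁
  obtain ⟨x, hx⟩ : ∃ x, x = ε * τ := ⟨_, rfl⟩
  have hx0 : 0 < x := by rw [hx]; positivity
  have hxL : 0 ≤ x * L := by positivity
  have hxD : 0 ≤ x * D := by positivity
  have h1 : 3 * (x * D) + 2 * (x * L) ≤ 1 := by rw [hx]; linarith
  have hx1 : x ≤ 1 := by nlinarith
  constructor
  · calc D * (ε ^ 2 * τ ^ 2) = x * D * x := by rw [hx]; ring
      _ ≤ x * D := mul_le_of_le_one_right hxD hx1
      _ ≤ 1 / 3 := by linarith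
  · calc ε ^ 2 * τ * L = ε * (x * L) := by rw [hx]; ring
      _ ≤ x * L := mul_le_of_le_one_left hxL hε1
      _ ≤ 1 / 2 := by linarith

theorem totalC_mul_le {κ R T B h τ₀ G E C₁ C₂ C₃ : ℝ} {m : ℕ} (hh : 0 ≤ h) (hτ₀ : 0 ≤ τ₀)
    (hG : 0 ≤ G) (h₁ : meshC κ R T m * E ≤ C₁) (h₂ : cutoffC κ R T m * E ≤ C₂)
    (h₃ : splitC κ R T B m * E ≤ C₃) :
    totalC κ R T B h τ₀ G m * E ≤ C₁ * h ^ (m - 1) + C₂ * τ₀ ^ (m - 1) + C₃ * G := by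
  have heq : totalC κ R T B h τ₀ G m * E = meshC κ R T m * E * h ^ (m - 1)
      + cutoffC κ R T m * E * τ₀ ^ (m - 1) + splitC κ R T B m * E * G := by
    unfold totalC meshC cutoffC splitC; ring
  rw [heq]
  gcongr

/-- The error estimate for a cutoff at which the low frequency defects are summable by parts. -/
theorem tsfp_error {a b σ ε T R B C D τ₀ τ : ℝ} (hab : a < b) (hσ : |σ| = 1) {m : ℕ} (hm : 3 ≤ m)
    (hT : 0 < T) (hR : 0 ≤ R) (hB : 0 ≤ B) (hC : 1 ≤ C) (hD : 1 ≤ D)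
    (hCh : R + meshC (mu a b 1) R T m * Real.exp (2 * lipC (mu a b 1) R * T) ≤ C)
    (hCt : cutoffC (mu a b 1) R T m * Real.exp (2 * lipC (mu a b 1) R * T) ≤ C)
    (hDt : splitC (mu a b 1) R T B m * Real.exp (2 * lipC (mu a b 1) R * T) ≤ D)
    (hτ₀ : 0 < τ₀) (hτ₀' : τ₀ ≤ 1 / (3 * C)) (hε : 0 < ε) (hε1 : ε ≤ 1) {ψ : ℝ → ℝ → ℂ}
    (hs : IsSolution a b σ ε (T / ε ^ 2) ψ) (hψ : BoundedBy a b m (T / ε ^ 2) R ψ) {N : ℕ}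
    (hE : Even N) (hN : 0 < N) (hh : mesh a b N < 1 / (3 * C)) (hτ : 0 < τ)
    (hτ₁ : τ ≤ 1 / (3 * D + 2 * lipC (mu a b 1) R) / ε)
    (hAB : AbelBound (mu a b 1) τ ⌈1 / τ₀⌉ m B) (n : ℕ) (hn : n * τ ≤ T / ε ^ 2) :
    hNorm a b 1 (fun x => ψ (n * τ) x - interp a b N (tsfp a b N σ ε τ (ψ 0) n) x)
        ≤ C * (mesh a b N ^ (m - 1) + τ₀ ^ (m - 1)) + D * (ε ^ 2 * τ ^ 2) ∧
      hNorm a b 1 (interp a b N (tsfp a b N σ ε τ (ψ 0) n)) ≤ 1 + supH1 a b (T / ε ^ 2) ψ := by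
  have hκ := mu_one_pos hab
  have hhN := mu_mul_mesh hab hN
  have hh0 := mesh_pos_of_mul_eq hκ hN hhN
  have hL := lipC_nonneg (mu a b 1) R
  have hg : |σ * ε ^ 2| = ε ^ 2 := by rw [abs_mul, hσ, one_mul, abs_of_nonneg (sq_nonneg ε)]
  have hε2 : ε ^ 2 ≠ 0 := by positivity
  have hgT : |σ * ε ^ 2| * (T / ε ^ 2) = T := by rw [hg, mul_div_cancel₀ _ hε2]
  have hS0 : 0 ≤ T / ε ^ 2 := by positivity
  obtain ⟨hG, hsmall⟩ := timeStep_small hD hL hε hε1 hτ hτ₁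
  rw [← hg] at hsmall
  have hle : totalC (mu a b 1) R T B (mesh a b N) τ₀ (|σ * ε ^ 2| * τ ^ 2) m *
      Real.exp (2 * lipC (mu a b 1) R * T)
      -- The amount $R\,h^{m-1}$ is held back for the truncation error of the exact solution.
      ≤ (C - R) * mesh a b N ^ (m - 1) + C * τ₀ ^ (m - 1) + D * (ε ^ 2 * τ ^ 2) := by
    rw [hg]
    exact totalC_mul_le hh0.le hτ₀.le (by positivity) (le_sub_iff_add_le'.mpr hCh) hCt hDt
  have hsize : totalC (mu a b 1) R T B (mesh a b N) τ₀ (|σ * ε ^ 2| * τ ^ 2) m *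
      Real.exp (2 * lipC (mu a b 1) R * T) ≤ 1 := by
    -- The contributions of mesh, cut-off and time step are each at most 1/3, which gives the bound
    -- 1 that `global_error` needs.
    have h1 := mul_pow_le_third hC hh0 hh.le (show m - 1 ≠ 0 by omega)
    have h2 := mul_pow_le_third hC hτ₀ hτ₀' (show m - 1 ≠ 0 by omega)
    have h3 : 0 ≤ R * mesh a b N ^ (m - 1) := by positivity
    linarith
  have hφ := exactFlow_of_solution hab hs hψ hm
  have h0 : (0 : ℝ) ∈ Set.Icc 0 (T / ε ^ 2) := ⟨le_rfl, hS0⟩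
  have hmain := global_error (η := tsfpCoeff a b N σ ε τ (ψ 0)) hκ hE hN hhN hm hφ hR hτ.le hS0
    hgT.le hsmall hτ₀ (Int.le_ceil (1 / τ₀)) hB hAB
    (tsfpCoeff_zero hab hN σ ε τ (hs.contDiff_space 0 h0).continuous (hs.periodic 0 h0)
      ((hψ.HB_coeff h0).summable_norm hκ (by omega)))
    (fun k _ => exists_frozenFlow_tsfp hab hN hE σ ε τ (ψ 0) k) hsize n hn
  have ht : (n : ℝ) * τ ∈ Set.Icc 0 (T / ε ^ 2) := ⟨by positivity, hn⟩
  set c := coeff a b (ψ (n * τ)) with hc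
  set d := gridCoeff a b N (tsfp a b N σ ε τ (ψ 0) n) with hd
  have hdiff : HB (mu a b 1) 1 (totalC (mu a b 1) R T B (mesh a b N) τ₀ (|σ * ε ^ 2| * τ ^ 2) m *
      Real.exp (2 * lipC (mu a b 1) R * T)) (fun l => d l - trunc N c l) := by
    refine hmain.of_norm_le_one fun l => le_of_eq ?_
    have h1 : tsfpCoeff a b N σ ε τ (ψ 0) n = twist (mu a b 1) (n * τ) d := rfl
    simp only [h1, ← twist_trunc, twist_sub, norm_twist]
  constructor
  · refine HB.hNorm_le ?_
    have h1 : coeff a b (fun x => ψ (n * τ) x - interp a b N (tsfp a b N σ ε τ (ψ 0) n) x)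
        = fun l => -((d l - trunc N c l) + (trunc N c l - c l)) := by
      funext l
      rw [coeff_sub (hs.contDiff_space _ ht).continuous (continuous_interp a b N _),
        coeff_interp hab]
      ring
    rw [h1]
    refine ((hdiff.add ((hψ.HB_coeff ht).trunc_sub hκ hE hN hhN (by omega))).neg).mono ?_
    linarith
  · refine HB.hNorm_le ?_
    have h1 : coeff a b (interp a b N (tsfp a b N σ ε τ (ψ 0) n))
        = fun l => (d l - trunc N c l) + trunc N c l := by
      funext l; rw [coeff_interp hab]; ring
    rw [h1]
    have h2 := ((hψ.1 _ ht).1.of_le (s := 1) (by omega)).HB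
    exact (hdiff.add (h2.trunc N)).mono
      (add_le_add hsize (hψ.hNorm_one_le_supH1 (by omega) ht))

end NLSTSFP

open NLSTSFP in
theorem mainTheorem3 (a b : ℝ) (hab : a < b) (σ : ℝ) (hσ : σ = 1 ∨ σ = -1)
    (m : ℕ) (hm : 5 ≤ m) (T : ℝ) (hT : 0 < T) (R : ℝ)
    (α : ℝ) (hα₀ : 0 < α) (hα₁ : α < 1) (ν : ℝ) (hν : 0 < ν) :
    -- error bound with all constants independent of `τ₀`, `ε`, `h`, `τ`, `n` and the solution
    (∃ C h₀ τbar τ₁ : ℝ, 0 < C ∧ 0 < h₀ ∧ 0 < τbar ∧ τbar < 1 ∧ 0 < τ₁ ∧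
      ∀ τ₀ : ℝ, 0 < τ₀ → τ₀ ≤ τbar →
      ∀ ε : ℝ, 0 < ε → ε ≤ 1 →
      ∀ ψ : ℝ → ℝ → ℂ, IsSolution a b σ ε (T / ε ^ 2) ψ → BoundedBy a b m (T / ε ^ 2) R ψ →
      ∀ N : ℕ, Even N → 0 < N → mesh a b N < h₀ →
      ∀ τ : ℝ, 0 < τ → τ ≤ τ₁ / ε →
      (SmallStep a b α τ₀ τ ∨
        (NonResonantStep a b α ν τ₀ τ ∧ 5 + ν ≤ (m : ℝ) ∧ 3 + 2 * ν ≤ (m : ℝ))) →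
      ∀ n : ℕ, (n : ℝ) * τ ≤ T / ε ^ 2 →
        hNorm a b 1 (fun x => ψ (n * τ) x - interp a b N (tsfp a b N σ ε τ (ψ 0) n) x)
            ≤ C * (mesh a b N ^ (m - 1) + ε ^ 2 * τ ^ 2 + τ₀ ^ (m - 1)) ∧
        hNorm a b 1 (interp a b N (tsfp a b N σ ε τ (ψ 0) n)) ≤ 1 + supH1 a b (T / ε ^ 2) ψ) ∧
    -- non-resonant steps under `5 + ν ≤ m` alone: only `τ₁` and the coefficient `D` of `ε²τ²`
    -- may depend on `τ₀`
    (5 + ν ≤ (m : ℝ) →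
      ∃ C h₀ τbar : ℝ, 0 < C ∧ 0 < h₀ ∧ 0 < τbar ∧ τbar < 1 ∧
      ∀ τ₀ : ℝ, 0 < τ₀ → τ₀ ≤ τbar →
      ∃ D τ₁ : ℝ, 0 < D ∧ 0 < τ₁ ∧
      ∀ ε : ℝ, 0 < ε → ε ≤ 1 →
      ∀ ψ : ℝ → ℝ → ℂ, IsSolution a b σ ε (T / ε ^ 2) ψ → BoundedBy a b m (T / ε ^ 2) R ψ →
      ∀ N : ℕ, Even N → 0 < N → mesh a b N < h₀ →
      ∀ τ : ℝ, 0 < τ → τ ≤ τ₁ / ε →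
      NonResonantStep a b α ν τ₀ τ →
      ∀ n : ℕ, (n : ℝ) * τ ≤ T / ε ^ 2 →
        hNorm a b 1 (fun x => ψ (n * τ) x - interp a b N (tsfp a b N σ ε τ (ψ 0) n) x)
            ≤ C * (mesh a b N ^ (m - 1) + τ₀ ^ (m - 1)) + D * (ε ^ 2 * τ ^ 2) ∧
        hNorm a b 1 (interp a b N (tsfp a b N σ ε τ (ψ 0) n)) ≤
          1 + supH1 a b (T / ε ^ 2) ψ) := by
  have hκ := mu_one_pos hab
  have hσ' : |σ| = 1 := by rcases hσ with rfl | rfl <;> simp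
  have hlam := nonresConst_pos hab hα₀ hν
  -- The constants are built from `|R|`, so that they are nonnegative for every real `R`.
  have hR : (0 : ℝ) ≤ |R| := abs_nonneg R
  have hm3 : 3 ≤ m := by omega
  have hE := Real.exp_pos (2 * lipC (mu a b 1) |R| * T)
  have hL := lipC_nonneg (mu a b 1) |R|
  have hmC := mul_nonneg (meshC_nonneg (κ := mu a b 1) hR hT.le m) hE.le
  have hcC := mul_nonneg (cutoffC_nonneg hκ hR hT.le m) hE.le
  have hceil : ∀ τ₀ : ℝ, 0 < τ₀ → 1 ≤ ⌈1 / τ₀⌉ := fun τ₀ h =>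
    Int.one_le_ceil_iff.mpr (by positivity)
  have hlt : ∀ C : ℝ, 1 ≤ C → 1 / (3 * C) < 1 := fun C hC => by
    rw [div_lt_one (by positivity)]; linarith
  constructor
  · have hBs : 0 ≤ 30 * (α * Real.pi / (4 * Real.sin (α * Real.pi))) := by
      have := Real.pi_pos
      have := Real.sin_pos_of_pos_of_lt_pi (show 0 < α * Real.pi by positivity) (by nlinarith)
      positivity
    have hBn : 0 ≤ 3 * 10 ^ (1 + ν) *
        (Real.pi * (mu a b 1 ^ 2) ^ (2 + ν) / nonresConst a b α ν ^ 2) := by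
      have := Real.pi_pos
      positivity
    set Bs := 30 * (α * Real.pi / (4 * Real.sin (α * Real.pi)))
    set Bn := 3 * 10 ^ (1 + ν) * (Real.pi * (mu a b 1 ^ 2) ^ (2 + ν) / nonresConst a b α ν ^ 2)
    have hsC := mul_nonneg
      (splitC_nonneg (κ := mu a b 1) hR hT.le (add_nonneg hBs hBn) m) hE.le
    -- One constant dominates the three error coefficients and fixes the thresholds $1/(3C)$. The
    -- sum `Bs + Bn` serves both kinds of step sizes.
    obtain ⟨C, hC⟩ : ∃ C, C = |R| + meshC (mu a b 1) |R| T m *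
        Real.exp (2 * lipC (mu a b 1) |R| * T) + cutoffC (mu a b 1) |R| T m *
        Real.exp (2 * lipC (mu a b 1) |R| * T) + splitC (mu a b 1) |R| T (Bs + Bn) m *
        Real.exp (2 * lipC (mu a b 1) |R| * T) + 1 := ⟨_, rfl⟩
    have hC1 : 1 ≤ C := by linarith
    refine ⟨C, 1 / (3 * C), 1 / (3 * C), 1 / (3 * C + 2 * lipC (mu a b 1) |R|), by linarith,
      by positivity, by positivity, hlt C hC1, by positivity, ?_⟩
    intro τ₀ hτ₀ hτ₀' ε hε hε1 ψ hs hψ N hN hN0 hh τ hτ hτ₁ hcond n hn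
    have hAB : AbelBound (mu a b 1) τ ⌈1 / τ₀⌉ m (Bs + Bn) := by
      rcases hcond with hS | ⟨hNR, -, hm'⟩
      · exact (abelBound_of_smallStep hab hα₀ hα₁ hτ₀ hS hm3).mono (by linarith)
      · exact (abelBound_of_nonres hκ hτ hlam hν (hceil τ₀ hτ₀) hNR.2 hm').mono (by linarith)
    obtain ⟨h1, h2⟩ := tsfp_error hab hσ' hm3 hT hR (add_nonneg hBs hBn) hC1 hC1
      (by linarith) (by linarith) (by linarith) hτ₀ hτ₀' hε hε1 hs (hψ.mono (le_abs_self R)) hN hN0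
      hh hτ hτ₁ hAB n hn
    exact ⟨h1.trans (le_of_eq (by ring)), h2⟩
  · intro _
    obtain ⟨C, hC⟩ : ∃ C, C = |R| + meshC (mu a b 1) |R| T m *
        Real.exp (2 * lipC (mu a b 1) |R| * T) + cutoffC (mu a b 1) |R| T m *
        Real.exp (2 * lipC (mu a b 1) |R| * T) + 1 := ⟨_, rfl⟩
    have hC1 : 1 ≤ C := by linarith
    refine ⟨C, 1 / (3 * C), 1 / (3 * C), by linarith, by positivity, by positivity, hlt C hC1, ?_⟩
    intro τ₀ hτ₀ hτ₀'
    have hn1 := hceil τ₀ hτ₀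
    have hB : 0 ≤ 3 * (mu a b 1 ^ 2 * (2 * ((⌈1 / τ₀⌉ : ℤ) : ℝ) ^ 2)) ^ (1 + ν) *
        (Real.pi * (mu a b 1 ^ 2) ^ (2 + ν) / nonresConst a b α ν ^ 2) := by
      have := Real.pi_pos
      positivity
    -- This depends on $\tau_0$ and enters only `splitC`, hence only `D` and the bound on $\tau$;
    -- `C` was fixed before $\tau_0$.
    set B := 3 * (mu a b 1 ^ 2 * (2 * ((⌈1 / τ₀⌉ : ℤ) : ℝ) ^ 2)) ^ (1 + ν) *
        (Real.pi * (mu a b 1 ^ 2) ^ (2 + ν) / nonresConst a b α ν ^ 2)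
    have hsC := mul_nonneg (splitC_nonneg (κ := mu a b 1) hR hT.le hB m) hE.le
    obtain ⟨D, hD⟩ : ∃ D, D = splitC (mu a b 1) |R| T B m *
        Real.exp (2 * lipC (mu a b 1) |R| * T) + 1 := ⟨_, rfl⟩
    have hD1 : 1 ≤ D := by linarith
    refine ⟨D, 1 / (3 * D + 2 * lipC (mu a b 1) |R|), by linarith, by positivity, ?_⟩
    intro ε hε hε1 ψ hs hψ N hN hN0 hh τ hτ hτ₁ hNR n hn
    exact tsfp_error hab hσ' hm3 hT hR hB hC1 hD1 (by linarith) (by linarith) (by linarith) hτ₀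
      hτ₀' hε hε1 hs (hψ.mono (le_abs_self R)) hN hN0 hh hτ hτ₁
      (abelBound_of_nonres' hκ hτ hlam hν hn1 hNR.2 (by omega)) n hn
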